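/- **Setting.** Let $\mathrm{Cat}$ be the 2-category of small categories, $\mathrm{CAT}$ that of locally small categories, and $J:\mathrm{Cat}\to\mathrm{CAT}$ the inclusion. Both are 2-multicategories: the hom-category $\mathrm{CAT}(B_1,\dots,B_n;Z)$, $n\ge 0$, is the category of functors $B_1\times\dots\times B_n\to Z$ and natural transformations, composition is substitution, and $\mathrm{Cat}$ is the full sub-2-multicategory on the small categories. For $f:B_1,\dots,B_n\to Z$ and a map $g$ into $B_j$, $f\circ_j g$ denotes substitution of $g$ in the $j$-th argument. For small $X$ let $\mathrm{Psh}X=[X^{op},\mathrm{Set}]$ and let $y_X:X\to\mathrm{Psh}X$ be the Yoneda embedding. Throughout, $T:\mathrm{ob}\,\mathrm{Cat}\to\mathrm{ob}\,\mathrm{CAT}$ is a function with functors $i_X:X\to TX$ (for presheaves, $T=\mathrm{Psh}$ and $i=y$). **Relative pseudomonad** $(T,i,{}^*;\eta,\mu,\theta)$ along $J$: functors $(-)^*:\mathrm{CAT}(X,TY)\to\mathrm{CAT}(TX,TY)$ with natural families of invertible 2-cells $\eta_f:f\to f^*i$, $\mu_{f,g}:(f^*g)^*\to f^*g^*$, $\theta_X:i_X^*\to1_{TX}$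 such that $(f^*\mu_{g,h})\cdot\mu_{f,g^*h}\cdot(\mu_{f,g}h)^*=(\mu_{f,g}h^*)\cdot\mu_{f^*g,h}$ and $(f^*\theta)\cdot\mu_{f,i}\cdot(\eta_f)^*=1_{f^*}$. **Strong relative pseudomonad** $(T,i,{}^t;\tilde t,\hat t,\theta)$ along $J$: for each argument position and all other arguments $B_k\in\mathrm{CAT}$, strengthening functors $$(-)^t:\mathrm{CAT}(B_1,\dots,X,\dots,B_n;TY)\to\mathrm{CAT}(B_1,\dots,TX,\dots,B_n;TY),\qquad X,Y\in\mathrm{Cat},$$ pseudonatural in the other arguments (that is, with coherent natural invertible 2-cells $(f\circ S)^t\cong f^t\circ S$ for substitutions $S$ in the arguments $B_k$), together with families of invertible 2-cells, natural in $f$ and $g$ and compatible with these pseudonaturality cells, $$\tilde t_f:f\to f^t\circ_t i,\qquad \hat t_{f,g}:(f^t\circ_t g)^t\to f^t\circ_t g^t,\qquad \theta_X:(i_X)^t\to 1_{TX}$$ for $f:B_1,\dots,X,\dots,B_n\to TY$ and $g:C_1,\dots,W,\dots,C_m\to TX$, where $\circ_t$ is composition in the strengthened argument. For all composable $f,g,h$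 it is required that $$(\hat t_{f,g}\circ_t h^t)\cdot\hat t_{f^t\circ_t g,h}=(f^t\circ_t\hat t_{g,h})\cdot\hat t_{f,g^t\circ_t h}\cdot(\hat t_{f,g}\circ_t h)^t,\qquad (f^t\circ_t\theta)\cdot\hat t_{f,i}\cdot(\tilde t_f)^t=1_{f^t}.$$ Restricted to unary maps, it is a relative pseudomonad with $(-)^*=(-)^t$, $\eta=\tilde t$, $\mu=\hat t$. It is **lax-idempotent** if each functor $(-)^t$ is left adjoint to $-\circ_t i_X$, with unit $\tilde t$. **Pseudocommutativity** of a strong relative pseudomonad. For $f:B_1,\dots,X,\dots,Y,\dots,B_n\to TZ$ write $f^s$, $f^t$ for the strengthenings in the left and the right one of the two displayed arguments (with 2-cells $\tilde s,\hat s$ and $\tilde t,\hat t$), and $f^{ts}=(f^t)^s$. A pseudocommutativity is a family of invertible 2-cells $\gamma_f:f^{ts}\to f^{st}$, natural in $f$ and compatible with substitution in the $B_k$, such that, with $\sim$ denoting pseudonaturality cells: 1. $f^t\xrightarrow{\tilde s}f^{ts}\circ_s i\xrightarrow{\gamma_f\circ_s i}f^{st}\circ_s i\xrightarrow{\sim}(f^s\circ_s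 i)^t$ equals $(\tilde s_f)^t$; 2. $f^s\xrightarrow{(\tilde t_f)^s}(f^t\circ_t i)^s\xrightarrow{\sim}f^{ts}\circ_t i\xrightarrow{\gamma_f\circ_t i}f^{st}\circ_t i$ equals $\tilde t_{f^s}$; 3. for $g:C_1,\dots,W,\dots,C_m\to TX$, strengthened in $W$, the composite $(f^{ts}\circ_s g)^s\xrightarrow{\hat s}f^{ts}\circ_s g^t\xrightarrow{\gamma_f\circ_s g^t}f^{st}\circ_s g^t\xrightarrow{\sim}(f^s\circ_s g^t)^t$ equals $(f^{ts}\circ_s g)^s\xrightarrow{(\gamma_f\circ_s g)^s}(f^{st}\circ_s g)^s\xrightarrow{\sim}(f^s\circ_s g)^{ts}\xrightarrow{\gamma}(f^s\circ_s g)^{st}\xrightarrow{(\hat s_{f,g})^t}(f^s\circ_s g^t)^t$; 4. for $h:D_1,\dots,V,\dots,D_l\to TY$, strengthened in $V$, the composite $(f^t\circ_t h)^{ts}\xrightarrow{(\hat t_{f,h})^s}(f^t\circ_t h^t)^s\xrightarrow{\sim}f^{ts}\circ_t h^t\xrightarrow{\gamma_f\circ_t h^t}f^{st}\circ_t h^t$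 equals $(f^t\circ_t h)^{ts}\xrightarrow{\gamma}(f^t\circ_t h)^{st}\xrightarrow{\sim}(f^{ts}\circ_t h)^t\xrightarrow{(\gamma_f\circ_t h)^t}(f^{st}\circ_t h)^t\xrightarrow{\hat t}f^{st}\circ_t h^t$; 5. for $f:B_1,\dots,W,\dots,X,\dots,Y,\dots,B_n\to TZ$, with strengthenings $s,t,u$ in $W,X,Y$, the two composites $f^{uts}\to f^{tus}\to f^{tsu}\to f^{stu}$ and $f^{uts}\to f^{ust}\to f^{sut}\to f^{stu}$ of cells $\gamma$ are equal. A strong relative pseudomonad is **pseudocommutative** if it has a pseudocommutativity. **Pseudo-multifunctor** $F:\mathrm{Cat}\to\mathrm{CAT}$ with object function $T$: functors $\mathrm{Cat}(X_1,\dots,X_n;Y)\to\mathrm{CAT}(TX_1,\dots,TX_n;TY)$, $f\mapsto Tf$, with invertible 2-cells $T1_X\cong 1_{TX}$ and $T(f\circ(g_1,\dots,g_n))\cong Tf\circ(Tg_1,\dots,Tg_n)$, natural in $f,g_1,\dots,g_n$ (the arguments of the composite may be listed in any order), satisfying the two unit axioms and the associativity axiom. A relative pseudomonad $(T,i,{}^*)$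 along $J$ is **multicategorical** if there are a pseudo-multifunctor with object function $T$, invertible 2-cells $\bar\imath_f:i_Y\circ f\to Tf\circ(i_{X_1},\dots,i_{X_n})$, natural in $f:X_1,\dots,X_n\to Y$, and an operation taking each 2-cell $\alpha:h\circ f\to Tf'\circ(g_1,\dots,g_n)$ (where $f':X_1',\dots,X_n'\to Y'$, $g_k:X_k\to TX'_k$, $h:Y\to TY'$) to a 2-cell $\alpha^*:h^*\circ Tf\to Tf'\circ(g_1^*,\dots,g_n^*)$ such that 1. $\alpha^*(i,\dots,i)\cdot h^*\bar\imath_f\cdot\eta_hf=Tf'(\eta_{g_1},\dots,\eta_{g_n})\cdot\alpha$; 2. for $\alpha$ as above and $\beta:h'\circ f'\to Tf''\circ(g_1',\dots,g_n')$, one has $\beta^*(g_1^*,\dots,g_n^*)\cdot h'^*\alpha^*\cdot\mu_{h',h}Tf=Tf''(\mu_{g_1',g_1},\dots,\mu_{g_n',g_n})\cdot\big(\beta^*(g_1,\dots,g_n)\cdot h'^*\alpha\big)^*$; 3. $Tf(\theta,\dots,\theta)\cdot(\bar\imath_f)^*=\theta_Y\,Tf$. **Theorem.** For small $X,Y$,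 locally small $B_k$ and every functor $f:B_1,\dots,X,\dots,B_n\to\mathrm{Psh}Y$, the left Kan extension of $f$ along $1,\dots,y_X,\dots,1$ exists. For every choice of such left Kan extensions $(f^t,\ \tilde t_f:f\to f^t\circ_t y_X)$ there is a strong relative pseudomonad along $J:\mathrm{Cat}\to\mathrm{CAT}$ with objects $\mathrm{Psh}X$ and units $y_X$, whose strengthenings and 2-cells $\tilde t$ are the chosen ones, and such that: 1. it is a lax-idempotent strong relative pseudomonad; 2. it is pseudocommutative; 3. its underlying relative pseudomonad is multicategorical. -/

import Mathlib

open CategoryTheory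

universe u

namespace RelPsh

/-! ### Generic operations on functors out of products -/

section Combinators

universe v₁ v₂ v₃ v₄ v₅ w₁ w₂ w₃ w₄ w₅

variable {A : Type w₁} [Category.{v₁} A] {A' : Type w₂} [Category.{v₂} A']
  {G : Type w₃} [Category.{v₃} G] {D : Type w₄} [Category.{v₄} D] {Z : Type w₅} [Category.{v₅} Z]

/-- Precomposition of `f` in its distinguished (first) argument with `k`:
`(a', γ) ↦ f (k a', γ)`. -/
abbrev pre (k : A' ⥤ A) (f : A × G ⥤ Z) : A' × G ⥤ Z := k.prod (𝟭 G) ⋙ f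

/-- Substitution of `S` into the remaining arguments: `(a, δ) ↦ f (a, S δ)`. -/
abbrev subst (S : D ⥤ G) (f : A × G ⥤ Z) : A × D ⥤ Z := (𝟭 A).prod S ⋙ f

/-- `(a', (γ, δ)) ↦ (g (a', δ), γ)`. -/
abbrev plug (G : Type w₃) [Category.{v₃} G] (g : A' × D ⥤ A) : A' × (G × D) ⥤ A × G :=
  Functor.prod'
    (Functor.prod' (CategoryTheory.Prod.fst A' (G × D))
      (CategoryTheory.Prod.snd A' (G × D) ⋙ CategoryTheory.Prod.snd G D) ⋙ g)
    (CategoryTheory.Prod.snd A' (G × D) ⋙ CategoryTheory.Prod.fst G D)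

/-- `plug` on 2-cells. -/
abbrev plugMap (G : Type w₃) [Category.{v₃} G] {g g' : A' × D ⥤ A} (β : g ⟶ g') :
    plug G g ⟶ plug G g' :=
  NatTrans.prod' (Functor.whiskerLeft _ β) (𝟙 _)

/-- Composition of multimorphisms in the distinguished argument:
`(a', (γ, δ)) ↦ f (g (a', δ), γ)`. -/
abbrev mcomp (f : A × G ⥤ Z) (g : A' × D ⥤ A) : A' × (G × D) ⥤ Z := plug G g ⋙ f

/-- `mcomp` on 2-cells in the outer multimorphism. -/
abbrev mcompL {f f' : A × G ⥤ Z} (α : f ⟶ f') (g : A' × D ⥤ A) : mcomp f g ⟶ mcomp f' g :=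
  Functor.whiskerLeft (plug G g) α

/-- `mcomp` on 2-cells in the inner multimorphism. -/
abbrev mcompR (f : A × G ⥤ Z) {g g' : A' × D ⥤ A} (β : g ⟶ g') : mcomp f g ⟶ mcomp f g' :=
  Functor.whiskerRight (plugMap G β) f

/-- `(a, (a', γ)) ↦ (a', (a, γ))`. -/
abbrev exch (A : Type w₁) [Category.{v₁} A] (A' : Type w₂) [Category.{v₂} A']
    (G : Type w₃) [Category.{v₃} G] : A × (A' × G) ⥤ A' × (A × G) :=
  Functor.prod' (CategoryTheory.Prod.snd A (A' × G) ⋙ CategoryTheory.Prod.fst A' G)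
    (Functor.prod' (CategoryTheory.Prod.fst A (A' × G))
      (CategoryTheory.Prod.snd A (A' × G) ⋙ CategoryTheory.Prod.snd A' G))

/-- `(a, (b, c)) ↦ ((a, b), c)`. -/
abbrev reassoc (A : Type w₁) [Category.{v₁} A] (A' : Type w₂) [Category.{v₂} A']
    (G : Type w₃) [Category.{v₃} G] : A × (A' × G) ⥤ (A × A') × G :=
  Functor.prod'
    (Functor.prod' (CategoryTheory.Prod.fst A (A' × G))
      (CategoryTheory.Prod.snd A (A' × G) ⋙ CategoryTheory.Prod.fst A' G))
    (CategoryTheory.Prod.snd A (A' × G) ⋙ CategoryTheory.Prod.snd A' G)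

/-- `(a, (b, (c, γ))) ↦ (c, (a, (b, γ)))`. -/
abbrev rot (A : Type w₁) [Category.{v₁} A] (B : Type w₂) [Category.{v₂} B]
    (C : Type w₄) [Category.{v₄} C] (G : Type w₃) [Category.{v₃} G] :
    A × (B × (C × G)) ⥤ C × (A × (B × G)) :=
  (𝟭 A).prod (exch B C G) ⋙ exch A C (B × G)

/-- `(c, (a, (b, γ))) ↦ (a, (b, (c, γ)))`. -/
abbrev rotInv (C : Type w₄) [Category.{v₄} C] (A : Type w₁) [Category.{v₁} A]
    (B : Type w₂) [Category.{v₂} B] (G : Type w₃) [Category.{v₃} G] :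
    C × (A × (B × G)) ⥤ A × (B × (C × G)) :=
  exch C A (B × G) ⋙ (𝟭 A).prod (exch C B G)

end Combinators

/-! ### The 2-multicategories `Cat` and `CAT` -/

/-- The inclusion of small categories into locally small categories, on objects. -/
abbrev J (X : Cat.{u, u}) : Cat.{u, u + 1} := @Cat.of (ULift.{u + 1} X) (uliftCategory X)

/-- A finite list of objects of `CAT`, formally bracketed. -/
inductive Ctx : Type (u + 2)
  | nil : Ctx
  | of (B : Cat.{u, u + 1}) : Ctx
  | app (Γ Δ : Ctx) : Ctx

/-- The product `B₁ × ⋯ × Bₙ` of a list of objects of `CAT`, bracketed as the list is. The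
hom-category `CAT(B₁, …, Bₙ; Z)` is the functor category `Γ.prod ⥤ Z`; when one argument `A` is
distinguished and `Γ` lists the other arguments, it is `A × Γ.prod ⥤ Z`. -/
@[reducible] def Ctx.prod : Ctx.{u} → Cat.{u, u + 1}
  | .nil => @Cat.of (ULift.{u + 1} (Discrete PUnit.{u + 1})) (uliftCategory _)
  | .of B => B
  | .app Γ Δ => Cat.of (Γ.prod × Δ.prod)

/-- The unique functor to the empty product. -/
abbrev Ctx.bang (Γ : Ctx.{u}) : Γ.prod ⥤ Ctx.prod.{u} .nil := (Functor.const _).obj ⟨⟨⟨⟩⟩⟩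

/-- A unary multimorphism `f : A → Z`, written with an empty list of other arguments. -/
abbrev unary {A Z : Cat.{u, u + 1}} (f : A ⥤ Z) : A × Ctx.prod.{u} .nil ⥤ Z :=
  CategoryTheory.Prod.fst A (Ctx.prod.{u} .nil) ⋙ f

/-! ### Strong relative pseudomonads -/

/-- A strong relative pseudomonad along `J : Cat → CAT`, with underlying objects `T` and units `i`.

`str X Y Γ` is the strengthening `f ↦ f^t` in the distinguished argument, `Γ` being the list of the
other arguments; `tilde f : f ≅ f^t ∘ₜ i`, `hat f g : (f^t ∘ₜ g)^t ≅ f^t ∘ₜ g^t` and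
`theta X : i^t ≅ 1` are the structural 2-cells. `pn S f : (f ∘ S)^t ≅ f^t ∘ S` is the
pseudonaturality in the other arguments; it is asked for along all functors
`S : Δ.prod ⥤ Γ.prod`, in particular those which substitute multimorphisms into some of the
arguments in `Γ` and those which permute or rebracket the arguments. -/
structure StrongRelPseudomonad (T : Cat.{u, u} → Cat.{u, u + 1}) (i : ∀ X, J X ⥤ T X) where
  str (X Y : Cat.{u, u}) (Γ : Ctx.{u}) : (J X × Γ.prod ⥤ T Y) ⥤ (T X × Γ.prod ⥤ T Y)
  pn {X Y : Cat.{u, u}} {Γ Δ : Ctx.{u}} (S : Δ.prod ⥤ Γ.prod) (f : J X × Γ.prod ⥤ T Y) :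
    (str X Y Δ).obj (subst S f) ≅ subst S ((str X Y Γ).obj f)
  tilde {X Y : Cat.{u, u}} {Γ : Ctx.{u}} (f : J X × Γ.prod ⥤ T Y) :
    f ≅ pre (i X) ((str X Y Γ).obj f)
  hat {W X Y : Cat.{u, u}} {Γ Δ : Ctx.{u}} (f : J X × Γ.prod ⥤ T Y) (g : J W × Δ.prod ⥤ T X) :
    (str W Y (.app Γ Δ)).obj (mcomp ((str X Y Γ).obj f) g) ≅
      mcomp ((str X Y Γ).obj f) ((str W X Δ).obj g)
  theta (X : Cat.{u, u}) :
    (str X X .nil).obj (unary (i X)) ≅ unary (𝟭 (T X))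
  /-- `pn` is natural in `f`. -/
  pn_naturality {X Y : Cat.{u, u}} {Γ Δ : Ctx.{u}} (S : Δ.prod ⥤ Γ.prod)
    {f f' : J X × Γ.prod ⥤ T Y} (α : f ⟶ f') :
    (str X Y Δ).map (Functor.whiskerLeft ((𝟭 (J X)).prod S) α) ≫ (pn S f').hom =
      (pn S f).hom ≫ Functor.whiskerLeft ((𝟭 (T X)).prod S) ((str X Y Γ).map α)
  /-- `pn` is natural in `S`. -/
  pn_naturality_subst {X Y : Cat.{u, u}} {Γ Δ : Ctx.{u}} {S S' : Δ.prod ⥤ Γ.prod} (σ : S ⟶ S')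
    (f : J X × Γ.prod ⥤ T Y) :
    (str X Y Δ).map (Functor.whiskerRight (NatTrans.prod (𝟙 (𝟭 (J X))) σ) f) ≫ (pn S' f).hom =
      (pn S f).hom ≫
        Functor.whiskerRight (NatTrans.prod (𝟙 (𝟭 (T X))) σ) ((str X Y Γ).obj f)
  pn_id {X Y : Cat.{u, u}} {Γ : Ctx.{u}} (f : J X × Γ.prod ⥤ T Y) :
    (pn (𝟭 Γ.prod) f).hom = 𝟙 ((str X Y Γ).obj f)
  pn_comp {X Y : Cat.{u, u}} {Γ Δ Θ : Ctx.{u}} (S : Δ.prod ⥤ Γ.prod) (S' : Θ.prod ⥤ Δ.prod)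
    (f : J X × Γ.prod ⥤ T Y) :
    (pn (S' ⋙ S) f).hom =
      (pn S' (subst S f)).hom ≫ Functor.whiskerLeft ((𝟭 (T X)).prod S') (pn S f).hom
  /-- `tilde` is natural in `f`. -/
  tilde_naturality {X Y : Cat.{u, u}} {Γ : Ctx.{u}} {f f' : J X × Γ.prod ⥤ T Y} (α : f ⟶ f') :
    (tilde f).hom ≫ Functor.whiskerLeft ((i X).prod (𝟭 Γ.prod)) ((str X Y Γ).map α) =
      α ≫ (tilde f').hom
  /-- `tilde` is compatible with substitution in the other arguments. -/
  tilde_pn {X Y : Cat.{u, u}} {Γ Δ : Ctx.{u}} (S : Δ.prod ⥤ Γ.prod) (f : J X × Γ.prod ⥤ T Y) :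
    (tilde (subst S f)).hom ≫ Functor.whiskerLeft ((i X).prod (𝟭 Δ.prod)) (pn S f).hom =
      Functor.whiskerLeft ((𝟭 (J X)).prod S) (tilde f).hom
  /-- `hat` is natural in `f`. -/
  hat_naturality_left {W X Y : Cat.{u, u}} {Γ Δ : Ctx.{u}} {f f' : J X × Γ.prod ⥤ T Y}
    (α : f ⟶ f') (g : J W × Δ.prod ⥤ T X) :
    (str W Y (.app Γ Δ)).map (mcompL ((str X Y Γ).map α) g) ≫ (hat f' g).hom =
      (hat f g).hom ≫ mcompL ((str X Y Γ).map α) ((str W X Δ).obj g)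
  /-- `hat` is natural in `g`. -/
  hat_naturality_right {W X Y : Cat.{u, u}} {Γ Δ : Ctx.{u}} (f : J X × Γ.prod ⥤ T Y)
    {g g' : J W × Δ.prod ⥤ T X} (β : g ⟶ g') :
    (str W Y (.app Γ Δ)).map (mcompR ((str X Y Γ).obj f) β) ≫ (hat f g').hom =
      (hat f g).hom ≫ mcompR ((str X Y Γ).obj f) ((str W X Δ).map β)
  /-- `hat` is compatible with substitution in the other arguments of `f` and of `g`. -/
  hat_pn {W X Y : Cat.{u, u}} {Γ Δ Γ' Δ' : Ctx.{u}} (S : Γ'.prod ⥤ Γ.prod)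
    (S' : Δ'.prod ⥤ Δ.prod) (f : J X × Γ.prod ⥤ T Y) (g : J W × Δ.prod ⥤ T X) :
    (hat (subst S f) (subst S' g)).hom ≫ mcompL (pn S f).hom ((str W X Δ').obj (subst S' g)) ≫
        mcompR (subst S ((str X Y Γ).obj f)) (pn S' g).hom =
      (str W Y (.app Γ' Δ')).map (mcompL (pn S f).hom (subst S' g)) ≫
        (pn (Γ := .app Γ Δ) (Δ := .app Γ' Δ') (S.prod S') (mcomp ((str X Y Γ).obj f) g)).hom ≫
        Functor.whiskerLeft ((𝟭 (T W)).prod (S.prod S')) (hat f g).hom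
  /-- Associativity axiom. The pseudonaturality along
  `reassoc : Γ × (Δ × Θ) ⥤ (Γ × Δ) × Θ` identifies the two bracketings of the list of the other
  arguments of `f ∘ₜ g ∘ₜ h`. -/
  assoc {V W X Y : Cat.{u, u}} {Γ Δ Θ : Ctx.{u}} (f : J X × Γ.prod ⥤ T Y)
    (g : J W × Δ.prod ⥤ T X) (h : J V × Θ.prod ⥤ T W) :
    (pn (Γ := .app (.app Γ Δ) Θ) (Δ := .app Γ (.app Δ Θ)) (reassoc Γ.prod Δ.prod Θ.prod)
        (mcomp ((str W Y (.app Γ Δ)).obj (mcomp ((str X Y Γ).obj f) g)) h)).hom ≫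
      Functor.whiskerLeft ((𝟭 (T V)).prod (reassoc Γ.prod Δ.prod Θ.prod))
        ((hat (Γ := .app Γ Δ) (mcomp ((str X Y Γ).obj f) g) h).hom ≫
          mcompL (hat f g).hom ((str V W Θ).obj h)) =
    (str V Y (.app Γ (.app Δ Θ))).map
        (Functor.whiskerLeft ((𝟭 (J V)).prod (reassoc Γ.prod Δ.prod Θ.prod))
          (mcompL (hat f g).hom h)) ≫
      (hat (Δ := .app Δ Θ) f (mcomp ((str W X Δ).obj g) h)).hom ≫
      mcompR ((str X Y Γ).obj f) (hat g h).hom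
  /-- Unit axiom. The list of the other arguments of `f^t ∘ₜ i` is `Γ` with an empty list
  appended, which is identified with `Γ` by pseudonaturality. -/
  unit {X Y : Cat.{u, u}} {Γ : Ctx.{u}} (f : J X × Γ.prod ⥤ T Y) :
    (str X Y Γ).map (tilde f).hom ≫
      (pn (Γ := .app Γ .nil) (Functor.prod' (𝟭 Γ.prod) Γ.bang)
        (mcomp ((str X Y Γ).obj f) (unary (i X)))).hom ≫
      Functor.whiskerLeft ((𝟭 (T X)).prod (Functor.prod' (𝟭 Γ.prod) Γ.bang))
        ((hat (Δ := .nil) f (unary (i X))).hom ≫ mcompR ((str X Y Γ).obj f) (theta X).hom) =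
    𝟙 ((str X Y Γ).obj f)

namespace StrongRelPseudomonad

variable {T : Cat.{u, u} → Cat.{u, u + 1}} {i : ∀ X, J X ⥤ T X} (S : StrongRelPseudomonad T i)

/-- `S` is lax-idempotent: strengthening is left adjoint to precomposition with the unit of the
relative pseudomonad, the unit of the adjunction being `tilde`. -/
def IsLaxIdempotent : Prop :=
  ∀ (X Y : Cat.{u, u}) (Γ : Ctx.{u}),
    ∃ adj : S.str X Y Γ ⊣ (Functor.whiskeringLeft _ _ (T Y)).obj ((i X).prod (𝟭 Γ.prod)),
      ∀ f : J X × Γ.prod ⥤ T Y, adj.unit.app f = (S.tilde f).hom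

/-! #### Multimorphisms with two distinguished arguments

Such a multimorphism is a functor `A × (B × Γ.prod) ⥤ Z`. -/

/-- Strengthening `f ↦ f^s` in the left one of two distinguished arguments. -/
abbrev strL (X : Cat.{u, u}) (B : Cat.{u, u + 1}) (Γ : Ctx.{u}) (Z : Cat.{u, u}) :
    (J X × (B × Γ.prod) ⥤ T Z) ⥤ (T X × (B × Γ.prod) ⥤ T Z) :=
  S.str X Z (.app (.of B) Γ)

/-- Strengthening `f ↦ f^t` in the right one of two distinguished arguments. -/
abbrev strR (A : Cat.{u, u + 1}) (Y : Cat.{u, u}) (Γ : Ctx.{u}) (Z : Cat.{u, u}) :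
    (A × (J Y × Γ.prod) ⥤ T Z) ⥤ (A × (T Y × Γ.prod) ⥤ T Z) :=
  (Functor.whiskeringLeft _ _ _).obj (exch (J Y) A Γ.prod) ⋙ S.str Y Z (.app (.of A) Γ) ⋙
    (Functor.whiskeringLeft _ _ _).obj (exch A (T Y) Γ.prod)

/-- `(a', (b, (γ, δ))) ↦ f (g (a', δ), (b, γ))`, the composite `f ∘ₛ g`. -/
abbrev inL {A A' B Z : Cat.{u, u + 1}} {Γ Δ : Ctx.{u}} (f : A × (B × Γ.prod) ⥤ Z)
    (g : A' × Δ.prod ⥤ A) : A' × (B × (Γ.prod × Δ.prod)) ⥤ Z :=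
  (𝟭 A').prod (reassoc B Γ.prod Δ.prod) ⋙ mcomp f g

/-- `(a, (b', (γ, δ))) ↦ f (a, (g (b', δ), γ))`, the composite `f ∘ₜ g`. -/
abbrev inR {A B B' Z : Cat.{u, u + 1}} {Γ Δ : Ctx.{u}} (f : A × (B × Γ.prod) ⥤ Z)
    (g : B' × Δ.prod ⥤ B) : A × (B' × (Γ.prod × Δ.prod)) ⥤ Z :=
  (𝟭 A).prod (plug Γ.prod g) ⋙ f

/-- `f ↦ f ∘ₛ g` on 2-cells. -/
abbrev inLMap {A A' B Z : Cat.{u, u + 1}} {Γ Δ : Ctx.{u}} {f f' : A × (B × Γ.prod) ⥤ Z}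
    (α : f ⟶ f') (g : A' × Δ.prod ⥤ A) : inL f g ⟶ inL f' g :=
  Functor.whiskerLeft ((𝟭 A').prod (reassoc B Γ.prod Δ.prod)) (mcompL α g)

/-- `f ↦ f ∘ₜ g` on 2-cells. -/
abbrev inRMap {A B B' Z : Cat.{u, u + 1}} {Γ Δ : Ctx.{u}} {f f' : A × (B × Γ.prod) ⥤ Z}
    (α : f ⟶ f') (g : B' × Δ.prod ⥤ B) : inR f g ⟶ inR f' g :=
  Functor.whiskerLeft ((𝟭 A).prod (plug Γ.prod g)) α

/-- `f → f^s ∘ₛ i`. -/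
abbrev tildeL {X Z : Cat.{u, u}} {B : Cat.{u, u + 1}} {Γ : Ctx.{u}}
    (f : J X × (B × Γ.prod) ⥤ T Z) :
    f ≅ (i X).prod (𝟭 (B × Γ.prod)) ⋙ (S.strL X B Γ Z).obj f :=
  S.tilde (Γ := .app (.of B) Γ) f

/-- `f → f^t ∘ₜ i`. -/
abbrev tildeR {Y Z : Cat.{u, u}} {A : Cat.{u, u + 1}} {Γ : Ctx.{u}}
    (f : A × (J Y × Γ.prod) ⥤ T Z) :
    f ≅ (𝟭 A).prod ((i Y).prod (𝟭 Γ.prod)) ⋙ (S.strR A Y Γ Z).obj f :=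
  Functor.isoWhiskerLeft (exch A (J Y) Γ.prod)
    (S.tilde (Γ := .app (.of A) Γ) (exch (J Y) A Γ.prod ⋙ f))

/-- `(f^s ∘ₛ g)^s → f^s ∘ₛ g^s`. -/
abbrev hatL {W X Z : Cat.{u, u}} {B : Cat.{u, u + 1}} {Γ Δ : Ctx.{u}}
    (f : J X × (B × Γ.prod) ⥤ T Z) (g : J W × Δ.prod ⥤ T X) :
    (S.strL W B (.app Γ Δ) Z).obj (inL ((S.strL X B Γ Z).obj f) g) ≅
      inL ((S.strL X B Γ Z).obj f) ((S.str W X Δ).obj g) :=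
  S.pn (Γ := .app (.app (.of B) Γ) Δ) (Δ := .app (.of B) (.app Γ Δ))
      (reassoc B Γ.prod Δ.prod) (mcomp ((S.strL X B Γ Z).obj f) g) ≪≫
    Functor.isoWhiskerLeft ((𝟭 (T W)).prod (reassoc B Γ.prod Δ.prod))
      (S.hat (Γ := .app (.of B) Γ) f g)

/-- `(f^t ∘ₜ g)^t → f^t ∘ₜ g^t`. -/
abbrev hatR {W Y Z : Cat.{u, u}} {A : Cat.{u, u + 1}} {Γ Δ : Ctx.{u}}
    (f : A × (J Y × Γ.prod) ⥤ T Z) (g : J W × Δ.prod ⥤ T Y) :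
    (S.strR A W (.app Γ Δ) Z).obj (inR ((S.strR A Y Γ Z).obj f) g) ≅
      inR ((S.strR A Y Γ Z).obj f) ((S.str W Y Δ).obj g) :=
  Functor.isoWhiskerLeft (exch A (T W) (Γ.prod × Δ.prod))
    (S.hatL (exch (J Y) A Γ.prod ⋙ f) g)

/-- `(f ∘ₜ g)^s ≅ f^s ∘ₜ g`. -/
abbrev commL {X Z : Cat.{u, u}} {B B' : Cat.{u, u + 1}} {Γ Δ : Ctx.{u}}
    (f : J X × (B × Γ.prod) ⥤ T Z) (g : B' × Δ.prod ⥤ B) :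
    (S.strL X B' (.app Γ Δ) Z).obj (inR f g) ≅ inR ((S.strL X B Γ Z).obj f) g :=
  S.pn (Γ := .app (.of B) Γ) (Δ := .app (.of B') (.app Γ Δ)) (plug Γ.prod g) f

/-- `(f ∘ₛ g)^t ≅ f^t ∘ₛ g`. -/
abbrev commR {Y Z : Cat.{u, u}} {A A' : Cat.{u, u + 1}} {Γ Δ : Ctx.{u}}
    (f : A × (J Y × Γ.prod) ⥤ T Z) (g : A' × Δ.prod ⥤ A) :
    (S.strR A' Y (.app Γ Δ) Z).obj (inL f g) ≅ inL ((S.strR A Y Γ Z).obj f) g :=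
  Functor.isoWhiskerLeft (exch A' (T Y) (Γ.prod × Δ.prod))
    (S.commL (exch (J Y) A Γ.prod ⋙ f) g)

/-- `(f ∘ₜ k)^s ≅ f^s ∘ₜ k` for unary `k`. -/
abbrev commL₁ {X Z : Cat.{u, u}} {B B' : Cat.{u, u + 1}} {Γ : Ctx.{u}}
    (f : J X × (B × Γ.prod) ⥤ T Z) (k : B' ⥤ B) :
    (S.strL X B' Γ Z).obj ((𝟭 (J X)).prod (k.prod (𝟭 Γ.prod)) ⋙ f) ≅
      (𝟭 (T X)).prod (k.prod (𝟭 Γ.prod)) ⋙ (S.strL X B Γ Z).obj f :=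
  S.pn (Γ := .app (.of B) Γ) (Δ := .app (.of B') Γ) (k.prod (𝟭 Γ.prod)) f

/-- `(f ∘ₛ k)^t ≅ f^t ∘ₛ k` for unary `k`. -/
abbrev commR₁ {Y Z : Cat.{u, u}} {A A' : Cat.{u, u + 1}} {Γ : Ctx.{u}}
    (f : A × (J Y × Γ.prod) ⥤ T Z) (k : A' ⥤ A) :
    (S.strR A' Y Γ Z).obj (k.prod (𝟭 (J Y × Γ.prod)) ⋙ f) ≅
      k.prod (𝟭 (T Y × Γ.prod)) ⋙ (S.strR A Y Γ Z).obj f :=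
  Functor.isoWhiskerLeft (exch A' (T Y) Γ.prod)
    (S.commL₁ (exch (J Y) A Γ.prod ⋙ f) k)

/-- Substitution of `R` into the other arguments commutes with `(-)^s`. -/
abbrev pnL {X Z : Cat.{u, u}} {B : Cat.{u, u + 1}} {Γ Δ : Ctx.{u}} (R : Δ.prod ⥤ Γ.prod)
    (f : J X × (B × Γ.prod) ⥤ T Z) :
    (S.strL X B Δ Z).obj ((𝟭 (J X)).prod ((𝟭 B).prod R) ⋙ f) ≅
      (𝟭 (T X)).prod ((𝟭 B).prod R) ⋙ (S.strL X B Γ Z).obj f :=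
  S.pn (Γ := .app (.of B) Γ) (Δ := .app (.of B) Δ) ((𝟭 B).prod R) f

/-- Substitution of `R` into the other arguments commutes with `(-)^t`. -/
abbrev pnR {Y Z : Cat.{u, u}} {A : Cat.{u, u + 1}} {Γ Δ : Ctx.{u}} (R : Δ.prod ⥤ Γ.prod)
    (f : A × (J Y × Γ.prod) ⥤ T Z) :
    (S.strR A Y Δ Z).obj ((𝟭 A).prod ((𝟭 (J Y)).prod R) ⋙ f) ≅
      (𝟭 A).prod ((𝟭 (T Y)).prod R) ⋙ (S.strR A Y Γ Z).obj f :=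
  Functor.isoWhiskerLeft (exch A (T Y) Δ.prod) (S.pnL R (exch (J Y) A Γ.prod ⋙ f))

/-! #### Multimorphisms with three distinguished arguments

Such a multimorphism is a functor `A × (B × (C × Γ.prod)) ⥤ Z`. Strengthenings in the first, second
and third argument are written `s`, `t` and `u`. -/

/-- `f ↦ f^s`. -/
abbrev str₁ (X : Cat.{u, u}) (B C : Cat.{u, u + 1}) (Γ : Ctx.{u}) (Z : Cat.{u, u}) :
    (J X × (B × (C × Γ.prod)) ⥤ T Z) ⥤ (T X × (B × (C × Γ.prod)) ⥤ T Z) :=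
  S.strL X B (.app (.of C) Γ) Z

/-- `f ↦ f^t`. -/
abbrev str₂ (A : Cat.{u, u + 1}) (X : Cat.{u, u}) (C : Cat.{u, u + 1}) (Γ : Ctx.{u})
    (Z : Cat.{u, u}) :
    (A × (J X × (C × Γ.prod)) ⥤ T Z) ⥤ (A × (T X × (C × Γ.prod)) ⥤ T Z) :=
  S.strR A X (.app (.of C) Γ) Z

/-- `f ↦ f^u`. -/
abbrev str₃ (A B : Cat.{u, u + 1}) (X : Cat.{u, u}) (Γ : Ctx.{u}) (Z : Cat.{u, u}) :
    (A × (B × (J X × Γ.prod)) ⥤ T Z) ⥤ (A × (B × (T X × Γ.prod)) ⥤ T Z) :=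
  (Functor.whiskeringLeft _ _ _).obj (rotInv (J X) A B Γ.prod) ⋙
    S.str X Z (.app (.of A) (.app (.of B) Γ)) ⋙
    (Functor.whiskeringLeft _ _ _).obj (rot A B (T X) Γ.prod)

/-- `f^s`, computed after exchanging the second and third arguments. -/
abbrev reord₁ {X Z : Cat.{u, u}} {B C : Cat.{u, u + 1}} {Γ : Ctx.{u}}
    (f : J X × (B × (C × Γ.prod)) ⥤ T Z) :
    (S.strL X C (.app (.of B) Γ) Z).obj ((𝟭 (J X)).prod (exch C B Γ.prod) ⋙ f) ≅
      (𝟭 (T X)).prod (exch C B Γ.prod) ⋙ (S.str₁ X B C Γ Z).obj f :=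
  S.pn (Γ := .app (.of B) (.app (.of C) Γ)) (Δ := .app (.of C) (.app (.of B) Γ))
    (exch C B Γ.prod) f

/-- `f^t`, computed after moving the first argument to the third place. -/
abbrev reord₂ {X Z : Cat.{u, u}} {A C : Cat.{u, u + 1}} {Γ : Ctx.{u}}
    (f : A × (J X × (C × Γ.prod)) ⥤ T Z) :
    (S.strL X C (.app (.of A) Γ) Z).obj (rot (J X) C A Γ.prod ⋙ f) ≅
      rot (T X) C A Γ.prod ⋙ (S.str₂ A X C Γ Z).obj f :=
  S.pn (Γ := .app (.of A) (.app (.of C) Γ)) (Δ := .app (.of C) (.app (.of A) Γ))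
    (exch C A Γ.prod) (exch (J X) A (C × Γ.prod) ⋙ f)

/-- `f^u`, computed after moving the first argument to the third place. -/
abbrev reord₃ {X Z : Cat.{u, u}} {A B : Cat.{u, u + 1}} {Γ : Ctx.{u}}
    (f : A × (B × (J X × Γ.prod)) ⥤ T Z) :
    (S.strR B X (.app (.of A) Γ) Z).obj (rot B (J X) A Γ.prod ⋙ f) ≅
      rot B (T X) A Γ.prod ⋙ (S.str₃ A B X Γ Z).obj f :=
  Functor.isoWhiskerLeft (exch B (T X) (A × Γ.prod))
    (S.pn (Γ := .app (.of A) (.app (.of B) Γ)) (Δ := .app (.of B) (.app (.of A) Γ))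
      (exch B A Γ.prod) (rotInv (J X) A B Γ.prod ⋙ f))

/-- A family of 2-cells `f^{ts} → f^{st}`. -/
abbrev GammaFamily : Type (u + 2) :=
  ∀ {X Y Z : Cat.{u, u}} {Γ : Ctx.{u}} (f : J X × (J Y × Γ.prod) ⥤ T Z),
    (S.strL X (T Y) Γ Z).obj ((S.strR (J X) Y Γ Z).obj f) ≅
      (S.strR (T X) Y Γ Z).obj ((S.strL X (J Y) Γ Z).obj f)

variable {S} in
/-- The 2-cell `f^{us} → f^{su}` at a multimorphism with three distinguished arguments. -/
abbrev GammaFamily.gamma₁₃ (γ : GammaFamily S) {W Y Z : Cat.{u, u}} {B : Cat.{u, u + 1}}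
    {Γ : Ctx.{u}} (f : J W × (B × (J Y × Γ.prod)) ⥤ T Z) :
    (S.str₁ W B (T Y) Γ Z).obj ((S.str₃ (J W) B Y Γ Z).obj f) ⟶
      (S.str₃ (T W) B Y Γ Z).obj ((S.str₁ W B (J Y) Γ Z).obj f) :=
  Functor.whiskerLeft ((𝟭 (T W)).prod (exch B (T Y) Γ.prod))
    ((S.reord₁ ((S.str₃ (J W) B Y Γ Z).obj f)).inv ≫
      (γ (Γ := .app (.of B) Γ) ((𝟭 (J W)).prod (exch (J Y) B Γ.prod) ⋙ f)).hom ≫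
      (S.strR (T W) Y (.app (.of B) Γ) Z).map (S.reord₁ f).hom)

variable {S} in
/-- The 2-cell `f^{ut} → f^{tu}` at a multimorphism with three distinguished arguments. -/
abbrev GammaFamily.gamma₂₃ (γ : GammaFamily S) {X Y Z : Cat.{u, u}} {A : Cat.{u, u + 1}}
    {Γ : Ctx.{u}} (f : A × (J X × (J Y × Γ.prod)) ⥤ T Z) :
    (S.str₂ A X (T Y) Γ Z).obj ((S.str₃ A (J X) Y Γ Z).obj f) ⟶
      (S.str₃ A (T X) Y Γ Z).obj ((S.str₂ A X (J Y) Γ Z).obj f) :=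
  Functor.whiskerLeft (rotInv A (T X) (T Y) Γ.prod)
    ((S.reord₂ ((S.str₃ A (J X) Y Γ Z).obj f)).inv ≫
      (S.strL X (T Y) (.app (.of A) Γ) Z).map (S.reord₃ f).inv ≫
      (γ (Γ := .app (.of A) Γ) (rot (J X) (J Y) A Γ.prod ⋙ f)).hom ≫
      (S.strR (T X) Y (.app (.of A) Γ) Z).map (S.reord₂ f).hom ≫
      (S.reord₃ ((S.str₂ A X (J Y) Γ Z).obj f)).hom)

variable {S} in
/-- The 2-cell `f^{ts} → f^{st}` at a multimorphism with three distinguished arguments. -/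
abbrev GammaFamily.gamma₁₂ (γ : GammaFamily S) {W X Z : Cat.{u, u}} {C : Cat.{u, u + 1}}
    {Γ : Ctx.{u}} (f : J W × (J X × (C × Γ.prod)) ⥤ T Z) :
    (S.str₁ W (T X) C Γ Z).obj ((S.str₂ (J W) X C Γ Z).obj f) ⟶
      (S.str₂ (T W) X C Γ Z).obj ((S.str₁ W (J X) C Γ Z).obj f) :=
  (γ (Γ := .app (.of C) Γ) f).hom

/-- A pseudocommutativity for the strong relative pseudomonad `S`. -/
structure Pseudocommutativity where
  gamma : GammaFamily S
  naturality {X Y Z : Cat.{u, u}} {Γ : Ctx.{u}} {f f' : J X × (J Y × Γ.prod) ⥤ T Z}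
    (α : f ⟶ f') :
    (S.strL X (T Y) Γ Z).map ((S.strR (J X) Y Γ Z).map α) ≫ (gamma f').hom =
      (gamma f).hom ≫ (S.strR (T X) Y Γ Z).map ((S.strL X (J Y) Γ Z).map α)
  /-- Compatibility with substitution in the arguments which are not distinguished. -/
  naturality_subst {X Y Z : Cat.{u, u}} {Γ Δ : Ctx.{u}} (R : Δ.prod ⥤ Γ.prod)
    (f : J X × (J Y × Γ.prod) ⥤ T Z) :
    (gamma ((𝟭 (J X)).prod ((𝟭 (J Y)).prod R) ⋙ f)).hom ≫
        (S.strR (T X) Y Δ Z).map (S.pnL R f).hom ≫ (S.pnR R ((S.strL X (J Y) Γ Z).obj f)).hom =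
      (S.strL X (T Y) Δ Z).map (S.pnR R f).hom ≫ (S.pnL R ((S.strR (J X) Y Γ Z).obj f)).hom ≫
        Functor.whiskerLeft ((𝟭 (T X)).prod ((𝟭 (T Y)).prod R)) (gamma f).hom
  /-- Precomposition of `gamma f` in the left argument with a unit map. -/
  tilde_left {X Y Z : Cat.{u, u}} {Γ : Ctx.{u}} (f : J X × (J Y × Γ.prod) ⥤ T Z) :
    (S.tildeL ((S.strR (J X) Y Γ Z).obj f)).hom ≫
        Functor.whiskerLeft ((i X).prod (𝟭 (T Y × Γ.prod))) (gamma f).hom ≫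
        (S.commR₁ ((S.strL X (J Y) Γ Z).obj f) (i X)).inv =
      (S.strR (J X) Y Γ Z).map (S.tildeL f).hom
  /-- Precomposition of `gamma f` in the right argument with a unit map. -/
  tilde_right {X Y Z : Cat.{u, u}} {Γ : Ctx.{u}} (f : J X × (J Y × Γ.prod) ⥤ T Z) :
    (S.strL X (J Y) Γ Z).map (S.tildeR f).hom ≫
        (S.commL₁ ((S.strR (J X) Y Γ Z).obj f) (i Y)).hom ≫
        Functor.whiskerLeft ((𝟭 (T X)).prod ((i Y).prod (𝟭 Γ.prod))) (gamma f).hom =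
      (S.tildeR ((S.strL X (J Y) Γ Z).obj f)).hom
  /-- Precomposition of `gamma f` in the left argument with a strengthened map. -/
  hat_left {W X Y Z : Cat.{u, u}} {Γ Δ : Ctx.{u}} (f : J X × (J Y × Γ.prod) ⥤ T Z)
    (g : J W × Δ.prod ⥤ T X) :
    (S.hatL ((S.strR (J X) Y Γ Z).obj f) g).hom ≫
        inLMap (gamma f).hom ((S.str W X Δ).obj g) ≫
        (S.commR ((S.strL X (J Y) Γ Z).obj f) ((S.str W X Δ).obj g)).inv =
      (S.strL W (T Y) (.app Γ Δ) Z).map (inLMap (gamma f).hom g) ≫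
        (S.strL W (T Y) (.app Γ Δ) Z).map (S.commR ((S.strL X (J Y) Γ Z).obj f) g).inv ≫
        (gamma (Γ := .app Γ Δ) (inL ((S.strL X (J Y) Γ Z).obj f) g)).hom ≫
        (S.strR (T W) Y (.app Γ Δ) Z).map (S.hatL f g).hom
  /-- Precomposition of `gamma f` in the right argument with a strengthened map. -/
  hat_right {V X Y Z : Cat.{u, u}} {Γ Δ : Ctx.{u}} (f : J X × (J Y × Γ.prod) ⥤ T Z)
    (h : J V × Δ.prod ⥤ T Y) :
    (S.strL X (T V) (.app Γ Δ) Z).map (S.hatR f h).hom ≫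
        (S.commL ((S.strR (J X) Y Γ Z).obj f) ((S.str V Y Δ).obj h)).hom ≫
        inRMap (gamma f).hom ((S.str V Y Δ).obj h) =
      (gamma (Γ := .app Γ Δ) (inR ((S.strR (J X) Y Γ Z).obj f) h)).hom ≫
        (S.strR (T X) V (.app Γ Δ) Z).map (S.commL ((S.strR (J X) Y Γ Z).obj f) h).hom ≫
        (S.strR (T X) V (.app Γ Δ) Z).map (inRMap (gamma f).hom h) ≫
        (S.hatR ((S.strL X (J Y) Γ Z).obj f) h).hom
  /-- Braiding axiom. -/
  braiding {W X Y Z : Cat.{u, u}} {Γ : Ctx.{u}} (f : J W × (J X × (J Y × Γ.prod)) ⥤ T Z) :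
    (S.str₁ W (T X) (T Y) Γ Z).map (gamma.gamma₂₃ f) ≫
        gamma.gamma₁₃ ((S.str₂ (J W) X (J Y) Γ Z).obj f) ≫
        (S.str₃ (T W) (T X) Y Γ Z).map (gamma.gamma₁₂ f) =
      gamma.gamma₁₂ ((S.str₃ (J W) (J X) Y Γ Z).obj f) ≫
        (S.str₂ (T W) X (T Y) Γ Z).map (gamma.gamma₁₃ f) ≫
        gamma.gamma₂₃ ((S.str₁ W (J X) (J Y) Γ Z).obj f)

end StrongRelPseudomonad

/-! ### Relative pseudomonads -/

/-- A relative pseudomonad along `J : Cat → CAT`, with underlying objects `T` and units `i`: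
`ext` is the extension `f ↦ f^*`, `eta f : f → f^* i`, `mu f g : (f^* g)^* → f^* g^*` and
`theta X : i^* → 1`. Functors compose in diagrammatic order. -/
structure RelPseudomonad (T : Cat.{u, u} → Cat.{u, u + 1}) (i : ∀ X, J X ⥤ T X) where
  ext (X Y : Cat.{u, u}) : (J X ⥤ T Y) ⥤ (T X ⥤ T Y)
  eta {X Y : Cat.{u, u}} (f : J X ⥤ T Y) : f ≅ i X ⋙ (ext X Y).obj f
  mu {W X Y : Cat.{u, u}} (f : J X ⥤ T Y) (g : J W ⥤ T X) :
    (ext W Y).obj (g ⋙ (ext X Y).obj f) ≅ (ext W X).obj g ⋙ (ext X Y).obj f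
  theta (X : Cat.{u, u}) : (ext X X).obj (i X) ≅ 𝟭 (T X)
  eta_naturality {X Y : Cat.{u, u}} {f f' : J X ⥤ T Y} (α : f ⟶ f') :
    (eta f).hom ≫ Functor.whiskerLeft (i X) ((ext X Y).map α) = α ≫ (eta f').hom
  mu_naturality_left {W X Y : Cat.{u, u}} {f f' : J X ⥤ T Y} (α : f ⟶ f') (g : J W ⥤ T X) :
    (ext W Y).map (Functor.whiskerLeft g ((ext X Y).map α)) ≫ (mu f' g).hom =
      (mu f g).hom ≫ Functor.whiskerLeft ((ext W X).obj g) ((ext X Y).map α)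
  mu_naturality_right {W X Y : Cat.{u, u}} (f : J X ⥤ T Y) {g g' : J W ⥤ T X} (β : g ⟶ g') :
    (ext W Y).map (Functor.whiskerRight β ((ext X Y).obj f)) ≫ (mu f g').hom =
      (mu f g).hom ≫ Functor.whiskerRight ((ext W X).map β) ((ext X Y).obj f)
  assoc {V W X Y : Cat.{u, u}} (f : J X ⥤ T Y) (g : J W ⥤ T X) (h : J V ⥤ T W) :
    (mu (g ⋙ (ext X Y).obj f) h).hom ≫ Functor.whiskerLeft ((ext V W).obj h) (mu f g).hom =
      (ext V Y).map (Functor.whiskerLeft h (mu f g).hom) ≫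
        (mu f (h ⋙ (ext W X).obj g)).hom ≫
        Functor.whiskerRight (mu g h).hom ((ext X Y).obj f)
  unit {X Y : Cat.{u, u}} (f : J X ⥤ T Y) :
    (ext X Y).map (eta f).hom ≫ (mu f (i X)).hom ≫
        Functor.whiskerRight (theta X).hom ((ext X Y).obj f) =
      𝟙 ((ext X Y).obj f)

section Unary

variable {T : Cat.{u, u} → Cat.{u, u + 1}} {i : ∀ X, J X ⥤ T X}

/-- `a ↦ (a, ⋆)`. -/
abbrev inUnary (A : Cat.{u, u + 1}) : A ⥤ A × Ctx.prod.{u} .nil :=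
  Functor.prod' (𝟭 A) ((Functor.const _).obj ⟨⟨⟨⟩⟩⟩)

theorem aux_square {C : Type*} [Category* C] {a b c a' b' c' : C} {p : a ⟶ a'} {q : b ⟶ b'}
    {r : c ⟶ c'} {x : a ⟶ b} {y : b ⟶ c} {x' : a' ⟶ b'} {y' : b' ⟶ c'}
    (h : p ≫ x' = x ≫ q) (h' : q ≫ y' = y ≫ r) : p ≫ x' ≫ y' = (x ≫ y) ≫ r := by
  rw [reassoc_of% h, h', Category.assoc]

theorem aux_pentagon {C : Type*} [Category* C]
    {x₀ x₁ x₂ x₃ x₄ y₁ y₂ z₁ z₂ z₃ z₄ z₅ z₆ z₇ : C}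
    {a₁ : x₀ ⟶ x₁} {a₂ : x₁ ⟶ x₂} {a₃ : x₂ ⟶ x₃} {a₄ : x₃ ⟶ x₄} {i₁ : x₃ ⟶ x₃}
    {c₁ : x₁ ⟶ y₁} {c₂ : y₁ ⟶ y₂} {c₃ : y₂ ⟶ x₃} {s₁ : x₀ ⟶ z₁} {k : z₁ ⟶ y₁}
    {m : z₁ ⟶ y₂} {n : z₁ ⟶ z₂} {r : z₂ ⟶ y₂} {s₂ : z₁ ⟶ z₃} {n' : z₃ ⟶ z₄} {t : z₂ ⟶ z₄}
    {h₁ : z₄ ⟶ z₅} {g₁ : z₅ ⟶ x₄} {b₂ : z₃ ⟶ z₆} {q : z₆ ⟶ z₄} {b₃ : z₆ ⟶ z₇}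
    {i₂ : z₇ ⟶ z₇} {g₂ : z₇ ⟶ z₅} {i₃ : z₆ ⟶ z₆} {b₁ : x₀ ⟶ z₃} {b₄ : z₇ ⟶ x₄}
    (A1 : a₂ ≫ a₃ ≫ i₁ = c₁ ≫ c₂ ≫ c₃) (A1' : i₁ = 𝟙 _) (A2 : s₁ ≫ k = a₁ ≫ c₁)
    (A3 : m = k ≫ c₂) (A4 : m = n ≫ r) (A5 : s₂ ≫ n' = n ≫ t)
    (A8 : r ≫ c₃ ≫ a₄ = t ≫ h₁ ≫ g₁) (A6 : n' = b₂ ≫ q)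
    (A7 : b₃ ≫ i₂ ≫ g₂ = i₃ ≫ q ≫ h₁) (A7' : i₂ = 𝟙 _) (A7'' : i₃ = 𝟙 _)
    (B1 : b₁ = s₁ ≫ s₂) (B4 : b₄ = g₂ ≫ g₁) :
    (a₁ ≫ a₂) ≫ a₃ ≫ a₄ = b₁ ≫ (b₂ ≫ b₃) ≫ b₄ := by
  subst A1' A7' A7'' B1 B4 A6
  simp only [Category.comp_id, Category.id_comp] at A1 A7
  simp only [Category.assoc]
  rw [reassoc_of% A1, ← reassoc_of% A2, ← reassoc_of% A3, A4, Category.assoc, A8,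
    ← reassoc_of% A5, reassoc_of% A7]

theorem aux_assoc {C : Type*} [Category* C] {a b c d e : C} {x : a ⟶ b} {y : b ⟶ c} {z : c ⟶ d}
    {t : d ⟶ e} {s : a ⟶ e} (h : x ≫ y ≫ z ≫ t = s) : x ≫ (y ≫ z) ≫ t = s := by
  rw [← h, Category.assoc]

/-- The relative pseudomonad obtained from a strong one by restriction to unary maps. -/
def StrongRelPseudomonad.toRelPseudomonad (S : StrongRelPseudomonad T i) :
    RelPseudomonad T i where
  ext X Y := (Functor.whiskeringLeft _ _ _).obj
      (CategoryTheory.Prod.fst (J X) (Ctx.prod.{u} .nil)) ⋙ S.str X Y .nil ⋙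
    (Functor.whiskeringLeft _ _ _).obj (inUnary (T X))
  eta {X Y} f := Functor.isoWhiskerLeft (inUnary (J X)) (S.tilde (Γ := .nil) (unary f))
  mu {W X Y} f g := Functor.isoWhiskerLeft (inUnary (T W))
    (S.pn (Γ := .app .nil .nil) (Δ := .nil) (Functor.prod' (𝟭 _) (Ctx.bang .nil))
        (mcomp ((S.str X Y .nil).obj (unary f)) (unary g)) ≪≫
      Functor.isoWhiskerLeft
        ((𝟭 (T W)).prod (Functor.prod' (𝟭 (Ctx.prod.{u} .nil)) (Ctx.bang .nil)))
        (S.hat (Γ := .nil) (Δ := .nil) (unary f) (unary g)))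
  theta X := Functor.isoWhiskerLeft (inUnary (T X)) (S.theta X)
  eta_naturality {X Y f f'} α :=
    congrArg (Functor.whiskerLeft (inUnary (J X)))
      (S.tilde_naturality (Γ := .nil) (Functor.whiskerLeft (CategoryTheory.Prod.fst _ _) α))
  mu_naturality_left {W X Y f f'} α g := by
    ext w
    have h1 := NatTrans.congr_app (S.pn_naturality (Γ := .app .nil .nil) (Δ := .nil)
      (Functor.prod' (𝟭 _) (Ctx.bang .nil)) (mcompL ((S.str X Y .nil).map
        (Functor.whiskerLeft (CategoryTheory.Prod.fst _ _) α)) (unary g))) (w, ⟨⟨⟨⟩⟩⟩)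
    have h2 := NatTrans.congr_app (S.hat_naturality_left (Γ := .nil) (Δ := .nil)
      (Functor.whiskerLeft (CategoryTheory.Prod.fst (J X) (Ctx.prod.{u} .nil)) α) (unary g))
      (w, (⟨⟨⟨⟩⟩⟩, ⟨⟨⟨⟩⟩⟩))
    exact aux_square h1 h2
  mu_naturality_right {W X Y} f {g g'} β := by
    ext w
    have h1 := NatTrans.congr_app (S.pn_naturality (Γ := .app .nil .nil) (Δ := .nil)
      (Functor.prod' (𝟭 _) (Ctx.bang .nil)) (mcompR ((S.str X Y .nil).obj (unary f))
        (Functor.whiskerLeft (CategoryTheory.Prod.fst (J W) (Ctx.prod.{u} .nil)) β)))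
      (w, ⟨⟨⟨⟩⟩⟩)
    have h2 := NatTrans.congr_app (S.hat_naturality_right (Γ := .nil) (Δ := .nil) (unary f)
      (Functor.whiskerLeft (CategoryTheory.Prod.fst (J W) (Ctx.prod.{u} .nil)) β))
      (w, (⟨⟨⟨⟩⟩⟩, ⟨⟨⟨⟩⟩⟩))
    exact aux_square h1 h2
  assoc {V W X Y} f g h := by
    ext v
    let d : Ctx.prod.{u} .nil ⥤ Ctx.prod.{u} (.app .nil .nil) :=
      Functor.prod' (𝟭 _) (Ctx.bang .nil)
    let e : Ctx.prod.{u} .nil ⥤ Ctx.prod.{u} (.app .nil (.app .nil .nil)) :=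
      d ⋙ (𝟭 (Ctx.prod.{u} .nil)).prod d
    let M : J W × Ctx.prod.{u} (.app .nil .nil) ⥤ T Y :=
      mcomp ((S.str X Y .nil).obj (unary f)) (unary g)
    let N : J V × Ctx.prod.{u} (.app .nil .nil) ⥤ T X :=
      mcomp ((S.str W X .nil).obj (unary g)) (unary h)
    have A1 := NatTrans.congr_app (S.hat_pn (Γ := .app .nil .nil) (Γ' := .nil) (Δ := .nil)
      (Δ' := .nil) d (𝟭 _) M (unary h)) (v, (⟨⟨⟨⟩⟩⟩, ⟨⟨⟨⟩⟩⟩))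
    have A1' : (mcompR (subst d ((S.str W Y (.app .nil .nil)).obj M))
        (S.pn (𝟭 (Ctx.prod.{u} .nil)) (unary h)).hom).app (v, (⟨⟨⟨⟩⟩⟩, ⟨⟨⟨⟩⟩⟩)) = 𝟙 _ := by
      rw [S.pn_id]
      exact CategoryTheory.Functor.map_id _ _
    have A2 := NatTrans.congr_app (S.pn_naturality (Γ := .app .nil .nil) (Δ := .nil) d
      (mcompL (S.pn (Γ := .app .nil .nil) (Δ := .nil) d M).hom (unary h))) (v, ⟨⟨⟨⟩⟩⟩)
    have A3 := NatTrans.congr_app (S.pn_comp (Γ := .app (.app .nil .nil) .nil)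
      (Δ := .app .nil .nil) (Θ := .nil) (d.prod (𝟭 _)) d
      (mcomp ((S.str W Y (.app .nil .nil)).obj M) (unary h))) (v, ⟨⟨⟨⟩⟩⟩)
    have A4 := NatTrans.congr_app (S.pn_comp (Γ := .app (.app .nil .nil) .nil)
      (Δ := .app .nil (.app .nil .nil)) (Θ := .nil) (reassoc _ _ _) e
      (mcomp ((S.str W Y (.app .nil .nil)).obj M) (unary h))) (v, ⟨⟨⟨⟩⟩⟩)
    have A5 := NatTrans.congr_app (S.pn_naturality (Γ := .app .nil (.app .nil .nil)) (Δ := .nil) e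
      (Functor.whiskerLeft ((𝟭 (J V)).prod (reassoc (Ctx.prod.{u} .nil) (Ctx.prod.{u} .nil)
        (Ctx.prod.{u} .nil))) (mcompL (S.hat (unary f) (unary g)).hom (unary h)))) (v, ⟨⟨⟨⟩⟩⟩)
    have A6 := NatTrans.congr_app (S.pn_comp (Γ := .app .nil (.app .nil .nil))
      (Δ := .app .nil .nil) (Θ := .nil) ((𝟭 _).prod d) d
      (mcomp ((S.str X Y .nil).obj (unary f)) N)) (v, ⟨⟨⟨⟩⟩⟩)
    have A7 := NatTrans.congr_app (S.hat_pn (Γ := .nil) (Γ' := .nil) (Δ := .app .nil .nil)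
      (Δ' := .nil) (𝟭 _) d (unary f) N) (v, (⟨⟨⟨⟩⟩⟩, ⟨⟨⟨⟩⟩⟩))
    have A7' : (mcompL (S.pn (𝟭 (Ctx.prod.{u} .nil)) (unary f)).hom
        ((S.str V X .nil).obj (subst d N))).app (v, (⟨⟨⟨⟩⟩⟩, ⟨⟨⟨⟩⟩⟩)) = 𝟙 _ := by
      rw [S.pn_id]
      rfl
    have A7'' : ((S.str V Y (.app .nil .nil)).map (mcompL (S.pn (𝟭 (Ctx.prod.{u} .nil))
        (unary f)).hom (subst d N))).app (v, (⟨⟨⟨⟩⟩⟩, ⟨⟨⟨⟩⟩⟩)) = 𝟙 _ := by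
      rw [S.pn_id]
      exact NatTrans.congr_app (CategoryTheory.Functor.map_id _ _) _
    have A8 := NatTrans.congr_app (S.assoc (Γ := .nil) (Δ := .nil) (Θ := .nil)
      (unary f) (unary g) (unary h)) (v, (⟨⟨⟨⟩⟩⟩, (⟨⟨⟨⟩⟩⟩, ⟨⟨⟨⟩⟩⟩)))
    have B1 := NatTrans.congr_app ((S.str V Y .nil).map_comp
      (Functor.whiskerLeft ((𝟭 (J V)).prod d)
        (mcompL (S.pn (Γ := .app .nil .nil) (Δ := .nil) d M).hom (unary h)))
      (Functor.whiskerLeft ((𝟭 (J V)).prod e)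
        (Functor.whiskerLeft ((𝟭 (J V)).prod (reassoc (Ctx.prod.{u} .nil) (Ctx.prod.{u} .nil)
          (Ctx.prod.{u} .nil))) (mcompL (S.hat (unary f) (unary g)).hom (unary h)))))
      (v, ⟨⟨⟨⟩⟩⟩)
    have B4 := ((inUnary (T X)) ⋙ (S.str X Y .nil).obj (unary f)).map_comp
      ((S.pn (Γ := .app .nil .nil) (Δ := .nil) d N).hom.app (v, ⟨⟨⟨⟩⟩⟩))
      ((S.hat (unary g) (unary h)).hom.app (v, (⟨⟨⟨⟩⟩⟩, ⟨⟨⟨⟩⟩⟩)))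
    exact aux_pentagon A1 A1' A2 A3 A4 A5 A8 A6 A7 A7' A7'' B1 B4
  unit {X Y} f := by
    ext w
    have h := NatTrans.congr_app (S.unit (Γ := .nil) (unary f)) (w, ⟨⟨⟨⟩⟩⟩)
    exact aux_assoc h

end Unary

/-! ### Multimorphisms with no distinguished argument

In this part a finite list of objects is a family `X : ι → Cat` over a finite type `ι`, and
`CAT(X; Z)` is the functor category `(∀ k, X k) ⥤ Z`. As `J` is fully faithful, a multimorphism
`X₁, …, Xₙ → Y` of small categories is taken to be a functor `(∀ k, J (X k)) ⥤ J Y`. -/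

/-- The identity multimorphism. -/
abbrev idMap (A : Cat.{u, u + 1}) : (∀ _ : Unit, A) ⥤ A := Pi.eval (fun _ : Unit => ↑A) ()

/-- `w ↦ (g k (w ∘ e k))ₖ`. -/
abbrev tuple {ι κ : Type} {fib : ι → Type} (e : ∀ k, fib k → κ) {W : κ → Cat.{u, u + 1}}
    {X : ι → Cat.{u, u + 1}} (g : ∀ k, (∀ m : fib k, W (e k m)) ⥤ X k) :
    (∀ m, W m) ⥤ (∀ k, X k) :=
  Functor.pi' (fun k => Pi.comap (fun m => ↑(W m)) (e k) ⋙ g k)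

/-- The composite `f ∘ (g₁, …, gₙ)` of multimorphisms. The arguments of `g k` are indexed by
`fib k`, those of the composite by `κ`, and `e` says which argument of the composite is the `m`-th
argument of `g k`; this is used when `(k, m) ↦ e k m` is a bijection. -/
abbrev fcomp {ι κ : Type} {fib : ι → Type} (e : ∀ k, fib k → κ) {W : κ → Cat.{u, u + 1}}
    {X : ι → Cat.{u, u + 1}} {Z : Cat.{u, u + 1}} (f : (∀ k, X k) ⥤ Z)
    (g : ∀ k, (∀ m : fib k, W (e k m)) ⥤ X k) : (∀ m, W m) ⥤ Z :=
  tuple e g ⋙ f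

/-- `fcomp` on 2-cells in the outer multimorphism. -/
abbrev fcompL {ι κ : Type} {fib : ι → Type} (e : ∀ k, fib k → κ) {W : κ → Cat.{u, u + 1}}
    {X : ι → Cat.{u, u + 1}} {Z : Cat.{u, u + 1}} {f f' : (∀ k, X k) ⥤ Z} (α : f ⟶ f')
    (g : ∀ k, (∀ m : fib k, W (e k m)) ⥤ X k) : fcomp e f g ⟶ fcomp e f' g :=
  Functor.whiskerLeft (tuple e g) α

/-- `fcomp` on 2-cells in the inner multimorphisms. -/
abbrev fcompR {ι κ : Type} {fib : ι → Type} (e : ∀ k, fib k → κ) {W : κ → Cat.{u, u + 1}}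
    {X : ι → Cat.{u, u + 1}} {Z : Cat.{u, u + 1}} (f : (∀ k, X k) ⥤ Z)
    {g g' : ∀ k, (∀ m : fib k, W (e k m)) ⥤ X k} (β : ∀ k, g k ⟶ g' k) :
    fcomp e f g ⟶ fcomp e f g' :=
  Functor.whiskerRight
    (NatTrans.pi' (fun k => Functor.whiskerLeft (Pi.comap (fun m => ↑(W m)) (e k)) (β k)) :
      tuple e g ⟶ tuple e g') f

/-- Every argument of a composite is an argument of exactly one of the inner multimorphisms. -/
abbrev IsConcat {ι κ : Type} {fib : ι → Type} (e : ∀ k, fib k → κ) : Prop :=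
  Function.Bijective (fun p : Σ k, fib k => e p.1 p.2)

theorem isConcat_id (κ : Type) : IsConcat (fun (_ : Unit) (m : κ) => m) :=
  ⟨fun ⟨_, _⟩ ⟨_, _⟩ h => by cases h; rfl, fun m => ⟨⟨(), m⟩, rfl⟩⟩

theorem isConcat_id' (ι : Type) : IsConcat (fun (k : ι) (_ : Unit) => k) :=
  ⟨fun ⟨_, _⟩ ⟨_, _⟩ h => by cases h; rfl, fun k => ⟨⟨k, ()⟩, rfl⟩⟩

theorem isConcat_sigma {ι : Type} (fib : ι → Type) :
    IsConcat (κ := Σ k, fib k) (fun k (m : fib k) => ⟨k, m⟩) :=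
  ⟨fun _ _ h => h, fun p => ⟨p, rfl⟩⟩

theorem isConcat_comp {ι κ ν : Type} {fib : ι → Type} {e : ∀ k, fib k → κ} {fib' : κ → Type}
    {e' : ∀ k, fib' k → ν} (he : IsConcat e) (he' : IsConcat e') :
    IsConcat (fun k (p : Σ m : fib k, fib' (e k m)) => e' (e k p.1) p.2) := by
  constructor
  · rintro ⟨k, m, n⟩ ⟨k', m', n'⟩ h
    have h₁ := he'.1 (a₁ := ⟨e k m, n⟩) (a₂ := ⟨e k' m', n'⟩) h
    have h₂ := he.1 (a₁ := ⟨k, m⟩) (a₂ := ⟨k', m'⟩) (Sigma.mk.inj h₁).1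
    cases h₂
    cases h₁
    rfl
  · intro x
    obtain ⟨⟨l, n⟩, rfl⟩ := he'.2 x
    obtain ⟨⟨k, m⟩, rfl⟩ := he.2 l
    exact ⟨⟨k, m, n⟩, rfl⟩

/-- A pseudo-multifunctor `Cat → CAT` with object function `T`: functors `map` on hom-categories and
2-cells `mapId : F 1 ≅ 1` and `mapComp : F (f ∘ (g₁, …, gₙ)) ≅ F f ∘ (F g₁, …, F gₙ)`. -/
structure PseudoMultifunctor (T : Cat.{u, u} → Cat.{u, u + 1}) where
  map {ι : Type} [Finite ι] (X : ι → Cat.{u, u}) (Y : Cat.{u, u}) :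
    ((∀ k, J (X k)) ⥤ J Y) ⥤ ((∀ k, T (X k)) ⥤ T Y)
  mapId (X : Cat.{u, u}) : (map (fun _ : Unit => X) X).obj (idMap (J X)) ≅ idMap (T X)
  mapComp {ι κ : Type} [Finite ι] [Finite κ] {fib : ι → Type} [∀ k, Finite (fib k)]
    (e : ∀ k, fib k → κ) (he : IsConcat e) {W : κ → Cat.{u, u}} {X : ι → Cat.{u, u}}
    {Y : Cat.{u, u}} (f : (∀ k, J (X k)) ⥤ J Y)
    (g : ∀ k, (∀ m : fib k, J (W (e k m))) ⥤ J (X k)) :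
    (map W Y).obj (fcomp e (W := fun m => J (W m)) (X := fun k => J (X k)) f g) ≅
      fcomp e (W := fun m => T (W m)) (X := fun k => T (X k)) ((map X Y).obj f)
        (fun k => (map (fun m => W (e k m)) (X k)).obj (g k))
  mapComp_naturality_left {ι κ : Type} [Finite ι] [Finite κ] {fib : ι → Type}
    [∀ k, Finite (fib k)] (e : ∀ k, fib k → κ) (he : IsConcat e) {W : κ → Cat.{u, u}}
    {X : ι → Cat.{u, u}} {Y : Cat.{u, u}} {f f' : (∀ k, J (X k)) ⥤ J Y} (α : f ⟶ f')
    (g : ∀ k, (∀ m : fib k, J (W (e k m))) ⥤ J (X k)) :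
    (map W Y).map (fcompL e (W := fun m => J (W m)) (X := fun k => J (X k)) α g) ≫
        (mapComp e he f' g).hom =
      (mapComp e he f g).hom ≫
        fcompL e (W := fun m => T (W m)) (X := fun k => T (X k)) ((map X Y).map α)
          (fun k => (map (fun m => W (e k m)) (X k)).obj (g k))
  mapComp_naturality_right {ι κ : Type} [Finite ι] [Finite κ] {fib : ι → Type}
    [∀ k, Finite (fib k)] (e : ∀ k, fib k → κ) (he : IsConcat e) {W : κ → Cat.{u, u}}
    {X : ι → Cat.{u, u}} {Y : Cat.{u, u}} (f : (∀ k, J (X k)) ⥤ J Y)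
    {g g' : ∀ k, (∀ m : fib k, J (W (e k m))) ⥤ J (X k)} (β : ∀ k, g k ⟶ g' k) :
    (map W Y).map (fcompR e (W := fun m => J (W m)) (X := fun k => J (X k)) f β) ≫
        (mapComp e he f g').hom =
      (mapComp e he f g).hom ≫
        fcompR e (W := fun m => T (W m)) (X := fun k => T (X k)) ((map X Y).obj f)
          (fun k => (map (fun m => W (e k m)) (X k)).map (β k))
  /-- First unit axiom, on `1 ∘ f = f`. -/
  id_comp {κ : Type} [Finite κ] {X : κ → Cat.{u, u}} {Y : Cat.{u, u}}
    (f : (∀ k, J (X k)) ⥤ J Y) :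
    (mapComp (fun (_ : Unit) (m : κ) => m) (isConcat_id κ) (X := fun _ => Y) (W := X)
        (idMap (J Y)) (fun _ => f)).hom ≫
      fcompL (fun (_ : Unit) (m : κ) => m) (W := fun m => T (X m)) (X := fun _ => T Y)
        (mapId Y).hom (fun _ => (map X Y).obj f) =
    𝟙 ((map X Y).obj f)
  /-- Second unit axiom, on `f ∘ (1, …, 1) = f`. -/
  comp_id {ι : Type} [Finite ι] {X : ι → Cat.{u, u}} {Y : Cat.{u, u}}
    (f : (∀ k, J (X k)) ⥤ J Y) :
    (mapComp (fun (k : ι) (_ : Unit) => k) (isConcat_id' ι) (W := X) f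
        (fun k => idMap (J (X k)))).hom ≫
      fcompR (fun (k : ι) (_ : Unit) => k) (W := fun k => T (X k)) (X := fun k => T (X k))
        ((map X Y).obj f) (fun k => (mapId (X k)).hom) =
    𝟙 ((map X Y).obj f)
  /-- Associativity axiom, on `(f ∘ (gₖ)ₖ) ∘ (hₗ)ₗ = f ∘ (gₖ ∘ (hₗ)ₗ)ₖ`. -/
  assoc {ι κ ν : Type} [Finite ι] [Finite κ] [Finite ν] {fib : ι → Type} [∀ k, Finite (fib k)]
    (e : ∀ k, fib k → κ) (he : IsConcat e) {fib' : κ → Type} [∀ k, Finite (fib' k)]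
    (e' : ∀ k, fib' k → ν) (he' : IsConcat e') {V : ν → Cat.{u, u}} {W : κ → Cat.{u, u}}
    {X : ι → Cat.{u, u}} {Y : Cat.{u, u}} (f : (∀ k, J (X k)) ⥤ J Y)
    (g : ∀ k, (∀ m : fib k, J (W (e k m))) ⥤ J (X k))
    (h : ∀ l, (∀ n : fib' l, J (V (e' l n))) ⥤ J (W l)) :
    (mapComp e' he' (fcomp e (W := fun m => J (W m)) (X := fun k => J (X k)) f g) h).hom ≫
      fcompL e' (W := fun n => T (V n)) (X := fun l => T (W l)) (mapComp e he f g).hom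
        (fun l => (map (fun n => V (e' l n)) (W l)).obj (h l)) =
    (mapComp (fun k (p : Σ m : fib k, fib' (e k m)) => e' (e k p.1) p.2)
        (isConcat_comp he he') f
        (fun k => fcomp (fun (m : fib k) (n : fib' (e k m)) => Sigma.mk m n)
          (W := fun p => J (V (e' (e k p.1) p.2))) (X := fun m => J (W (e k m))) (g k)
          (fun m => h (e k m)))).hom ≫
      fcompR (fun k (p : Σ m : fib k, fib' (e k m)) => e' (e k p.1) p.2)
        (W := fun n => T (V n)) (X := fun k => T (X k)) ((map X Y).obj f)
        (fun k => (mapComp (fun (m : fib k) (n : fib' (e k m)) => Sigma.mk m n)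
          (isConcat_sigma _) (W := fun p => V (e' (e k p.1) p.2)) (X := fun m => W (e k m)) (g k)
          (fun m => h (e k m))).hom)

/-- The structure making a relative pseudomonad along `J : Cat → CAT` a multicategorical relative
pseudomonad. -/
structure RelPseudomonad.Multicategorical {T : Cat.{u, u} → Cat.{u, u + 1}}
    {i : ∀ X, J X ⥤ T X} (R : RelPseudomonad T i) where
  F : PseudoMultifunctor T
  /-- `ī_f : i ∘ J f → T f ∘ (i, …, i)`. -/
  unitCell {ι : Type} [Finite ι] {X : ι → Cat.{u, u}} {Y : Cat.{u, u}}
    (f : (∀ k, J (X k)) ⥤ J Y) :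
    f ⋙ i Y ≅ Functor.pi (fun k => i (X k)) ⋙ (F.map X Y).obj f
  unitCell_naturality {ι : Type} [Finite ι] {X : ι → Cat.{u, u}} {Y : Cat.{u, u}}
    {f f' : (∀ k, J (X k)) ⥤ J Y} (α : f ⟶ f') :
    Functor.whiskerRight α (i Y) ≫ (unitCell f').hom =
      (unitCell f).hom ≫ Functor.whiskerLeft (Functor.pi (fun k => i (X k))) ((F.map X Y).map α)
  /-- `α ↦ α^*`. -/
  extCell {ι : Type} [Finite ι] {X X' : ι → Cat.{u, u}} {Y Y' : Cat.{u, u}}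
    {f : (∀ k, J (X k)) ⥤ J Y} {f' : (∀ k, J (X' k)) ⥤ J Y'} {g : ∀ k, J (X k) ⥤ T (X' k)}
    {h : J Y ⥤ T Y'} (α : f ⋙ h ⟶ Functor.pi g ⋙ (F.map X' Y').obj f') :
    (F.map X Y).obj f ⋙ (R.ext Y Y').obj h ⟶
      Functor.pi (fun k => (R.ext (X k) (X' k)).obj (g k)) ⋙ (F.map X' Y').obj f'
  /-- Compatibility with `eta`. -/
  eta_compat {ι : Type} [Finite ι] {X X' : ι → Cat.{u, u}} {Y Y' : Cat.{u, u}}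
    {f : (∀ k, J (X k)) ⥤ J Y} {f' : (∀ k, J (X' k)) ⥤ J Y'} {g : ∀ k, J (X k) ⥤ T (X' k)}
    {h : J Y ⥤ T Y'} (α : f ⋙ h ⟶ Functor.pi g ⋙ (F.map X' Y').obj f') :
    Functor.whiskerLeft f (R.eta h).hom ≫
        Functor.whiskerRight (unitCell f).hom ((R.ext Y Y').obj h) ≫
        Functor.whiskerLeft (Functor.pi (fun k => i (X k))) (extCell α) =
      α ≫ Functor.whiskerRight (NatTrans.pi (fun k => (R.eta (g k)).hom)) ((F.map X' Y').obj f')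
  /-- Compatibility with `mu`. -/
  mu_compat {ι : Type} [Finite ι] {X X' X'' : ι → Cat.{u, u}} {Y Y' Y'' : Cat.{u, u}}
    {f : (∀ k, J (X k)) ⥤ J Y} {f' : (∀ k, J (X' k)) ⥤ J Y'} {f'' : (∀ k, J (X'' k)) ⥤ J Y''}
    {g : ∀ k, J (X k) ⥤ T (X' k)} {g' : ∀ k, J (X' k) ⥤ T (X'' k)}
    {h : J Y ⥤ T Y'} {h' : J Y' ⥤ T Y''}
    (α : f ⋙ h ⟶ Functor.pi g ⋙ (F.map X' Y').obj f')
    (β : f' ⋙ h' ⟶ Functor.pi g' ⋙ (F.map X'' Y'').obj f'') :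
    Functor.whiskerLeft ((F.map X Y).obj f) (R.mu h' h).hom ≫
        Functor.whiskerRight (extCell α) ((R.ext Y' Y'').obj h') ≫
        Functor.whiskerLeft (Functor.pi (fun k => (R.ext (X k) (X' k)).obj (g k))) (extCell β) =
      extCell (f := f) (f' := f'') (g := fun k => g k ⋙ (R.ext (X' k) (X'' k)).obj (g' k))
          (h := h ⋙ (R.ext Y' Y'').obj h')
          (Functor.whiskerRight α ((R.ext Y' Y'').obj h') ≫
            Functor.whiskerLeft (Functor.pi g) (extCell β)) ≫
        Functor.whiskerRight (NatTrans.pi (fun k => (R.mu (g' k) (g k)).hom))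
          ((F.map X'' Y'').obj f'')
  /-- Compatibility with `theta`. -/
  theta_compat {ι : Type} [Finite ι] {X : ι → Cat.{u, u}} {Y : Cat.{u, u}}
    (f : (∀ k, J (X k)) ⥤ J Y) :
    extCell (unitCell f).hom ≫
        Functor.whiskerRight (NatTrans.pi (fun k => (R.theta (X k)).hom)) ((F.map X Y).obj f) =
      Functor.whiskerLeft ((F.map X Y).obj f) (R.theta Y).hom

/-! ### Presheaves -/

/-- The category of presheaves on a small category. -/
abbrev Psh (X : Cat.{u, u}) : Cat.{u, u + 1} := Cat.of (Xᵒᵖ ⥤ Type u)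

/-- The Yoneda embedding. -/
abbrev yon (X : Cat.{u, u}) : J X ⥤ Psh X := ULift.downFunctor ⋙ yoneda

/-- A choice, for every multimorphism `f : B₁, …, X, …, Bₙ → Psh Y`, of a left Kan extension
`(lan f, unit f)` of `f` along `1, …, y, …, 1`. -/
structure LanChoice where
  lan {X Y : Cat.{u, u}} {Γ : Ctx.{u}} (f : J X × Γ.prod ⥤ Psh Y) : Psh X × Γ.prod ⥤ Psh Y
  unit {X Y : Cat.{u, u}} {Γ : Ctx.{u}} (f : J X × Γ.prod ⥤ Psh Y) :
    f ⟶ (yon X).prod (𝟭 Γ.prod) ⋙ lan f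
  isLan {X Y : Cat.{u, u}} {Γ : Ctx.{u}} (f : J X × Γ.prod ⥤ Psh Y) :
    (lan f).IsLeftKanExtension (unit f)

/-- The strengthenings of `S` and the 2-cells `tilde` are the chosen left Kan extensions. -/
def StrongRelPseudomonad.StrengthIsLan (S : StrongRelPseudomonad Psh.{u} yon) (K : LanChoice.{u}) :
    Prop :=
  ∀ {X Y : Cat.{u, u}} {Γ : Ctx.{u}} (f : J X × Γ.prod ⥤ Psh Y),
    ∃ h : K.lan f = (S.str X Y Γ).obj f,
      K.unit f ≫ Functor.whiskerLeft ((yon X).prod (𝟭 Γ.prod)) (eqToHom h) = (S.tilde f).hom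

end RelPsh

/-!
Every presheaf is a colimit of representables, and this is the reason for every part of the
theorem. Call a functor `F : Psh X × G ⥤ Z` cocontinuous in its first argument if each `F(-, γ)`
preserves small colimits (`IsCocontFst`). Such a functor is a left Kan extension of its restriction
along `y × 1` (`IsCocontFst.isLeftKanExtension`), and every `f : X × G ⥤ Psh Y` has an extension of
this kind, obtained for each `γ` from the universal property of `Psh X`. Hence the left Kan
extension `f^t` along `y × 1` exists, is cocontinuous in its first argument whichever way it is
chosen, and its unit `f → f^t ∘ y` is invertible. Functors cocontinuous in their first argument are
closed under substitution in the other arguments and under composition in the first one.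

So a 2-cell `f^t → H` is the same as a 2-cell `f → H ∘ y`, and it is invertible if the latter is
and `H` is cocontinuous. The structural 2-cells (`LanChoice.pn`, `LanChoice.hat`,
`LanChoice.theta`) are defined by this universal property, and each axiom is an equation of 2-cells
out of some `f^t`, to be checked at representables, where it says how the units compose. The
universal property is also the adjunction required for lax-idempotency.

For the pseudocommutativity, 2-cells out of `f^{ts}` and out of `f^{st}` are determined by their
restrictions along `y` in both arguments (`LanChoice.hom_extLR`, `LanChoice.hom_extRL`), and both
functors restrict to `f`. This gives the isomorphism `γ_f : f^{ts} → f^{st}` and reduces its axioms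
to pairs, or triples, of representables. As `f^{ts} ≅ f^{st}`, the functor `f^{ts}` is cocontinuous
in both arguments, which is what compatibility with `hat` in the left argument needs.

For the multicategorical structure, a functor of several variables is called separately
cocontinuous if it preserves colimits in each variable (`IsSepCocont`). Families of presheaves are
generated by families of representables under colimits in one coordinate at a time
(`pi_presheaf_induction`), and a separately cocontinuous functor is a left Kan extension of its
restriction along `(y, …, y)` (`IsSepCocont.isLeftKanExtension`). Extensions exist because the
external product `p ↦ (x ↦ ∏ₖ pₖ(xₖ))` is separately cocontinuous and sends representables to
representables, so that it can be followed by a cocontinuous functor on presheaves on `∏ₖ Xₖ`. Then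
`Tf` is the extension of `y ∘ f`, and all cells and axioms come from the universal property as
before.
-/

namespace RelPsh

open Limits

/-! ### Pasting -/

section Whisker

/-! Composites of a commuting polygon with a further map. The terms are stated for an arbitrary
category, so that they apply where morphisms of `Psh X` and of its underlying functor category are
identified only up to unfolding. -/

variable {C : Type*} [Category* C] {a b c d b' c' : C}

theorem whisker_triangle {k : a ⟶ b} {l : b ⟶ c} {m : a ⟶ c} (h : k ≫ l = m) (r : c ⟶ d) :
    k ≫ l ≫ r = m ≫ r := by
  rw [← h, Category.assoc]

theorem whisker_square {k : a ⟶ b} {l : b ⟶ c} {m : a ⟶ b'} {n : b' ⟶ c} (h : k ≫ l = m ≫ n)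
    (r : c ⟶ d) : k ≫ l ≫ r = m ≫ n ≫ r := by
  rw [whisker_triangle h, Category.assoc]

theorem whisker_pentagon {k : a ⟶ b} {l : b ⟶ b'} {l' : b' ⟶ c} {m : a ⟶ c'} {n : c' ⟶ c}
    (h : k ≫ l ≫ l' = m ≫ n) (r : c ⟶ d) : k ≫ l ≫ l' ≫ r = m ≫ n ≫ r := by
  rw [← Category.assoc m, ← h, Category.assoc, Category.assoc]

theorem map_whisker_pentagon {C D : Type*} [Category* C] [Category* D] (F : C ⥤ D)
    {a b b' c c' : C} {d : D} {k : a ⟶ b} {l : b ⟶ b'} {l' : b' ⟶ c} {m : a ⟶ c'} {n : c' ⟶ c}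
    (h : k ≫ l ≫ l' = m ≫ n) (r : F.obj c ⟶ d) :
    F.map k ≫ F.map l ≫ F.map l' ≫ r = F.map m ≫ F.map n ≫ r := by
  simp only [← F.map_comp_assoc, h]

end Whisker

/-! ### Functors preserving colimits in their first argument -/

section Cocontinuity

universe v₁ v₂ v₃ v₄ v₅ w₁ w₂ w₃ w₄ w₅

variable {A : Type w₁} [Category.{v₁} A] {A' : Type w₂} [Category.{v₂} A']
  {G : Type w₃} [Category.{v₃} G] {D : Type w₄} [Category.{v₄} D] {Z : Type w₅} [Category.{v₅} Z]

/-- `F : A × G ⥤ Z` preserves small colimits in its first argument. -/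
def IsCocontFst (F : A × G ⥤ Z) : Prop :=
  ∀ γ : G, PreservesColimitsOfSize.{u, u} (Prod.sectL A γ ⋙ F)

theorem IsCocontFst.of_iso {F F' : A × G ⥤ Z} (hF : IsCocontFst.{u} F) (e : F ≅ F') :
    IsCocontFst.{u} F' := fun γ =>
  have := hF γ
  preservesColimits_of_natIso (Functor.isoWhiskerLeft (Prod.sectL A γ) e)

theorem IsCocontFst.subst {F : A × G ⥤ Z} (hF : IsCocontFst.{u} F) (S : D ⥤ G) :
    IsCocontFst.{u} (subst S F) := fun δ =>
  have := hF (S.obj δ)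
  preservesColimits_of_natIso
    (NatIso.ofComponents (fun a => Iso.refl (F.obj (a, S.obj δ))) (fun φ =>
        (Category.comp_id _).trans ((congrArg (fun k => F.map (Prod.mkHom φ k))
          (S.map_id δ).symm).trans (Category.id_comp _).symm)) :
      Prod.sectL A (S.obj δ) ⋙ F ≅ Prod.sectL A δ ⋙ RelPsh.subst S F)

theorem IsCocontFst.mcomp {F : A × G ⥤ Z} {g : A' × D ⥤ A} (hF : IsCocontFst.{u} F)
    (hg : IsCocontFst.{u} g) : IsCocontFst.{u} (mcomp F g) := fun ⟨γ, δ⟩ =>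
  have := hF γ
  have := hg δ
  preservesColimits_of_natIso
    (NatIso.ofComponents (fun a => Iso.refl (F.obj (g.obj (a, δ), γ))) (fun _ =>
        (Category.comp_id _).trans (Category.id_comp _).symm) :
      (Prod.sectL A' δ ⋙ g) ⋙ Prod.sectL A γ ⋙ F ≅ Prod.sectL A' (γ, δ) ⋙ RelPsh.mcomp F g)

/-- The composite with `𝟭 A` is the form in which `unary (𝟭 A)` unfolds. -/
theorem isCocontFst_fst : IsCocontFst.{u} (CategoryTheory.Prod.fst A G ⋙ 𝟭 A) := fun γ =>
  preservesColimits_of_natIso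
    (NatIso.ofComponents (fun a => Iso.refl a) (fun _ =>
        (Category.comp_id _).trans (Category.id_comp _).symm) :
      𝟭 A ≅ Prod.sectL A γ ⋙ CategoryTheory.Prod.fst A G ⋙ 𝟭 A)

end Cocontinuity

/-- An object of `X`, as an object of `J X`. -/
abbrev J.up {X : Cat.{u, u}} (x : X) : J X := ULift.up x

section Density

universe v₃ v₅ w₃ w₅

variable {X : Type u} [Category.{u} X] {G : Type w₃} [Category.{v₃} G] {Z : Type w₅}
  [Category.{v₅} Z]

/-- If two functors send a cocone to colimit cocones, a 2-cell between them which is invertible on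
the diagram is invertible at the apex. -/
theorem isIso_app_of_isColimit {C : Type*} [Category* C] {K : Type*} [Category* K]
    {F F' : C ⥤ Z} (α : F ⟶ F') {D : K ⥤ C} {c : Cocone D}
    (hF : IsColimit (F.mapCocone c)) (hF' : IsColimit (F'.mapCocone c))
    (h : ∀ j, IsIso (α.app (D.obj j))) : IsIso (α.app c.pt) := by
  let e := NatIso.ofComponents (F := D ⋙ F) (G := D ⋙ F') (fun j => asIso (α.app (D.obj j)))
      (fun f => α.naturality _)
  have : α.app c.pt = (IsColimit.coconePointsIsoOfNatIso hF hF' e).hom := by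
    refine hF.hom_ext (fun j => ?_)
    rw [IsColimit.comp_coconePointsIsoOfNatIso_hom]
    exact α.naturality _
  rw [this]
  infer_instance

/-- The colimit expressing `F (p, γ)` through the values of `F` at representables. -/
noncomputable def IsCocontFst.isColimit {F : (Xᵒᵖ ⥤ Type u) × G ⥤ Z} (hF : IsCocontFst.{u} F)
    (p : Xᵒᵖ ⥤ Type u) (γ : G) :
    IsColimit ((Prod.sectL (Xᵒᵖ ⥤ Type u) γ ⋙ F).mapCocone (Presheaf.tautologicalCocone p)) :=
  have := hF γ
  isColimitOfPreserves _ (Presheaf.isColimitTautologicalCocone p)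

/-- 2-cells out of a functor which is cocontinuous in its first argument are determined by their
components at representables. -/
theorem IsCocontFst.hom_ext {F F' : (Xᵒᵖ ⥤ Type u) × G ⥤ Z} (hF : IsCocontFst.{u} F)
    {α β : F ⟶ F'} (h : ∀ x γ, α.app (yoneda.obj x, γ) = β.app (yoneda.obj x, γ)) : α = β := by
  ext ⟨p, γ⟩
  refine (hF.isColimit p γ).hom_ext (fun j => ?_)
  exact (α.naturality _).trans (((h _ _) =≫ _).trans (β.naturality _).symm)

/-- A functor which is cocontinuous in its first argument is a left Kan extension of its
restriction to representables. -/
theorem IsCocontFst.isLeftKanExtension {X : Cat.{u, u}} {F : Psh X × G ⥤ Z}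
    (hF : IsCocontFst.{u} F) {f : J X × G ⥤ Z} (φ : f ≅ (yon X).prod (𝟭 G) ⋙ F) :
    F.IsLeftKanExtension φ.hom := by
  refine Functor.LeftExtension.IsPointwiseLeftKanExtension.isLeftKanExtension
      (E := Functor.LeftExtension.mk F φ.hom) ?_
  rintro ⟨(p : Xᵒᵖ ⥤ Type u), γ⟩
  have hc := IsCocontFst.isColimit (X := X) hF p γ
  -- The colimit over the elements of `p` is compared with the one over all arrows
  -- `(y x, γ') ⟶ (p, γ)`; a cocone `s` on the latter restricts to a cocone `t s` on the former.
  let arr (j : CostructuredArrow (yoneda (C := X)) p) :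
      CostructuredArrow ((yon X).prod (𝟭 G)) (p, γ) :=
    CostructuredArrow.mk (Y := (J.up j.left, γ)) (Prod.mkHom j.hom (𝟙 γ))
  let arrMap {j j' : CostructuredArrow (yoneda (C := X)) p} (k : j ⟶ j') : arr j ⟶ arr j' :=
    CostructuredArrow.homMk (Prod.mkHom (X₁ := J.up j.left) (X₂ := J.up j'.left) k.left (𝟙 γ))
      (Prod.ext (CostructuredArrow.w k) (Category.comp_id _))
  let t (s : Cocone (CostructuredArrow.proj ((yon X).prod (𝟭 G)) (p, γ) ⋙ f)) :
      Cocone ((CostructuredArrow.proj (yoneda (C := X)) p ⋙ yoneda) ⋙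
        Prod.sectL (Xᵒᵖ ⥤ Type u) γ ⋙ F) :=
    { pt := s.pt
      ι := { app j := φ.inv.app (J.up j.left, γ) ≫ s.ι.app (arr j)
             naturality j j' k := by
               have h1 := φ.inv.naturality
                 (Prod.mkHom (X₁ := J.up j.left) (X₂ := J.up j'.left) k.left (𝟙 γ))
               have h2 := s.w (arrMap k)
               exact (Category.assoc _ _ _).symm.trans ((h1 =≫ _).trans
                 ((Category.assoc _ _ _).trans ((_ ≫= h2).trans (Category.comp_id _).symm))) } }
  refine IsColimit.mk (fun s => hc.desc (t s)) ?_ ?_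
  · intro s j
    -- An arrow `(y x, γ') ⟶ (p, γ)` factors through `(y x, γ)`, so that the leg at `j` is
    -- determined by the leg at `arr j₀`.
    let j₀ : CostructuredArrow (yoneda (C := X)) p :=
      CostructuredArrow.mk (Y := j.left.1.down) j.hom.1
    have h := hc.fac (t s) j₀
    let k₀ : j.left ⟶ (j.left.1, γ) := Prod.mkHom (𝟙 j.left.1) j.hom.2
    have h3 := φ.hom.naturality k₀
    have h4 := s.w (j := arr j₀) (j' := j) (CostructuredArrow.homMk k₀
      (Prod.ext ((congrArg (· ≫ j.hom.1) ((yon X).map_id j.left.1)).trans (Category.id_comp _))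
        (Category.comp_id _)))
    have h5 : F.map j.hom = ((yon X).prod (𝟭 G) ⋙ F).map k₀ ≫
        F.map (Prod.mkHom (X₁ := (yon X).obj j.left.1) (X₂ := p) j.hom.1 (𝟙 γ)) :=
      (congrArg F.map (Prod.ext ((congrArg (· ≫ j.hom.1) ((yon X).map_id j.left.1)).trans
        (Category.id_comp _)).symm (Category.comp_id _).symm)).trans (F.map_comp _ _)
    have h6 : φ.hom.app (j.left.1, γ) ≫ F.map (Prod.mkHom (X₁ := (yon X).obj j.left.1) (X₂ := p)
        j.hom.1 (𝟙 γ)) ≫ hc.desc (t s) = s.ι.app (arr j₀) :=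
      (_ ≫= h).trans (φ.hom_inv_id_app_assoc _ _)
    refine Eq.trans ?_ h4
    refine Eq.trans ?_ (_ ≫= h6)
    refine (congrArg (fun k => (φ.hom.app j.left ≫ k) ≫ hc.desc (t s)) h5).trans ?_
    have h3' := h3 =≫ (F.map (Prod.mkHom (X₁ := (yon X).obj j.left.1) (X₂ := p)
        j.hom.1 (𝟙 γ)) ≫ hc.desc (t s))
    simp only [Category.assoc] at h3'
    exact ((Category.assoc _ _ _).trans (_ ≫= Category.assoc _ _ _)).trans h3'.symm
  · intro s m hm
    refine hc.hom_ext (fun j => ?_)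
    refine Eq.trans ?_ (hc.fac (t s) j).symm
    have h := hm (arr j)
    exact (Iso.eq_inv_comp (φ.app _)).2 ((Category.assoc _ _ _).symm.trans h)

theorem preservesColimits_leftKanExtension_uliftYoneda {X : Type u} [Category.{u} X]
    {Z : Type w₅} [Category.{u} Z] [HasColimitsOfSize.{u, u} Z] (f : X ⥤ Z) :
    PreservesColimitsOfSize.{u, u} (uliftYoneda.{u}.lan.obj f) :=
  Presheaf.preservesColimitsOfSize_of_isLeftKanExtension.{u} _ (uliftYoneda.{u}.lanUnit.app f)

theorem isIso_lanUnit_uliftYoneda {X : Type u} [Category.{u} X]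
    {Z : Type w₅} [Category.{u} Z] [HasColimitsOfSize.{u, u} Z] (f : X ⥤ Z) :
    IsIso (uliftYoneda.{u}.lanUnit.app f) :=
  Presheaf.isIso_of_isLeftKanExtension.{u} _ (uliftYoneda.{u}.lanUnit.app f)

/-- Every `f : X × G ⥤ Z` extends to a functor on `Psh X × G` which is cocontinuous in its first
argument. -/
theorem exists_isCocontFst_extension {X : Type u} [Category.{u} X]
    {Z : Type w₅} [Category.{u} Z] [HasColimitsOfSize.{u, u} Z] (f : X × G ⥤ Z) :
    ∃ F : (Xᵒᵖ ⥤ Type u) × G ⥤ Z, IsCocontFst.{u} F ∧ Nonempty (f ≅ yoneda.prod (𝟭 G) ⋙ F) := by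
  have := fun f' : X ⥤ Z => isIso_lanUnit_uliftYoneda f'
  -- The extension is taken for each value of the second argument; as the left Kan extension is a
  -- functor, the result is functorial in that argument.
  have : IsIso (Functor.lanUnit (H := Z) (uliftYoneda.{u} (C := X))) := NatIso.isIso_of_isIso_app _
  let f' : G ⥤ X ⥤ Z := Functor.curry.obj (CategoryTheory.Prod.swap G X ⋙ f)
  let c : G ⥤ (Xᵒᵖ ⥤ Type u) ⥤ Z := f' ⋙ uliftYoneda.{u}.lan
  refine ⟨CategoryTheory.Prod.swap _ _ ⋙ Functor.uncurry.obj c, fun γ => ?_, ⟨?_⟩⟩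
  · have : PreservesColimitsOfSize.{u, u} (c.obj γ) :=
      preservesColimits_leftKanExtension_uliftYoneda (f'.obj γ)
    exact preservesColimits_of_natIso (F := c.obj γ)
      (NatIso.ofComponents (fun p => Iso.refl _) (fun k => (Category.comp_id _).trans
        ((((congrArg (fun m => m.app _ ≫ (c.obj γ).map k) (c.map_id γ)).trans
          (Category.id_comp _)).symm).trans (Category.id_comp _).symm)))
  · let e : f' ≅ c ⋙ (Functor.whiskeringLeft _ _ Z).obj yoneda :=
      Functor.isoWhiskerLeft f' (asIso (uliftYoneda.{u} (C := X)).lanUnit) ≪≫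
        Functor.isoWhiskerLeft c ((Functor.whiskeringLeft X (Xᵒᵖ ⥤ Type u) Z).mapIso
          uliftYonedaIsoYoneda.{u, u, u})
    refine NatIso.ofComponents (fun x => (e.app x.2).app x.1) ?_
    rintro ⟨x, γ⟩ ⟨x', γ'⟩ ⟨k, l⟩
    have h1 := (e.hom.app γ').naturality k
    have h2 := NatTrans.congr_app (e.hom.naturality l) x
    have h3 : f.map (Prod.mkHom k l) = (f'.map l).app x ≫ (f'.obj γ').map k := by
      simp [f', ← f.map_comp]
    exact (h3 =≫ _).trans ((Category.assoc _ _ _).trans ((_ ≫= h1).trans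
      ((Category.assoc _ _ _).symm.trans ((h2 =≫ _).trans (Category.assoc _ _ _)))))

/-- The equivalence `X → J X`. -/
abbrev J.upFunctor (X : Cat.{u, u}) : X ⥤ J X where
  obj := J.up
  map k := k

/-- The equivalence `J X → X`. -/
abbrev J.downFunctor (X : Cat.{u, u}) : J X ⥤ X := ULift.downFunctor

/-- The values of `f` lie in `Psh Y`, which has all small colimits; no size or cocompleteness
condition is needed on the other arguments `G`. -/
theorem exists_isCocontFst_lan {X Y : Cat.{u, u}} (f : J X × G ⥤ Psh Y) :
    ∃ F : Psh X × G ⥤ Psh Y, IsCocontFst.{u} F ∧ Nonempty (f ≅ (yon X).prod (𝟭 G) ⋙ F) := by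
  have : HasColimitsOfSize.{u, u} (Psh Y) :=
    inferInstanceAs (HasColimitsOfSize.{u, u} (Yᵒᵖ ⥤ Type u))
  obtain ⟨F, hF, ⟨φ⟩⟩ := exists_isCocontFst_extension (X := X) (Z := Psh Y)
    ((J.upFunctor X).prod (𝟭 G) ⋙ f)
  exact ⟨F, hF, ⟨Functor.isoWhiskerLeft ((J.downFunctor X).prod (𝟭 G)) φ⟩⟩

end Density

/-! ### Left Kan extensions along `1, …, y, …, 1` -/

theorem map_mkHom_comp {A G Z : Type*} [Category* A] [Category* G] [Category* Z] (F : A × G ⥤ Z)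
    {a b c : A} (γ : G) (k : a ⟶ b) (l : b ⟶ c) :
    F.map (Prod.mkHom k (𝟙 γ)) ≫ F.map (Prod.mkHom l (𝟙 γ)) =
      F.map (Prod.mkHom (k ≫ l) (𝟙 γ)) := by
  rw [← F.map_comp, prod_comp, Category.comp_id]

namespace LanChoice

theorem nonempty : Nonempty LanChoice.{u} := by
  have h {X Y : Cat.{u, u}} {Γ : Ctx.{u}} (f : J X × Γ.prod ⥤ Psh Y) :
      ∃ (F : Psh X × Γ.prod ⥤ Psh Y) (α : f ⟶ (yon X).prod (𝟭 Γ.prod) ⋙ F),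
        F.IsLeftKanExtension α := by
    obtain ⟨F, hF, ⟨φ⟩⟩ := exists_isCocontFst_lan f
    exact ⟨F, _, hF.isLeftKanExtension φ⟩
  choose lan unit isLan using @h
  exact ⟨⟨lan, unit, isLan⟩⟩

variable (K : LanChoice.{u}) {X Y : Cat.{u, u}} {Γ Δ : Ctx.{u}}

/-- A left Kan extension along `1, …, y, …, 1` is unique up to isomorphism, hence is cocontinuous in
its first argument with invertible unit, as one such extension is. -/
theorem isCocontFst_and_isIso_unit (f : J X × Γ.prod ⥤ Psh Y) :
    IsCocontFst.{u} (K.lan f) ∧ IsIso (K.unit f) := by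
  obtain ⟨F, hF, ⟨φ⟩⟩ := exists_isCocontFst_lan f
  have := K.isLan f
  have : F.IsLeftKanExtension φ.hom := hF.isLeftKanExtension φ
  let e : F ≅ K.lan f := Functor.leftKanExtensionUnique F φ.hom (K.lan f) (K.unit f)
  have h : K.unit f = φ.hom ≫ Functor.whiskerLeft _ e.hom :=
    (Functor.descOfIsLeftKanExtension_fac F φ.hom (K.lan f) (K.unit f)).symm
  refine ⟨IsCocontFst.of_iso hF e, ?_⟩
  rw [h]
  infer_instance

theorem isCocontFst (f : J X × Γ.prod ⥤ Psh Y) : IsCocontFst.{u} (K.lan f) :=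
  (K.isCocontFst_and_isIso_unit f).1

instance (f : J X × Γ.prod ⥤ Psh Y) : IsIso (K.unit f) :=
  (K.isCocontFst_and_isIso_unit f).2

/-- The 2-cell `f^t → H` induced by a 2-cell `f → H ∘ₜ y`. -/
noncomputable def desc {f : J X × Γ.prod ⥤ Psh Y} {H : Psh X × Γ.prod ⥤ Psh Y}
    (φ : f ⟶ (yon X).prod (𝟭 Γ.prod) ⋙ H) : K.lan f ⟶ H :=
  have := K.isLan f
  Functor.descOfIsLeftKanExtension (K.lan f) (K.unit f) H φ

theorem unit_desc {f : J X × Γ.prod ⥤ Psh Y} {H : Psh X × Γ.prod ⥤ Psh Y}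
    (φ : f ⟶ (yon X).prod (𝟭 Γ.prod) ⋙ H) :
    K.unit f ≫ Functor.whiskerLeft _ (K.desc φ) = φ :=
  have := K.isLan f
  Functor.descOfIsLeftKanExtension_fac (K.lan f) (K.unit f) H φ

theorem unit_desc_app {f : J X × Γ.prod ⥤ Psh Y} {H : Psh X × Γ.prod ⥤ Psh Y}
    (φ : f ⟶ (yon X).prod (𝟭 Γ.prod) ⋙ H) (x : J X) (γ : Γ.prod) :
    (K.unit f).app (x, γ) ≫ (K.desc φ).app ((yon X).obj x, γ) = φ.app (x, γ) :=
  NatTrans.congr_app (K.unit_desc φ) (x, γ)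

theorem hom_ext {f : J X × Γ.prod ⥤ Psh Y} {H : Psh X × Γ.prod ⥤ Psh Y} {α β : K.lan f ⟶ H}
    (h : ∀ x γ, (K.unit f).app (x, γ) ≫ α.app ((yon X).obj x, γ) =
      (K.unit f).app (x, γ) ≫ β.app ((yon X).obj x, γ)) : α = β :=
  have := K.isLan f
  Functor.hom_ext_of_isLeftKanExtension (K.lan f) (K.unit f) α β
    (NatTrans.ext (funext fun p => h p.1 p.2))

/-- The comparison of `f^t` with a functor which is cocontinuous in its first argument and restricts
to `f` is invertible. -/
theorem isIso_desc {f : J X × Γ.prod ⥤ Psh Y} {H : Psh X × Γ.prod ⥤ Psh Y}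
    (hH : IsCocontFst.{u} H) (φ : f ⟶ (yon X).prod (𝟭 Γ.prod) ⋙ H) (_ : IsIso φ) :
    IsIso (K.desc φ) := by
  have := K.isLan f
  have : H.IsLeftKanExtension φ := hH.isLeftKanExtension (asIso φ)
  exact (Functor.leftKanExtensionUnique (K.lan f) (K.unit f) H φ).isIso_hom

/-- The 2-cell `f^t → f'^t` induced by a 2-cell `f → f'`. -/
noncomputable def lanMap {f f' : J X × Γ.prod ⥤ Psh Y} (α : f ⟶ f') : K.lan f ⟶ K.lan f' :=
  K.desc (α ≫ K.unit f')

theorem unit_lanMap {f f' : J X × Γ.prod ⥤ Psh Y} (α : f ⟶ f') (x : J X) (γ : Γ.prod) :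
    (K.unit f).app (x, γ) ≫ (K.lanMap α).app ((yon X).obj x, γ) =
      α.app (x, γ) ≫ (K.unit f').app (x, γ) :=
  K.unit_desc_app _ x γ

/-- Strengthening `f ↦ f^t`, as a functor. -/
noncomputable def str (X Y : Cat.{u, u}) (Γ : Ctx.{u}) :
    (J X × Γ.prod ⥤ Psh Y) ⥤ (Psh X × Γ.prod ⥤ Psh Y) where
  obj f := K.lan f
  map α := K.lanMap α
  map_id f := K.hom_ext fun x γ =>
    (K.unit_lanMap _ x γ).trans ((Category.id_comp _).trans (Category.comp_id _).symm)
  map_comp {f f' f''} α β := K.hom_ext fun x γ => by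
    refine (K.unit_lanMap _ x γ).trans ?_
    refine Eq.trans ?_ ((reassoc_of% (K.unit_lanMap α x γ)) _).symm
    exact (Category.assoc _ _ _).trans (_ ≫= (K.unit_lanMap β x γ).symm)

/-- The pseudonaturality cell `(f ∘ S)^t ≅ f^t ∘ S`. -/
noncomputable def pn (S : Δ.prod ⥤ Γ.prod) (f : J X × Γ.prod ⥤ Psh Y) :
    K.lan (subst S f) ≅ subst S (K.lan f) :=
  have := K.isIso_desc (f := subst S f) ((K.isCocontFst f).subst S)
    (Functor.whiskerLeft ((𝟭 (J X)).prod S) (K.unit f)) inferInstance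
  asIso (K.desc (f := subst S f) (H := subst S (K.lan f))
    (Functor.whiskerLeft ((𝟭 (J X)).prod S) (K.unit f)))

theorem unit_pn (S : Δ.prod ⥤ Γ.prod) (f : J X × Γ.prod ⥤ Psh Y) (x : J X) (δ : Δ.prod) :
    (K.unit (subst S f)).app (x, δ) ≫ (K.pn S f).hom.app ((yon X).obj x, δ) =
      (K.unit f).app (x, S.obj δ) :=
  K.unit_desc_app (f := subst S f) (H := subst S (K.lan f)) _ x δ

/-- The cell `(f^t ∘ₜ g)^t ≅ f^t ∘ₜ g^t`. -/
noncomputable def hat {W : Cat.{u, u}} (f : J X × Γ.prod ⥤ Psh Y) (g : J W × Δ.prod ⥤ Psh X) :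
    K.lan (Γ := .app Γ Δ) (mcomp (K.lan f) g) ≅ mcomp (K.lan f) (K.lan g) :=
  have : IsIso (mcompR (K.lan f) (K.unit g)) := by
    have : IsIso (plugMap Γ.prod (K.unit g)) := by
      have : ∀ p, IsIso ((plugMap Γ.prod (K.unit g)).app p) := fun p => by
        rw [isIso_prod_iff]
        exact ⟨inferInstanceAs (IsIso ((K.unit g).app _)), inferInstanceAs (IsIso (𝟙 _))⟩
      exact NatIso.isIso_of_isIso_app _
    infer_instance
  have := K.isIso_desc (Γ := .app Γ Δ) (f := mcomp (K.lan f) g)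
    ((K.isCocontFst f).mcomp (K.isCocontFst g)) (mcompR (K.lan f) (K.unit g)) this
  asIso (K.desc (Γ := .app Γ Δ) (f := mcomp (K.lan f) g) (H := mcomp (K.lan f) (K.lan g))
    (mcompR (K.lan f) (K.unit g)))

theorem unit_hat {W : Cat.{u, u}} (f : J X × Γ.prod ⥤ Psh Y) (g : J W × Δ.prod ⥤ Psh X) (w : J W)
    (γ : Γ.prod) (δ : Δ.prod) :
    (K.unit (Γ := .app Γ Δ) (mcomp (K.lan f) g)).app (w, (γ, δ)) ≫
        (K.hat f g).hom.app ((yon W).obj w, (γ, δ)) =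
      (K.lan f).map (Prod.mkHom ((K.unit g).app (w, δ)) (𝟙 γ)) :=
  K.unit_desc_app (Γ := .app Γ Δ) (f := mcomp (K.lan f) g) (H := mcomp (K.lan f) (K.lan g)) _ w
    (γ, δ)

/-- The cell `y^t ≅ 1`. -/
noncomputable def theta (X : Cat.{u, u}) : K.lan (Γ := .nil) (unary (yon X)) ≅ unary (𝟭 (Psh X)) :=
  have := K.isIso_desc (Γ := .nil) (f := unary (yon X)) (H := unary (𝟭 (Psh X)))
    isCocontFst_fst (𝟙 (unary (yon X))) inferInstance
  asIso (K.desc (Γ := .nil) (f := unary (yon X)) (H := unary (𝟭 (Psh X))) (𝟙 (unary (yon X))))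

theorem unit_theta (x : J X) (γ : Ctx.prod.{u} .nil) :
    (K.unit (Γ := .nil) (unary (yon X))).app (x, γ) ≫
        (K.theta X).hom.app ((yon X).obj x, γ) = 𝟙 ((yon X).obj x) :=
  K.unit_desc_app (Γ := .nil) (f := unary (yon X)) (H := unary (𝟭 (Psh X))) _ x γ

end LanChoice

/-! ### The strong relative pseudomonad of presheaves -/

namespace LanChoice

variable (K : LanChoice.{u})

/-- The strong relative pseudomonad of presheaves determined by a choice of left Kan extensions.
Each axiom is an equation between 2-cells out of a left Kan extension, and is checked after
precomposition with the unit, where `unit_lanMap`, `unit_pn`, `unit_hat` and `unit_theta` compute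
both sides. -/
noncomputable def strong : StrongRelPseudomonad Psh.{u} yon where
  str := K.str
  pn := K.pn
  tilde {X Y Γ} f := (asIso (K.unit f) : f ≅ (yon X).prod (𝟭 Γ.prod) ⋙ K.lan f)
  hat := K.hat
  theta := K.theta
  pn_naturality {X Y Γ Δ} S {f f'} α := K.hom_ext fun x δ => by
    refine ((reassoc_of% (K.unit_lanMap (Functor.whiskerLeft ((𝟭 (J X)).prod S) α) x δ)) _).trans ?_
    refine (_ ≫= K.unit_pn S f' x δ).trans ?_
    refine Eq.trans ?_ ((reassoc_of% (K.unit_pn S f x δ)) _).symm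
    exact (K.unit_lanMap α x (S.obj δ)).symm
  pn_naturality_subst {X Y Γ Δ S S'} σ f := K.hom_ext fun x δ => by
    refine ((reassoc_of% (K.unit_lanMap (f := subst S f) (f' := subst S' f) _ x δ)) _).trans ?_
    refine (_ ≫= K.unit_pn S' f x δ).trans ?_
    refine Eq.trans ?_ ((reassoc_of% (K.unit_pn S f x δ)) _).symm
    refine ((K.unit f).naturality (Prod.mkHom (𝟙 x) (σ.app δ))).trans ?_
    exact _ ≫= congrArg (fun k => (K.lan f).map (Prod.mkHom k (σ.app δ))) ((yon X).map_id x)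
  pn_id {X Y Γ} f := K.hom_ext fun x γ =>
    (K.unit_pn (𝟭 Γ.prod) f x γ).trans (Category.comp_id _).symm
  pn_comp {X Y Γ Δ Θ} S S' f := K.hom_ext fun x θ => by
    refine (K.unit_pn (S' ⋙ S) f x θ).trans ?_
    refine Eq.trans ?_ ((reassoc_of% (K.unit_pn S' (subst S f) x θ)) _).symm
    exact (K.unit_pn S f x (S'.obj θ)).symm
  tilde_naturality {X Y Γ f f'} α := NatTrans.ext (funext fun p => K.unit_lanMap α p.1 p.2)
  tilde_pn {X Y Γ Δ} S f := NatTrans.ext (funext fun p => K.unit_pn S f p.1 p.2)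
  hat_naturality_left {W X Y Γ Δ f f'} α g := K.hom_ext (Γ := .app Γ Δ) fun w ⟨γ, δ⟩ => by
    refine ((reassoc_of% (K.unit_lanMap (Γ := .app Γ Δ) (mcompL (K.lanMap α) g) w
      (γ, δ))) _).trans ?_
    refine (_ ≫= K.unit_hat f' g w γ δ).trans ?_
    refine Eq.trans ?_ ((reassoc_of% (K.unit_hat f g w γ δ)) _).symm
    exact ((K.lanMap α).naturality _).symm
  hat_naturality_right {W X Y Γ Δ} f {g g'} β := K.hom_ext (Γ := .app Γ Δ) fun w ⟨γ, δ⟩ => by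
    refine ((reassoc_of% (K.unit_lanMap (Γ := .app Γ Δ) (mcompR (K.lan f) β) w (γ, δ))) _).trans ?_
    refine (_ ≫= K.unit_hat f g' w γ δ).trans ?_
    refine Eq.trans ?_ ((reassoc_of% (K.unit_hat f g w γ δ)) _).symm
    refine (map_mkHom_comp _ _ _ _).trans (Eq.trans ?_ (map_mkHom_comp _ _ _ _).symm)
    exact congrArg (fun k => (K.lan f).map (Prod.mkHom k (𝟙 γ))) (K.unit_lanMap β w δ).symm
  hat_pn {W X Y Γ Δ Γ' Δ'} S S' f g := K.hom_ext (Γ := .app Γ' Δ') fun w ⟨γ, δ⟩ => by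
    refine ((reassoc_of% (K.unit_hat (subst S f) (subst S' g) w γ δ)) _).trans ?_
    refine Eq.trans ?_ ((reassoc_of% (K.unit_lanMap (Γ := .app Γ' Δ')
      (mcompL (K.pn S f).hom (subst S' g)) w (γ, δ))) _).symm
    refine Eq.trans ?_ (_ ≫= ((reassoc_of% (K.unit_pn (Γ := .app Γ Δ) (Δ := .app Γ' Δ') (S.prod S')
      (mcomp (K.lan f) g) w (γ, δ))) _).symm)
    refine Eq.trans ?_ (_ ≫= (K.unit_hat f g w (S.obj γ) (S'.obj δ)).symm)
    refine ((reassoc_of% ((K.pn S f).hom.naturality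
      (Prod.mkHom ((K.unit (subst S' g)).app (w, δ)) (𝟙 γ)))) _).trans ?_
    refine _ ≫= ((map_mkHom_comp (subst S (K.lan f)) γ _ _).trans ?_)
    refine (congrArg (fun k => (subst S (K.lan f)).map (Prod.mkHom k (𝟙 γ)))
      (K.unit_pn S' g w δ)).trans ?_
    exact congrArg (fun k => (K.lan f).map (Prod.mkHom ((K.unit g).app (w, S'.obj δ)) k))
      (S.map_id γ)
  assoc {V W X Y Γ Δ Θ} f g h := K.hom_ext (Γ := .app Γ (.app Δ Θ)) fun v ⟨γ, δ, θ⟩ => by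
    refine ((reassoc_of% (K.unit_pn (Γ := .app (.app Γ Δ) Θ) (Δ := .app Γ (.app Δ Θ))
      (reassoc Γ.prod Δ.prod Θ.prod)
        (mcomp (K.lan (Γ := .app Γ Δ) (mcomp (K.lan f) g)) h) v (γ, (δ, θ)))) _).trans ?_
    refine ((reassoc_of% (K.unit_hat (Γ := .app Γ Δ) (mcomp (K.lan f) g) h v (γ, δ) θ)) _).trans ?_
    refine ((K.hat f g).hom.naturality (Prod.mkHom ((K.unit h).app (v, θ)) (𝟙 (γ, δ)))).trans ?_
    refine Eq.trans ?_ ((reassoc_of% (K.unit_lanMap (Γ := .app Γ (.app Δ Θ))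
      (Functor.whiskerLeft ((𝟭 (J V)).prod (reassoc Γ.prod Δ.prod Θ.prod))
          (mcompL (K.hat f g).hom h)) v (γ, (δ, θ)))) _).symm
    refine _ ≫= ?_
    refine Eq.trans ?_ ((reassoc_of% (K.unit_hat (Δ := .app Δ Θ) f (mcomp (K.lan g) h) v γ
      (δ, θ))) _).symm
    refine Eq.trans ?_ (map_mkHom_comp (K.lan f) γ _ _).symm
    exact congrArg (fun k => (K.lan f).map (Prod.mkHom k (𝟙 γ))) (K.unit_hat g h v δ θ).symm
  unit {X Y Γ} f := K.hom_ext fun x γ => by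
    refine ((reassoc_of% (K.unit_lanMap (K.unit f) x γ)) _).trans ?_
    refine (_ ≫= ?_)
    refine ((reassoc_of% (K.unit_pn (Γ := .app Γ .nil) (Functor.prod' (𝟭 Γ.prod) Γ.bang)
        (mcomp (K.lan f) (unary (yon X))) x γ)) _).trans ?_
    refine ((reassoc_of% (K.unit_hat (Δ := .nil) f (unary (yon X)) x γ ⟨⟨⟨⟩⟩⟩)) _).trans ?_
    refine (map_mkHom_comp _ _ _ _).trans ?_
    refine (congrArg (fun k => (K.lan f).map (Prod.mkHom k (𝟙 γ)))
      (K.unit_theta x ⟨⟨⟨⟩⟩⟩)).trans ?_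
    exact (K.lan f).map_id _

theorem strengthIsLan : K.strong.StrengthIsLan K := fun f =>
  ⟨rfl, (K.unit f ≫= Functor.whiskerLeft_id' _).trans (Category.comp_id _)⟩

theorem isLaxIdempotent : K.strong.IsLaxIdempotent := fun X Y Γ =>
  ⟨Adjunction.mkOfUnitCounit
    { unit := { app f := K.unit f
                naturality f f' α := (K.strong.tilde_naturality α).symm }
      counit := { app H := K.desc (f := (yon X).prod (𝟭 Γ.prod) ⋙ H) (𝟙 _)
                  naturality H H' α := K.hom_ext fun x γ => by
                    refine ((reassoc_of% (K.unit_lanMap _ x γ)) _).trans ?_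
                    refine (_ ≫= K.unit_desc_app _ x γ).trans ?_
                    refine Eq.trans ?_ ((reassoc_of% (K.unit_desc_app _ x γ)) _).symm
                    exact (Category.comp_id _).trans (Category.id_comp _).symm }
      left_triangle := NatTrans.ext (funext fun f => K.hom_ext fun x γ => by
        refine ((reassoc_of% (K.unit_lanMap (K.unit f) x γ)) _).trans ?_
        exact _ ≫= K.unit_desc_app (f := (yon X).prod (𝟭 Γ.prod) ⋙ K.lan f) (𝟙 _) x γ)
      right_triangle := NatTrans.ext (funext fun H => K.unit_desc _) }, fun f => rfl⟩

end LanChoice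

section Pseudocommutativity

open StrongRelPseudomonad

/-! ### Strengthenings in two arguments -/

namespace LanChoice

variable (K : LanChoice.{u})

section TwoArguments

variable {X Y Z : Cat.{u, u}} {A A' B B' : Cat.{u, u + 1}} {Γ Δ : Ctx.{u}}

/-! The lemmas `tildeL_…` and `tildeR_…` compute the 2-cells out of a strengthening at
representables. Those for the right argument are those for the left one, after the two arguments are
exchanged. -/

theorem hom_extL {f : J X × (B × Γ.prod) ⥤ Psh Z} {H : Psh X × (B × Γ.prod) ⥤ Psh Z}
    {α β : (K.strong.strL X B Γ Z).obj f ⟶ H}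
    (h : ∀ x b γ, (K.strong.tildeL f).hom.app (x, (b, γ)) ≫ α.app ((yon X).obj x, (b, γ)) =
      (K.strong.tildeL f).hom.app (x, (b, γ)) ≫ β.app ((yon X).obj x, (b, γ))) : α = β :=
  K.hom_ext (Γ := .app (.of B) Γ) fun x p => h x p.1 p.2

theorem hom_extR {f : A × (J Y × Γ.prod) ⥤ Psh Z} {H : A × (Psh Y × Γ.prod) ⥤ Psh Z}
    {α β : (K.strong.strR A Y Γ Z).obj f ⟶ H}
    (h : ∀ a y γ, (K.strong.tildeR f).hom.app (a, (y, γ)) ≫ α.app (a, ((yon Y).obj y, γ)) =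
      (K.strong.tildeR f).hom.app (a, (y, γ)) ≫ β.app (a, ((yon Y).obj y, γ))) : α = β :=
  congrArg (Functor.whiskerLeft (exch A (Psh Y) Γ.prod))
    (K.hom_ext (Γ := .app (.of A) Γ) (f := exch (J Y) A Γ.prod ⋙ f)
      (H := exch (Psh Y) A Γ.prod ⋙ H)
      (α := Functor.whiskerLeft (exch (Psh Y) A Γ.prod) α)
      (β := Functor.whiskerLeft (exch (Psh Y) A Γ.prod) β) fun y p => h p.1 y p.2)

theorem tildeL_map {f f' : J X × (B × Γ.prod) ⥤ Psh Z} (α : f ⟶ f') (x : J X) (b : B)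
    (γ : Γ.prod) :
    (K.strong.tildeL f).hom.app (x, (b, γ)) ≫
        ((K.strong.strL X B Γ Z).map α).app ((yon X).obj x, (b, γ)) =
      α.app (x, (b, γ)) ≫ (K.strong.tildeL f').hom.app (x, (b, γ)) :=
  K.unit_lanMap (Γ := .app (.of B) Γ) α x (b, γ)

theorem tildeR_map {f f' : A × (J Y × Γ.prod) ⥤ Psh Z} (α : f ⟶ f') (a : A) (y : J Y)
    (γ : Γ.prod) :
    (K.strong.tildeR f).hom.app (a, (y, γ)) ≫
        ((K.strong.strR A Y Γ Z).map α).app (a, ((yon Y).obj y, γ)) =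
      α.app (a, (y, γ)) ≫ (K.strong.tildeR f').hom.app (a, (y, γ)) :=
  K.unit_lanMap (Γ := .app (.of A) Γ) (Functor.whiskerLeft (exch (J Y) A Γ.prod) α) y (a, γ)

theorem tildeL_hatL {W : Cat.{u, u}} (f : J X × (B × Γ.prod) ⥤ Psh Z) (g : J W × Δ.prod ⥤ Psh X)
    (w : J W) (b : B) (γ : Γ.prod) (δ : Δ.prod) :
    (K.strong.tildeL (Γ := .app Γ Δ) (inL ((K.strong.strL X B Γ Z).obj f) g)).hom.app
        (w, (b, (γ, δ))) ≫ (K.strong.hatL f g).hom.app ((yon W).obj w, (b, (γ, δ))) =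
      ((K.strong.strL X B Γ Z).obj f).map
        (Prod.mkHom ((K.unit g).app (w, δ)) (𝟙 ((b, γ) : B × Γ.prod))) := by
  refine ((reassoc_of% (K.unit_pn (Γ := .app (.app (.of B) Γ) Δ) (Δ := .app (.of B) (.app Γ Δ))
    (reassoc B Γ.prod Δ.prod) (mcomp ((K.strong.strL X B Γ Z).obj f) g) w (b, (γ, δ)))) _).trans ?_
  exact K.unit_hat (Γ := .app (.of B) Γ) f g w (b, γ) δ

theorem tildeR_hatR {W : Cat.{u, u}} (f : A × (J Y × Γ.prod) ⥤ Psh Z) (g : J W × Δ.prod ⥤ Psh Y)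
    (a : A) (w : J W) (γ : Γ.prod) (δ : Δ.prod) :
    (K.strong.tildeR (Γ := .app Γ Δ) (inR ((K.strong.strR A Y Γ Z).obj f) g)).hom.app
        (a, (w, (γ, δ))) ≫ (K.strong.hatR f g).hom.app (a, ((yon W).obj w, (γ, δ))) =
      ((K.strong.strR A Y Γ Z).obj f).map
        (Prod.mkHom (𝟙 a) (Prod.mkHom ((K.unit g).app (w, δ)) (𝟙 γ))) :=
  K.tildeL_hatL (exch (J Y) A Γ.prod ⋙ f) g w a γ δ

theorem tildeL_commL (f : J X × (B × Γ.prod) ⥤ Psh Z) (g : B' × Δ.prod ⥤ B) (x : J X) (b : B')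
    (γ : Γ.prod) (δ : Δ.prod) :
    (K.strong.tildeL (Γ := .app Γ Δ) (inR f g)).hom.app (x, (b, (γ, δ))) ≫
        (K.strong.commL f g).hom.app ((yon X).obj x, (b, (γ, δ))) =
      (K.strong.tildeL f).hom.app (x, (g.obj (b, δ), γ)) :=
  K.unit_pn (Γ := .app (.of B) Γ) (Δ := .app (.of B') (.app Γ Δ)) (plug Γ.prod g) f x (b, (γ, δ))

theorem tildeR_commR (f : A × (J Y × Γ.prod) ⥤ Psh Z) (g : A' × Δ.prod ⥤ A) (a : A') (y : J Y)
    (γ : Γ.prod) (δ : Δ.prod) :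
    (K.strong.tildeR (Γ := .app Γ Δ) (inL f g)).hom.app (a, (y, (γ, δ))) ≫
        (K.strong.commR f g).hom.app (a, ((yon Y).obj y, (γ, δ))) =
      (K.strong.tildeR f).hom.app (g.obj (a, δ), (y, γ)) :=
  K.tildeL_commL (exch (J Y) A Γ.prod ⋙ f) g y a γ δ

theorem tildeL_commL₁ (f : J X × (B × Γ.prod) ⥤ Psh Z) (k : B' ⥤ B) (x : J X) (b : B')
    (γ : Γ.prod) :
    (K.strong.tildeL ((𝟭 (J X)).prod (k.prod (𝟭 Γ.prod)) ⋙ f)).hom.app (x, (b, γ)) ≫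
        (K.strong.commL₁ f k).hom.app ((yon X).obj x, (b, γ)) =
      (K.strong.tildeL f).hom.app (x, (k.obj b, γ)) :=
  K.unit_pn (Γ := .app (.of B) Γ) (Δ := .app (.of B') Γ) (k.prod (𝟭 Γ.prod)) f x (b, γ)

theorem tildeR_commR₁ (f : A × (J Y × Γ.prod) ⥤ Psh Z) (k : A' ⥤ A) (a : A') (y : J Y)
    (γ : Γ.prod) :
    (K.strong.tildeR (k.prod (𝟭 (J Y × Γ.prod)) ⋙ f)).hom.app (a, (y, γ)) ≫
        (K.strong.commR₁ f k).hom.app (a, ((yon Y).obj y, γ)) =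
      (K.strong.tildeR f).hom.app (k.obj a, (y, γ)) :=
  K.tildeL_commL₁ (exch (J Y) A Γ.prod ⋙ f) k y a γ

theorem tildeL_pnL (R : Δ.prod ⥤ Γ.prod) (f : J X × (B × Γ.prod) ⥤ Psh Z) (x : J X) (b : B)
    (δ : Δ.prod) :
    (K.strong.tildeL ((𝟭 (J X)).prod ((𝟭 B).prod R) ⋙ f)).hom.app (x, (b, δ)) ≫
        (K.strong.pnL R f).hom.app ((yon X).obj x, (b, δ)) =
      (K.strong.tildeL f).hom.app (x, (b, R.obj δ)) :=
  K.unit_pn (Γ := .app (.of B) Γ) (Δ := .app (.of B) Δ) ((𝟭 B).prod R) f x (b, δ)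

theorem tildeR_pnR (R : Δ.prod ⥤ Γ.prod) (f : A × (J Y × Γ.prod) ⥤ Psh Z) (a : A) (y : J Y)
    (δ : Δ.prod) :
    (K.strong.tildeR ((𝟭 A).prod ((𝟭 (J Y)).prod R) ⋙ f)).hom.app (a, (y, δ)) ≫
        (K.strong.pnR R f).hom.app (a, ((yon Y).obj y, δ)) =
      (K.strong.tildeR f).hom.app (a, (y, R.obj δ)) :=
  K.tildeL_pnL R (exch (J Y) A Γ.prod ⋙ f) y a δ

/-- 2-cells out of `f^{ts}` are determined by their components at pairs of representables. -/
theorem hom_extLR {f : J X × (J Y × Γ.prod) ⥤ Psh Z} {H : Psh X × (Psh Y × Γ.prod) ⥤ Psh Z}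
    {α β : (K.strong.strL X (Psh Y) Γ Z).obj ((K.strong.strR (J X) Y Γ Z).obj f) ⟶ H}
    (h : ∀ x y γ, (K.strong.tildeR f).hom.app (x, (y, γ)) ≫
        (K.strong.tildeL ((K.strong.strR (J X) Y Γ Z).obj f)).hom.app
          (x, ((yon Y).obj y, γ)) ≫ α.app ((yon X).obj x, ((yon Y).obj y, γ)) =
      (K.strong.tildeR f).hom.app (x, (y, γ)) ≫
        (K.strong.tildeL ((K.strong.strR (J X) Y Γ Z).obj f)).hom.app
          (x, ((yon Y).obj y, γ)) ≫ β.app ((yon X).obj x, ((yon Y).obj y, γ))) : α = β := by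
  have h' : (K.strong.tildeL ((K.strong.strR (J X) Y Γ Z).obj f)).hom ≫
      Functor.whiskerLeft ((yon X).prod (𝟭 (Psh Y × Γ.prod))) α =
    (K.strong.tildeL ((K.strong.strR (J X) Y Γ Z).obj f)).hom ≫
      Functor.whiskerLeft ((yon X).prod (𝟭 (Psh Y × Γ.prod))) β := K.hom_extR h
  exact K.hom_extL fun x q γ => NatTrans.congr_app h' (x, (q, γ))

/-- 2-cells out of `f^{st}` are determined by their components at pairs of representables. -/
theorem hom_extRL {f : J X × (J Y × Γ.prod) ⥤ Psh Z} {H : Psh X × (Psh Y × Γ.prod) ⥤ Psh Z}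
    {α β : (K.strong.strR (Psh X) Y Γ Z).obj ((K.strong.strL X (J Y) Γ Z).obj f) ⟶ H}
    (h : ∀ x y γ, (K.strong.tildeL f).hom.app (x, (y, γ)) ≫
        (K.strong.tildeR ((K.strong.strL X (J Y) Γ Z).obj f)).hom.app
          ((yon X).obj x, (y, γ)) ≫ α.app ((yon X).obj x, ((yon Y).obj y, γ)) =
      (K.strong.tildeL f).hom.app (x, (y, γ)) ≫
        (K.strong.tildeR ((K.strong.strL X (J Y) Γ Z).obj f)).hom.app
          ((yon X).obj x, (y, γ)) ≫ β.app ((yon X).obj x, ((yon Y).obj y, γ))) : α = β := by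
  have h' : (K.strong.tildeR ((K.strong.strL X (J Y) Γ Z).obj f)).hom ≫
      Functor.whiskerLeft ((𝟭 (Psh X)).prod ((yon Y).prod (𝟭 Γ.prod))) α =
    (K.strong.tildeR ((K.strong.strL X (J Y) Γ Z).obj f)).hom ≫
      Functor.whiskerLeft ((𝟭 (Psh X)).prod ((yon Y).prod (𝟭 Γ.prod))) β := K.hom_extL h
  exact K.hom_extR fun p y γ => NatTrans.congr_app h' (p, (y, γ))

/-- The 2-cell `f^{ts} → f^{st}`, induced by `(f → f^s ∘ₛ y)^t`. -/
noncomputable def gammaHom (f : J X × (J Y × Γ.prod) ⥤ Psh Z) :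
    (K.strong.strL X (Psh Y) Γ Z).obj ((K.strong.strR (J X) Y Γ Z).obj f) ⟶
      (K.strong.strR (Psh X) Y Γ Z).obj ((K.strong.strL X (J Y) Γ Z).obj f) :=
  K.desc (Γ := .app (.of (Psh Y)) Γ) (f := (K.strong.strR (J X) Y Γ Z).obj f)
    (H := (K.strong.strR (Psh X) Y Γ Z).obj ((K.strong.strL X (J Y) Γ Z).obj f))
    ((K.strong.strR (J X) Y Γ Z).map (K.strong.tildeL f).hom ≫
      (K.strong.commR₁ ((K.strong.strL X (J Y) Γ Z).obj f) (yon X)).hom)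

theorem tildeL_gammaHom (f : J X × (J Y × Γ.prod) ⥤ Psh Z) :
    (K.strong.tildeL ((K.strong.strR (J X) Y Γ Z).obj f)).hom ≫
        Functor.whiskerLeft ((yon X).prod (𝟭 (Psh Y × Γ.prod))) (K.gammaHom f) =
      (K.strong.strR (J X) Y Γ Z).map (K.strong.tildeL f).hom ≫
        (K.strong.commR₁ ((K.strong.strL X (J Y) Γ Z).obj f) (yon X)).hom :=
  K.unit_desc (Γ := .app (.of (Psh Y)) Γ) (f := (K.strong.strR (J X) Y Γ Z).obj f)
    (H := (K.strong.strR (Psh X) Y Γ Z).obj ((K.strong.strL X (J Y) Γ Z).obj f)) _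

/-- At a pair of representables, `f^{ts} → f^{st}` is the canonical comparison. -/
theorem tilde_gammaHom (f : J X × (J Y × Γ.prod) ⥤ Psh Z) (x : J X) (y : J Y) (γ : Γ.prod) :
    (K.strong.tildeR f).hom.app (x, (y, γ)) ≫
        (K.strong.tildeL ((K.strong.strR (J X) Y Γ Z).obj f)).hom.app (x, ((yon Y).obj y, γ)) ≫
        (K.gammaHom f).app ((yon X).obj x, ((yon Y).obj y, γ)) =
      (K.strong.tildeL f).hom.app (x, (y, γ)) ≫
        (K.strong.tildeR ((K.strong.strL X (J Y) Γ Z).obj f)).hom.app ((yon X).obj x, (y, γ)) := by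
  refine (_ ≫= NatTrans.congr_app (K.tildeL_gammaHom f) (x, ((yon Y).obj y, γ))).trans ?_
  refine ((reassoc_of% (K.tildeR_map (K.strong.tildeL f).hom x y γ)) _).trans ?_
  exact _ ≫= K.tildeR_commR₁ ((K.strong.strL X (J Y) Γ Z).obj f) (yon X) x y γ

/-- The 2-cell `f^{st} → f^{ts}`, induced by `(f → f^t ∘ₜ y)^s`. -/
noncomputable def gammaInv (f : J X × (J Y × Γ.prod) ⥤ Psh Z) :
    (K.strong.strR (Psh X) Y Γ Z).obj ((K.strong.strL X (J Y) Γ Z).obj f) ⟶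
      (K.strong.strL X (Psh Y) Γ Z).obj ((K.strong.strR (J X) Y Γ Z).obj f) :=
  Functor.whiskerLeft (exch (Psh X) (Psh Y) Γ.prod)
    (K.desc (Γ := .app (.of (Psh X)) Γ)
      (f := exch (J Y) (Psh X) Γ.prod ⋙ (K.strong.strL X (J Y) Γ Z).obj f)
      (H := exch (Psh Y) (Psh X) Γ.prod ⋙
        (K.strong.strL X (Psh Y) Γ Z).obj ((K.strong.strR (J X) Y Γ Z).obj f))
      (Functor.whiskerLeft (exch (J Y) (Psh X) Γ.prod)
        ((K.strong.strL X (J Y) Γ Z).map (K.strong.tildeR f).hom ≫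
          (K.strong.commL₁ ((K.strong.strR (J X) Y Γ Z).obj f) (yon Y)).hom)))

theorem tilde_gammaInv (f : J X × (J Y × Γ.prod) ⥤ Psh Z) (x : J X) (y : J Y) (γ : Γ.prod) :
    (K.strong.tildeL f).hom.app (x, (y, γ)) ≫
        (K.strong.tildeR ((K.strong.strL X (J Y) Γ Z).obj f)).hom.app ((yon X).obj x, (y, γ)) ≫
        (K.gammaInv f).app ((yon X).obj x, ((yon Y).obj y, γ)) =
      (K.strong.tildeR f).hom.app (x, (y, γ)) ≫
        (K.strong.tildeL ((K.strong.strR (J X) Y Γ Z).obj f)).hom.app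
          (x, ((yon Y).obj y, γ)) := by
  refine (_ ≫= K.unit_desc_app (Γ := .app (.of (Psh X)) Γ)
      (f := exch (J Y) (Psh X) Γ.prod ⋙ (K.strong.strL X (J Y) Γ Z).obj f)
      (H := exch (Psh Y) (Psh X) Γ.prod ⋙
        (K.strong.strL X (Psh Y) Γ Z).obj ((K.strong.strR (J X) Y Γ Z).obj f)) _ y
      ((yon X).obj x, γ)).trans ?_
  refine ((reassoc_of% (K.tildeL_map (K.strong.tildeR f).hom x y γ)) _).trans ?_
  exact _ ≫= K.tildeL_commL₁ ((K.strong.strR (J X) Y Γ Z).obj f) (yon Y) x y γ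

/-- The pseudocommutativity `f^{ts} ≅ f^{st}`. -/
noncomputable def gamma (f : J X × (J Y × Γ.prod) ⥤ Psh Z) :
    (K.strong.strL X (Psh Y) Γ Z).obj ((K.strong.strR (J X) Y Γ Z).obj f) ≅
      (K.strong.strR (Psh X) Y Γ Z).obj ((K.strong.strL X (J Y) Γ Z).obj f) where
  hom := K.gammaHom f
  inv := K.gammaInv f
  hom_inv_id := K.hom_extLR fun x y γ => by
    have h1 := K.tilde_gammaHom f x y γ =≫
      (K.gammaInv f).app ((yon X).obj x, ((yon Y).obj y, γ))
    have h2 := K.tilde_gammaInv f x y γ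
    simp only [Category.assoc] at h1
    exact (h1.trans h2).trans (_ ≫= (Category.comp_id _).symm)
  inv_hom_id := K.hom_extRL fun x y γ => by
    have h1 := K.tilde_gammaInv f x y γ =≫
      (K.gammaHom f).app ((yon X).obj x, ((yon Y).obj y, γ))
    have h2 := K.tilde_gammaHom f x y γ
    simp only [Category.assoc] at h1
    exact (h1.trans h2).trans (_ ≫= (Category.comp_id _).symm)

end TwoArguments
end LanChoice

/-! ### Compatibilities of the pseudocommutativity -/

namespace LanChoice

variable (K : LanChoice.{u})

section TwoArguments

variable {X Y Z : Cat.{u, u}} {A A' B B' : Cat.{u, u + 1}} {Γ Δ : Ctx.{u}}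

theorem gammaHom_naturality {f f' : J X × (J Y × Γ.prod) ⥤ Psh Z} (α : f ⟶ f') :
    (K.strong.strL X (Psh Y) Γ Z).map ((K.strong.strR (J X) Y Γ Z).map α) ≫ K.gammaHom f' =
      K.gammaHom f ≫ (K.strong.strR (Psh X) Y Γ Z).map ((K.strong.strL X (J Y) Γ Z).map α) :=
  K.hom_extLR fun x y γ => by
    refine (_ ≫= ((reassoc_of% (K.tildeL_map ((K.strong.strR (J X) Y Γ Z).map α) x
      ((yon Y).obj y) γ)) _)).trans ?_
    refine ((reassoc_of% (K.tildeR_map α x y γ)) _).trans ?_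
    refine (_ ≫= K.tilde_gammaHom f' x y γ).trans ?_
    refine Eq.trans ?_ ((reassoc_of% (K.tilde_gammaHom f x y γ)) _).symm
    refine Eq.trans ?_ (_ ≫= (K.tildeR_map ((K.strong.strL X (J Y) Γ Z).map α)
      ((yon X).obj x) y γ).symm)
    exact ((reassoc_of% (K.tildeL_map α x y γ)) _).symm

theorem gammaHom_naturality_subst (R : Δ.prod ⥤ Γ.prod) (f : J X × (J Y × Γ.prod) ⥤ Psh Z) :
    K.gammaHom ((𝟭 (J X)).prod ((𝟭 (J Y)).prod R) ⋙ f) ≫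
        (K.strong.strR (Psh X) Y Δ Z).map (K.strong.pnL R f).hom ≫
          (K.strong.pnR R ((K.strong.strL X (J Y) Γ Z).obj f)).hom =
      (K.strong.strL X (Psh Y) Δ Z).map (K.strong.pnR R f).hom ≫
        (K.strong.pnL R ((K.strong.strR (J X) Y Γ Z).obj f)).hom ≫
        Functor.whiskerLeft ((𝟭 (Psh X)).prod ((𝟭 (Psh Y)).prod R)) (K.gammaHom f) :=
  K.hom_extLR fun x y δ => by
    refine ((reassoc_of% (K.tilde_gammaHom ((𝟭 (J X)).prod ((𝟭 (J Y)).prod R) ⋙ f) x y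
      δ)) _).trans ?_
    refine (_ ≫= (reassoc_of% (K.tildeR_map (K.strong.pnL R f).hom ((yon X).obj x) y δ)) _).trans ?_
    refine ((reassoc_of% (K.tildeL_pnL R f x y δ)) _).trans ?_
    refine (_ ≫= K.tildeR_pnR R ((K.strong.strL X (J Y) Γ Z).obj f) ((yon X).obj x) y δ).trans ?_
    refine (K.tilde_gammaHom f x y (R.obj δ)).symm.trans ?_
    refine Eq.trans ?_ (_ ≫= ((reassoc_of% (K.tildeL_map (K.strong.pnR R f).hom x
      ((yon Y).obj y) δ)) _).symm)
    refine Eq.trans ?_ ((reassoc_of% (K.tildeR_pnR R f x y δ)) _).symm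
    exact _ ≫= ((reassoc_of% (K.tildeL_pnL R ((K.strong.strR (J X) Y Γ Z).obj f) x
      ((yon Y).obj y) δ)) _).symm

theorem gammaHom_tilde_right (f : J X × (J Y × Γ.prod) ⥤ Psh Z) :
    (K.strong.strL X (J Y) Γ Z).map (K.strong.tildeR f).hom ≫
        (K.strong.commL₁ ((K.strong.strR (J X) Y Γ Z).obj f) (yon Y)).hom ≫
        Functor.whiskerLeft ((𝟭 (Psh X)).prod ((yon Y).prod (𝟭 Γ.prod))) (K.gammaHom f) =
      (K.strong.tildeR ((K.strong.strL X (J Y) Γ Z).obj f)).hom :=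
  K.hom_extL fun x y γ => by
    refine ((reassoc_of% (K.tildeL_map (K.strong.tildeR f).hom x y γ)) _).trans ?_
    refine (_ ≫= (reassoc_of% (K.tildeL_commL₁ ((K.strong.strR (J X) Y Γ Z).obj f) (yon Y) x y
      γ)) _).trans ?_
    exact K.tilde_gammaHom f x y γ

/-- 2-cells out of a functor which is cocontinuous in its second argument are determined by their
components at representables in that argument. -/
theorem hom_ext_snd {F H : A × (Psh Y × Γ.prod) ⥤ Psh Z}
    (hF : IsCocontFst.{u} (exch (Psh Y) A Γ.prod ⋙ F)) {α β : F ⟶ H}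
    (h : ∀ a (y : J Y) γ, α.app (a, ((yon Y).obj y, γ)) = β.app (a, ((yon Y).obj y, γ))) :
    α = β :=
  congrArg (Functor.whiskerLeft (exch A (Psh Y) Γ.prod))
    (IsCocontFst.hom_ext (X := Y) hF (α := Functor.whiskerLeft (exch (Psh Y) A Γ.prod) α)
      (β := Functor.whiskerLeft (exch (Psh Y) A Γ.prod) β) fun y p => h p.1 ⟨y⟩ p.2)

/-- `f^{ts}` is cocontinuous in its second argument, since it is isomorphic to `f^{st}`. -/
theorem isCocontFst_exch_strL_strR (f : J X × (J Y × Γ.prod) ⥤ Psh Z) :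
    IsCocontFst.{u} (exch (Psh Y) (Psh X) Γ.prod ⋙
      (K.strong.strL X (Psh Y) Γ Z).obj ((K.strong.strR (J X) Y Γ Z).obj f)) :=
  (K.isCocontFst (Γ := .app (.of (Psh X)) Γ)
    (exch (J Y) (Psh X) Γ.prod ⋙ (K.strong.strL X (J Y) Γ Z).obj f)).of_iso
      (Functor.isoWhiskerLeft (exch (Psh Y) (Psh X) Γ.prod) (K.gamma f).symm)

/-- Naturality of `f → f^t ∘ₜ y` in the first argument. -/
theorem tildeR_naturality_left (f : A × (J Y × Γ.prod) ⥤ Psh Z) {a a' : A} (k : a ⟶ a') (y : J Y)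
    (γ : Γ.prod) :
    (K.strong.tildeR f).hom.app (a, (y, γ)) ≫ ((K.strong.strR A Y Γ Z).obj f).map
        (Prod.mkHom k (𝟙 (((yon Y).obj y, γ) : Psh Y × Γ.prod))) =
      f.map (Prod.mkHom k (𝟙 ((y, γ) : J Y × Γ.prod))) ≫
        (K.strong.tildeR f).hom.app (a', (y, γ)) := by
  refine Eq.trans ?_ ((K.strong.tildeR f).hom.naturality
    (Prod.mkHom k (𝟙 ((y, γ) : J Y × Γ.prod)))).symm
  exact _ ≫= congrArg (fun l => ((K.strong.strR A Y Γ Z).obj f).map (Prod.mkHom k l))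
    (Prod.ext ((yon Y).map_id y).symm rfl)

theorem tildeR_commR_inv (f : A × (J Y × Γ.prod) ⥤ Psh Z) (g : A' × Δ.prod ⥤ A) (a : A') (y : J Y)
    (γ : Γ.prod) (δ : Δ.prod) :
    (K.strong.tildeR f).hom.app (g.obj (a, δ), (y, γ)) ≫
        (K.strong.commR f g).inv.app (a, ((yon Y).obj y, (γ, δ))) =
      (K.strong.tildeR (Γ := .app Γ Δ) (inL f g)).hom.app (a, (y, (γ, δ))) :=
  (Iso.comp_inv_eq ((K.strong.commR f g).app (a, ((yon Y).obj y, (γ, δ))))).2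
    (K.tildeR_commR f g a y γ δ).symm

/-- The source `(f^{ts} ∘ₛ g)^s` is a strengthening in the left argument only. After restriction to
representables there, the cocontinuity of `f^{ts}` in the right argument is what allows the second
restriction to representables. -/
theorem gammaHom_hat_left {W : Cat.{u, u}} (f : J X × (J Y × Γ.prod) ⥤ Psh Z)
    (g : J W × Δ.prod ⥤ Psh X) :
    (K.strong.hatL ((K.strong.strR (J X) Y Γ Z).obj f) g).hom ≫
        inLMap (K.gammaHom f) ((K.strong.str W X Δ).obj g) ≫
        (K.strong.commR ((K.strong.strL X (J Y) Γ Z).obj f) ((K.strong.str W X Δ).obj g)).inv =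
      (K.strong.strL W (Psh Y) (.app Γ Δ) Z).map (inLMap (K.gammaHom f) g) ≫
        (K.strong.strL W (Psh Y) (.app Γ Δ) Z).map
          (K.strong.commR ((K.strong.strL X (J Y) Γ Z).obj f) g).inv ≫
        K.gammaHom (Γ := .app Γ Δ) (inL ((K.strong.strL X (J Y) Γ Z).obj f) g) ≫
        (K.strong.strR (Psh W) Y (.app Γ Δ) Z).map (K.strong.hatL f g).hom := by
  have key : (K.strong.tildeL (Γ := .app Γ Δ) (inL ((K.strong.strL X (Psh Y) Γ Z).obj
        ((K.strong.strR (J X) Y Γ Z).obj f)) g)).hom ≫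
      Functor.whiskerLeft ((yon W).prod (𝟭 (Psh Y × (Γ.prod × Δ.prod))))
        ((K.strong.hatL ((K.strong.strR (J X) Y Γ Z).obj f) g).hom ≫
        inLMap (K.gammaHom f) ((K.strong.str W X Δ).obj g) ≫
        (K.strong.commR ((K.strong.strL X (J Y) Γ Z).obj f) ((K.strong.str W X Δ).obj g)).inv) =
      (K.strong.tildeL (Γ := .app Γ Δ) (inL ((K.strong.strL X (Psh Y) Γ Z).obj
        ((K.strong.strR (J X) Y Γ Z).obj f)) g)).hom ≫
      Functor.whiskerLeft ((yon W).prod (𝟭 (Psh Y × (Γ.prod × Δ.prod))))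
      ((K.strong.strL W (Psh Y) (.app Γ Δ) Z).map (inLMap (K.gammaHom f) g) ≫
        (K.strong.strL W (Psh Y) (.app Γ Δ) Z).map
          (K.strong.commR ((K.strong.strL X (J Y) Γ Z).obj f) g).inv ≫
        K.gammaHom (Γ := .app Γ Δ) (inL ((K.strong.strL X (J Y) Γ Z).obj f) g) ≫
        (K.strong.strR (Psh W) Y (.app Γ Δ) Z).map (K.strong.hatL f g).hom) := by
    refine hom_ext_snd (Γ := .app Γ Δ) (F := inL ((K.strong.strL X (Psh Y) Γ Z).obj
        ((K.strong.strR (J X) Y Γ Z).obj f)) g)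
      (IsCocontFst.subst (K.isCocontFst_exch_strL_strR f) (plug Γ.prod g)) ?_
    rintro w y ⟨γ, δ⟩
    refine ((reassoc_of% (K.tildeL_hatL ((K.strong.strR (J X) Y Γ Z).obj f) g w
      ((yon Y).obj y) γ δ)) _).trans ?_
    refine ((reassoc_of% ((K.gammaHom f).naturality (Prod.mkHom ((K.unit g).app (w, δ))
      (𝟙 (((yon Y).obj y, γ) : Psh Y × Γ.prod))))) _).trans ?_
    refine Eq.trans ?_ ((reassoc_of% (K.tildeL_map (Γ := .app Γ Δ) (inLMap (K.gammaHom f) g) w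
      ((yon Y).obj y) (γ, δ))) _).symm
    refine _ ≫= ?_
    refine Eq.trans ?_ ((reassoc_of% (K.tildeL_map (Γ := .app Γ Δ)
      (K.strong.commR ((K.strong.strL X (J Y) Γ Z).obj f) g).inv w
      ((yon Y).obj y) (γ, δ))) _).symm
    -- The remaining equation starts at `f^{st}`; it is checked after precomposition with the
    -- invertible cell `f^s → f^{st} ∘ₜ y`.
    have : IsIso ((K.strong.tildeR ((K.strong.strL X (J Y) Γ Z).obj f)).hom.app
      (g.obj (w, δ), (y, γ))) := inferInstance
    refine (cancel_epi ((K.strong.tildeR ((K.strong.strL X (J Y) Γ Z).obj f)).hom.app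
      (g.obj (w, δ), (y, γ)))).1 ?_
    refine ((reassoc_of% (K.tildeR_naturality_left ((K.strong.strL X (J Y) Γ Z).obj f)
      ((K.unit g).app (w, δ)) y γ)) _).trans ?_
    refine (_ ≫= K.tildeR_commR_inv ((K.strong.strL X (J Y) Γ Z).obj f)
      ((K.strong.str W X Δ).obj g) ((yon W).obj w) y γ δ).trans ?_
    refine Eq.trans ?_ ((reassoc_of% (K.tildeR_commR_inv ((K.strong.strL X (J Y) Γ Z).obj f)
      g w y γ δ)) _).symm
    refine Eq.trans ?_ ((reassoc_of% (K.tilde_gammaHom (Γ := .app Γ Δ)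
      (inL ((K.strong.strL X (J Y) Γ Z).obj f) g) w y (γ, δ))) _).symm
    refine Eq.trans ?_ (_ ≫= (K.tildeR_map (Γ := .app Γ Δ)
      (K.strong.hatL f g).hom ((yon W).obj w) y (γ, δ)).symm)
    exact ((reassoc_of% (K.tildeL_hatL f g w y γ δ)) _).symm
  exact K.hom_extL (Γ := .app Γ Δ) fun w q γ => NatTrans.congr_app key (w, (q, γ))

theorem gammaHom_hat_right {V : Cat.{u, u}} (f : J X × (J Y × Γ.prod) ⥤ Psh Z)
    (h : J V × Δ.prod ⥤ Psh Y) :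
    (K.strong.strL X (Psh V) (.app Γ Δ) Z).map (K.strong.hatR f h).hom ≫
        (K.strong.commL ((K.strong.strR (J X) Y Γ Z).obj f) ((K.strong.str V Y Δ).obj h)).hom ≫
        inRMap (K.gammaHom f) ((K.strong.str V Y Δ).obj h) =
      K.gammaHom (Γ := .app Γ Δ) (inR ((K.strong.strR (J X) Y Γ Z).obj f) h) ≫
        (K.strong.strR (Psh X) V (.app Γ Δ) Z).map
          (K.strong.commL ((K.strong.strR (J X) Y Γ Z).obj f) h).hom ≫
        (K.strong.strR (Psh X) V (.app Γ Δ) Z).map (inRMap (K.gammaHom f) h) ≫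
        (K.strong.hatR ((K.strong.strL X (J Y) Γ Z).obj f) h).hom :=
  K.hom_extLR (Γ := .app Γ Δ) fun x v ⟨γ, δ⟩ => by
    refine (_ ≫= (reassoc_of% (K.tildeL_map (Γ := .app Γ Δ) (K.strong.hatR f h).hom x
      ((yon V).obj v) (γ, δ))) _).trans ?_
    refine ((reassoc_of% (K.tildeR_hatR f h x v γ δ)) _).trans ?_
    refine (_ ≫= (reassoc_of% (K.tildeL_commL ((K.strong.strR (J X) Y Γ Z).obj f)
      ((K.strong.str V Y Δ).obj h) x ((yon V).obj v) γ δ)) _).trans ?_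
    refine Eq.trans ?_ ((reassoc_of% (K.tilde_gammaHom (Γ := .app Γ Δ)
      (inR ((K.strong.strR (J X) Y Γ Z).obj f) h) x v (γ, δ))) _).symm
    refine Eq.trans ?_ (_ ≫= ((reassoc_of% (K.tildeR_map (Γ := .app Γ Δ)
      (K.strong.commL ((K.strong.strR (J X) Y Γ Z).obj f) h).hom ((yon X).obj x) v (γ, δ))) _).symm)
    refine Eq.trans ?_ ((reassoc_of% (K.tildeL_commL ((K.strong.strR (J X) Y Γ Z).obj f)
      h x v γ δ)) _).symm
    refine Eq.trans ?_ (_ ≫= ((reassoc_of% (K.tildeR_map (Γ := .app Γ Δ)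
      (inRMap (K.gammaHom f) h) ((yon X).obj x) v (γ, δ))) _).symm)
    refine Eq.trans ?_ (_ ≫= (_ ≫= (K.tildeR_hatR ((K.strong.strL X (J Y) Γ Z).obj f)
      h ((yon X).obj x) v γ δ).symm))
    refine (((K.strong.tildeL ((K.strong.strR (J X) Y Γ Z).obj f)).hom ≫
      Functor.whiskerLeft ((yon X).prod (𝟭 (Psh Y × Γ.prod))) (K.gammaHom f)).naturality
        (Prod.mkHom (𝟙 x) (Prod.mkHom ((K.unit h).app (v, δ)) (𝟙 γ)))).trans ?_
    refine (Category.assoc _ _ _).trans (_ ≫= (_ ≫= ?_))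
    exact congrArg (fun l => ((K.strong.strR (Psh X) Y Γ Z).obj
      ((K.strong.strL X (J Y) Γ Z).obj f)).map (Prod.mkHom l (Prod.mkHom ((K.unit h).app (v, δ))
        (𝟙 γ)))) ((yon X).map_id x)

end TwoArguments
end LanChoice

/-! ### Strengthenings in three arguments and the braiding axiom -/

namespace LanChoice

variable (K : LanChoice.{u})

section ThreeArguments

variable {W X Y Z : Cat.{u, u}} {A B C : Cat.{u, u + 1}} {Γ : Ctx.{u}}

/-- `f → f^u ∘ᵤ y`, in the third of three distinguished arguments. -/
noncomputable def tilde₃ (f : A × (B × (J Y × Γ.prod)) ⥤ Psh Z) :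
    f ⟶ (𝟭 A).prod ((𝟭 B).prod ((yon Y).prod (𝟭 Γ.prod))) ⋙ (K.strong.str₃ A B Y Γ Z).obj f :=
  Functor.whiskerLeft (rot A B (J Y) Γ.prod)
    (K.unit (Γ := .app (.of A) (.app (.of B) Γ)) (rotInv (J Y) A B Γ.prod ⋙ f))

theorem tilde₃_map {f f' : A × (B × (J Y × Γ.prod)) ⥤ Psh Z} (α : f ⟶ f') (a : A) (b : B) (y : J Y)
    (γ : Γ.prod) :
    (K.tilde₃ f).app (a, (b, (y, γ))) ≫
        ((K.strong.str₃ A B Y Γ Z).map α).app (a, (b, ((yon Y).obj y, γ))) =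
      α.app (a, (b, (y, γ))) ≫ (K.tilde₃ f').app (a, (b, (y, γ))) :=
  K.unit_lanMap (Γ := .app (.of A) (.app (.of B) Γ))
    (Functor.whiskerLeft (rotInv (J Y) A B Γ.prod) α) y (a, (b, γ))

theorem hom_ext₃ {f : A × (B × (J Y × Γ.prod)) ⥤ Psh Z} {H : A × (B × (Psh Y × Γ.prod)) ⥤ Psh Z}
    {α β : (K.strong.str₃ A B Y Γ Z).obj f ⟶ H}
    (h : ∀ a b y γ, (K.tilde₃ f).app (a, (b, (y, γ))) ≫ α.app (a, (b, ((yon Y).obj y, γ))) =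
      (K.tilde₃ f).app (a, (b, (y, γ))) ≫ β.app (a, (b, ((yon Y).obj y, γ)))) : α = β :=
  congrArg (Functor.whiskerLeft (rot A B (Psh Y) Γ.prod))
    (K.hom_ext (Γ := .app (.of A) (.app (.of B) Γ)) (f := rotInv (J Y) A B Γ.prod ⋙ f)
      (H := rotInv (Psh Y) A B Γ.prod ⋙ H)
      (α := Functor.whiskerLeft (rotInv (Psh Y) A B Γ.prod) α)
      (β := Functor.whiskerLeft (rotInv (Psh Y) A B Γ.prod) β) fun y p => h p.1 p.2.1 y p.2.2)

theorem tildeL_reord₁ (f : J X × (B × (C × Γ.prod)) ⥤ Psh Z) (x : J X) (b : B) (c : C)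
    (γ : Γ.prod) :
    (K.strong.tildeL (Γ := .app (.of B) Γ) ((𝟭 (J X)).prod (exch C B Γ.prod) ⋙ f)).hom.app
        (x, (c, (b, γ))) ≫ (K.strong.reord₁ f).hom.app ((yon X).obj x, (c, (b, γ))) =
      (K.strong.tildeL (Γ := .app (.of C) Γ) f).hom.app (x, (b, (c, γ))) :=
  K.unit_pn (Γ := .app (.of B) (.app (.of C) Γ)) (Δ := .app (.of C) (.app (.of B) Γ))
    (exch C B Γ.prod) f x (c, (b, γ))

theorem tildeL_reord₂ (f : A × (J X × (C × Γ.prod)) ⥤ Psh Z) (a : A) (x : J X) (c : C)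
    (γ : Γ.prod) :
    (K.strong.tildeL (Γ := .app (.of A) Γ) (rot (J X) C A Γ.prod ⋙ f)).hom.app
        (x, (c, (a, γ))) ≫ (K.strong.reord₂ f).hom.app ((yon X).obj x, (c, (a, γ))) =
      (K.strong.tildeR (Γ := .app (.of C) Γ) f).hom.app (a, (x, (c, γ))) :=
  K.unit_pn (Γ := .app (.of A) (.app (.of C) Γ)) (Δ := .app (.of C) (.app (.of A) Γ))
    (exch C A Γ.prod) (exch (J X) A (C × Γ.prod) ⋙ f) x (c, (a, γ))

theorem tildeL_reord₁_inv (f : J X × (B × (C × Γ.prod)) ⥤ Psh Z) (x : J X) (b : B) (c : C)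
    (γ : Γ.prod) :
    (K.strong.tildeL (Γ := .app (.of C) Γ) f).hom.app (x, (b, (c, γ))) ≫
        (K.strong.reord₁ f).inv.app ((yon X).obj x, (c, (b, γ))) =
      (K.strong.tildeL (Γ := .app (.of B) Γ) ((𝟭 (J X)).prod (exch C B Γ.prod) ⋙ f)).hom.app
        (x, (c, (b, γ))) :=
  (Iso.comp_inv_eq ((K.strong.reord₁ f).app ((yon X).obj x, (c, (b, γ))))).2
    (K.tildeL_reord₁ f x b c γ).symm

theorem tildeL_reord₂_inv (f : A × (J X × (C × Γ.prod)) ⥤ Psh Z) (a : A) (x : J X) (c : C)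
    (γ : Γ.prod) :
    (K.strong.tildeR (Γ := .app (.of C) Γ) f).hom.app (a, (x, (c, γ))) ≫
        (K.strong.reord₂ f).inv.app ((yon X).obj x, (c, (a, γ))) =
      (K.strong.tildeL (Γ := .app (.of A) Γ) (rot (J X) C A Γ.prod ⋙ f)).hom.app
        (x, (c, (a, γ))) :=
  (Iso.comp_inv_eq ((K.strong.reord₂ f).app ((yon X).obj x, (c, (a, γ))))).2
    (K.tildeL_reord₂ f a x c γ).symm

theorem tildeR_reord₃ (f : A × (B × (J Y × Γ.prod)) ⥤ Psh Z) (a : A) (b : B) (y : J Y)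
    (γ : Γ.prod) :
    (K.strong.tildeR (Γ := .app (.of A) Γ) (rot B (J Y) A Γ.prod ⋙ f)).hom.app
        (b, (y, (a, γ))) ≫ (K.strong.reord₃ f).hom.app (b, ((yon Y).obj y, (a, γ))) =
      (K.tilde₃ f).app (a, (b, (y, γ))) :=
  K.unit_pn (Γ := .app (.of A) (.app (.of B) Γ)) (Δ := .app (.of B) (.app (.of A) Γ))
    (exch B A Γ.prod) (rotInv (J Y) A B Γ.prod ⋙ f) y (b, (a, γ))

theorem tildeR_reord₃_inv (f : A × (B × (J Y × Γ.prod)) ⥤ Psh Z) (a : A) (b : B) (y : J Y)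
    (γ : Γ.prod) :
    (K.tilde₃ f).app (a, (b, (y, γ))) ≫
        (K.strong.reord₃ f).inv.app (b, ((yon Y).obj y, (a, γ))) =
      (K.strong.tildeR (Γ := .app (.of A) Γ) (rot B (J Y) A Γ.prod ⋙ f)).hom.app
        (b, (y, (a, γ))) :=
  (Iso.comp_inv_eq ((K.strong.reord₃ f).app (b, ((yon Y).obj y, (a, γ))))).2
    (K.tildeR_reord₃ f a b y γ).symm

theorem tilde_gamma₁₃ (f : J W × (B × (J Y × Γ.prod)) ⥤ Psh Z) (w : J W) (b : B) (y : J Y)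
    (γ : Γ.prod) :
    (K.tilde₃ f).app (w, (b, (y, γ))) ≫
        (K.strong.tildeL (Γ := .app (.of (Psh Y)) Γ) ((K.strong.str₃ (J W) B Y Γ Z).obj f)).hom.app
          (w, (b, ((yon Y).obj y, γ))) ≫
        (GammaFamily.gamma₁₃ (S := K.strong) K.gamma f).app
          ((yon W).obj w, (b, ((yon Y).obj y, γ))) =
      (K.strong.tildeL (Γ := .app (.of (J Y)) Γ) f).hom.app (w, (b, (y, γ))) ≫
        (K.tilde₃ ((K.strong.str₁ W B (J Y) Γ Z).obj f)).app ((yon W).obj w, (b, (y, γ))) := by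
  have h1 := K.tildeL_reord₁_inv ((K.strong.str₃ (J W) B Y Γ Z).obj f) w b ((yon Y).obj y) γ
  refine (_ ≫= whisker_triangle h1 _).trans ?_
  refine (whisker_pentagon (K.tilde_gammaHom (Γ := .app (.of B) Γ)
    ((𝟭 (J W)).prod (exch (J Y) B Γ.prod) ⋙ f) w y (b, γ)) _).trans ?_
  refine (_ ≫= K.tildeR_map (Γ := .app (.of B) Γ) (K.strong.reord₁ f).hom ((yon W).obj w) y
    (b, γ)).trans ?_
  exact whisker_triangle (K.tildeL_reord₁ f w b y γ) _

theorem tilde_gamma₂₃ (f : A × (J X × (J Y × Γ.prod)) ⥤ Psh Z) (a : A) (x : J X) (y : J Y)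
    (γ : Γ.prod) :
    (K.tilde₃ f).app (a, (x, (y, γ))) ≫
        (K.strong.tildeR (Γ := .app (.of (Psh Y)) Γ) ((K.strong.str₃ A (J X) Y Γ Z).obj f)).hom.app
          (a, (x, ((yon Y).obj y, γ))) ≫
        (GammaFamily.gamma₂₃ (S := K.strong) K.gamma f).app
          (a, ((yon X).obj x, ((yon Y).obj y, γ))) =
      (K.strong.tildeR (Γ := .app (.of (J Y)) Γ) f).hom.app (a, (x, (y, γ))) ≫
        (K.tilde₃ ((K.strong.str₂ A X (J Y) Γ Z).obj f)).app (a, ((yon X).obj x, (y, γ))) := by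
  have h1 := K.tildeL_reord₂_inv ((K.strong.str₃ A (J X) Y Γ Z).obj f) a x ((yon Y).obj y) γ
  have h2 := K.tildeR_reord₃_inv f a x y γ
  refine (_ ≫= whisker_triangle h1 _).trans ?_
  refine (_ ≫= whisker_square (K.tildeL_map (Γ := .app (.of A) Γ) (K.strong.reord₃ f).inv x
    ((yon Y).obj y) (a, γ)) _).trans ?_
  refine (whisker_triangle h2 _).trans ?_
  refine (whisker_pentagon (K.tilde_gammaHom (Γ := .app (.of A) Γ)
    (rot (J X) (J Y) A Γ.prod ⋙ f) x y (a, γ)) _).trans ?_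
  refine (_ ≫= whisker_square (K.tildeR_map (Γ := .app (.of A) Γ) (K.strong.reord₂ f).hom
    ((yon X).obj x) y (a, γ)) _).trans ?_
  refine (whisker_triangle (K.tildeL_reord₂ f a x y γ) _).trans ?_
  exact _ ≫= K.tildeR_reord₃ ((K.strong.str₂ A X (J Y) Γ Z).obj f) a ((yon X).obj x) y γ

/-- 2-cells out of `f^{uts}` are determined by their components at triples of representables. -/
theorem hom_extL₂₃ {f : J W × (J X × (J Y × Γ.prod)) ⥤ Psh Z}
    {H : Psh W × (Psh X × (Psh Y × Γ.prod)) ⥤ Psh Z}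
    {α β : (K.strong.str₁ W (Psh X) (Psh Y) Γ Z).obj ((K.strong.str₂ (J W) X (Psh Y) Γ Z).obj
      ((K.strong.str₃ (J W) (J X) Y Γ Z).obj f)) ⟶ H}
    (h : ∀ w x y γ, (K.tilde₃ f).app (w, (x, (y, γ))) ≫
      (K.strong.tildeR (Γ := .app (.of (Psh Y)) Γ)
        ((K.strong.str₃ (J W) (J X) Y Γ Z).obj f)).hom.app (w, (x, ((yon Y).obj y, γ))) ≫
      (K.strong.tildeL (Γ := .app (.of (Psh Y)) Γ) ((K.strong.str₂ (J W) X (Psh Y) Γ Z).obj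
        ((K.strong.str₃ (J W) (J X) Y Γ Z).obj f))).hom.app
          (w, ((yon X).obj x, ((yon Y).obj y, γ))) ≫
      α.app ((yon W).obj w, ((yon X).obj x, ((yon Y).obj y, γ))) =
      (K.tilde₃ f).app (w, (x, (y, γ))) ≫
      (K.strong.tildeR (Γ := .app (.of (Psh Y)) Γ)
        ((K.strong.str₃ (J W) (J X) Y Γ Z).obj f)).hom.app (w, (x, ((yon Y).obj y, γ))) ≫
      (K.strong.tildeL (Γ := .app (.of (Psh Y)) Γ) ((K.strong.str₂ (J W) X (Psh Y) Γ Z).obj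
        ((K.strong.str₃ (J W) (J X) Y Γ Z).obj f))).hom.app
          (w, ((yon X).obj x, ((yon Y).obj y, γ))) ≫
      β.app ((yon W).obj w, ((yon X).obj x, ((yon Y).obj y, γ)))) : α = β := by
  let u₁ := (K.strong.tildeL (Γ := .app (.of (Psh Y)) Γ) ((K.strong.str₂ (J W) X (Psh Y) Γ Z).obj
        ((K.strong.str₃ (J W) (J X) Y Γ Z).obj f))).hom
  let u₂ := (K.strong.tildeR (Γ := .app (.of (Psh Y)) Γ)
        ((K.strong.str₃ (J W) (J X) Y Γ Z).obj f)).hom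
  have h₃ : u₂ ≫ Functor.whiskerLeft ((𝟭 (J W)).prod ((yon X).prod (𝟭 (Psh Y × Γ.prod)))) (u₁ ≫
        Functor.whiskerLeft ((yon W).prod (𝟭 (Psh X × (Psh Y × Γ.prod)))) α) =
      u₂ ≫ Functor.whiskerLeft ((𝟭 (J W)).prod ((yon X).prod (𝟭 (Psh Y × Γ.prod)))) (u₁ ≫
        Functor.whiskerLeft ((yon W).prod (𝟭 (Psh X × (Psh Y × Γ.prod)))) β) := K.hom_ext₃ h
  have h₂ : u₁ ≫ Functor.whiskerLeft ((yon W).prod (𝟭 (Psh X × (Psh Y × Γ.prod)))) α =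
      u₁ ≫ Functor.whiskerLeft ((yon W).prod (𝟭 (Psh X × (Psh Y × Γ.prod)))) β :=
    K.hom_extR (Γ := .app (.of (Psh Y)) Γ) fun w x p => NatTrans.congr_app h₃ (w, (x, p))
  exact K.hom_extL (Γ := .app (.of (Psh Y)) Γ) fun w p q => NatTrans.congr_app h₂ (w, (p, q))

/-- Both composites restrict at a triple of representables to the canonical 2-cell from `f`. -/
theorem gamma_braiding (f : J W × (J X × (J Y × Γ.prod)) ⥤ Psh Z) :
    (K.strong.str₁ W (Psh X) (Psh Y) Γ Z).map (GammaFamily.gamma₂₃ (S := K.strong) K.gamma f) ≫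
        GammaFamily.gamma₁₃ (S := K.strong) K.gamma ((K.strong.str₂ (J W) X (J Y) Γ Z).obj f) ≫
        (K.strong.str₃ (Psh W) (Psh X) Y Γ Z).map (GammaFamily.gamma₁₂ (S := K.strong) K.gamma f) =
      GammaFamily.gamma₁₂ (S := K.strong) K.gamma ((K.strong.str₃ (J W) (J X) Y Γ Z).obj f) ≫
        (K.strong.str₂ (Psh W) X (Psh Y) Γ Z).map (GammaFamily.gamma₁₃ (S := K.strong) K.gamma f) ≫
        GammaFamily.gamma₂₃ (S := K.strong) K.gamma ((K.strong.str₁ W (J X) (J Y) Γ Z).obj f) :=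
  K.hom_extL₂₃ fun w x y γ => by
    refine (_ ≫= (_ ≫= whisker_square (K.tildeL_map (Γ := .app (.of (Psh Y)) Γ)
      (GammaFamily.gamma₂₃ (S := K.strong) K.gamma f) w ((yon X).obj x)
      ((yon Y).obj y, γ)) _)).trans ?_
    refine (whisker_pentagon (K.tilde_gamma₂₃ f w x y γ) _).trans ?_
    refine (_ ≫= whisker_pentagon (K.tilde_gamma₁₃ ((K.strong.str₂ (J W) X (J Y) Γ Z).obj f) w
      ((yon X).obj x) y γ) _).trans ?_
    refine (_ ≫= (_ ≫= K.tilde₃_map (GammaFamily.gamma₁₂ (S := K.strong) K.gamma f)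
      ((yon W).obj w) ((yon X).obj x) y γ)).trans ?_
    refine (whisker_pentagon (K.tilde_gammaHom (Γ := .app (.of (J Y)) Γ) f w x (y, γ)) _).trans ?_
    refine Eq.trans ?_ (_ ≫= (whisker_pentagon (K.tilde_gammaHom (Γ := .app (.of (Psh Y)) Γ)
      ((K.strong.str₃ (J W) (J X) Y Γ Z).obj f) w x ((yon Y).obj y, γ)) _).symm)
    refine Eq.trans ?_ (_ ≫= (_ ≫= (whisker_square (K.tildeR_map (Γ := .app (.of (Psh Y)) Γ)
      (GammaFamily.gamma₁₃ (S := K.strong) K.gamma f) ((yon W).obj w) x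
      ((yon Y).obj y, γ)) _).symm))
    refine Eq.trans ?_ (whisker_pentagon (K.tilde_gamma₁₃ (B := J X) f w x y γ) _).symm
    exact _ ≫= (K.tilde_gamma₂₃ ((K.strong.str₁ W (J X) (J Y) Γ Z).obj f) ((yon W).obj w) x y
      γ).symm

end ThreeArguments

theorem nonempty_pseudocommutativity : Nonempty K.strong.Pseudocommutativity :=
  ⟨{ gamma := K.gamma
     naturality := K.gammaHom_naturality
     naturality_subst := K.gammaHom_naturality_subst
     tilde_left f := (Category.assoc _ _ _).symm.trans
      ((Iso.comp_inv_eq _).2 (K.tildeL_gammaHom f))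
     tilde_right := K.gammaHom_tilde_right
     hat_left := K.gammaHom_hat_left
     hat_right := K.gammaHom_hat_right
     braiding := K.gamma_braiding }⟩

end LanChoice

end Pseudocommutativity

/-! ### Separately cocontinuous functors -/

section SepCocont

universe v v' v'' w w' w''

variable {ι : Type} {A : ι → Type w} [∀ k, Category.{v} (A k)] {Z : Type w'} [Category.{v'} Z]
  {Z' : Type w''} [Category.{v''} Z']

/-- A functor `H` of several variables preserves small colimits in each variable separately. This is
expressed through cocones `c` of families which are colimit cocones in one coordinate `k₀` and whose
legs are invertible in all other coordinates. -/
def IsSepCocont (H : (∀ k, A k) ⥤ Z) : Prop :=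
  ∀ (k₀ : ι) {K : Type u} [Category.{u} K] (D : K ⥤ ∀ k, A k) (c : Cocone D),
    Nonempty (IsColimit ((Pi.eval A k₀).mapCocone c)) →
    (∀ k ≠ k₀, ∀ j, IsIso (c.ι.app j k)) → Nonempty (IsColimit (H.mapCocone c))

theorem IsSepCocont.of_iso {H H' : (∀ k, A k) ⥤ Z} (hH : IsSepCocont.{u} H) (e : H ≅ H') :
    IsSepCocont.{u} H' := fun k₀ _ _ D c hc hi =>
  (hH k₀ D c hc hi).map (IsColimit.mapCoconeEquiv e)

theorem IsSepCocont.comp {H : (∀ k, A k) ⥤ Z} (hH : IsSepCocont.{u} H) (L : Z ⥤ Z')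
    [PreservesColimitsOfSize.{u, u} L] : IsSepCocont.{u} (H ⋙ L) := fun k₀ _ _ D c hc hi =>
  (hH k₀ D c hc hi).map fun h =>
    (isColimitOfPreserves L h : IsColimit (L.mapCocone (H.mapCocone c)))

end SepCocont

theorem isSepCocont_idMap (A : Cat.{u, u + 1}) : IsSepCocont.{u} (idMap A) :=
  fun _ _ _ _ _ hc _ => hc

/-- Every argument of a composite belongs to exactly one of the inner multimorphisms, so a cocone
varying in one argument only is sent to a cocone of the same kind. -/
theorem IsSepCocont.fcomp {ι κ : Type} {fib : ι → Type} {e : ∀ k, fib k → κ} (he : IsConcat e)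
    {W : κ → Cat.{u, u + 1}} {X : ι → Cat.{u, u + 1}} {Z : Cat.{u, u + 1}} {f : (∀ k, X k) ⥤ Z}
    {g : ∀ k, (∀ m : fib k, W (e k m)) ⥤ X k} (hf : IsSepCocont.{u} f)
    (hg : ∀ k, IsSepCocont.{u} (g k)) : IsSepCocont.{u} (fcomp e f g) := by
  intro l K _ D c hc hi
  obtain ⟨⟨k₀, m₀⟩, rfl⟩ := he.2 l
  refine hf k₀ (D ⋙ tuple e g) ((tuple e g).mapCocone c) ?_ ?_
  · refine hg k₀ m₀ (D ⋙ Pi.comap (fun m => ↑(W m)) (e k₀))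
      ((Pi.comap (fun m => ↑(W m)) (e k₀)).mapCocone c) hc (fun m hm j => ?_)
    exact hi _ (fun h => hm (by cases he.1 (a₁ := ⟨k₀, m⟩) (a₂ := ⟨k₀, m₀⟩) h; rfl)) j
  · intro k hk j
    have : IsIso ((Pi.comap (fun m => ↑(W m)) (e k)).map (c.ι.app j)) := by
      rw [isIso_pi_iff]
      exact fun m => hi _ (fun h => hk (congrArg Sigma.fst
        (he.1 (a₁ := ⟨k, m⟩) (a₂ := ⟨k₀, m₀⟩) h))) j
    exact inferInstanceAs (IsIso ((g k).map ((Pi.comap (fun m => ↑(W m)) (e k)).map (c.ι.app j))))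

section Density

variable {ι : Type} [Finite ι] {X : ι → Type u} [∀ k, Category.{u} (X k)]

/-- Families of presheaves are generated by families of representables under colimits taken in one
coordinate at a time: by induction on the set of coordinates at which the family is not
representable, resolving one of them by its tautological cocone. -/
theorem pi_presheaf_induction (P : (∀ k, (X k)ᵒᵖ ⥤ Type u) → Prop)
    (rep : ∀ x : ∀ k, X k, P (fun k => yoneda.obj (x k)))
    (colim : ∀ (k₀ : ι) {K : Type u} [Category.{u} K] (D : K ⥤ ∀ k, (X k)ᵒᵖ ⥤ Type u)
      (c : Cocone D), Nonempty (IsColimit ((Pi.eval _ k₀).mapCocone c)) →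
      (∀ k ≠ k₀, ∀ j, IsIso (c.ι.app j k)) → (∀ j, P (D.obj j)) → P c.pt)
    (p : ∀ k, (X k)ᵒᵖ ⥤ Type u) : P p := by
  classical
  have := Fintype.ofFinite ι
  suffices h : ∀ (s : Finset ι) (p : ∀ k, (X k)ᵒᵖ ⥤ Type u),
      (∀ k ∉ s, ∃ x, p k = yoneda.obj x) → P p from
    h Finset.univ p (fun k hk => absurd (Finset.mem_univ k) hk)
  intro s
  induction s using Finset.induction_on with
  | empty =>
    intro p hp
    choose x hx using fun k => hp k (Finset.notMem_empty k)
    obtain rfl : p = fun k => yoneda.obj (x k) := funext hx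
    exact rep x
  | insert k₀ s hk₀ ih =>
    intro p hp
    -- The tautological cocone of `p k₀` in the coordinate `k₀`, constant cocones in the others.
    have h : ∀ k, ∃ (R : CostructuredArrow yoneda (p k₀) ⥤ (X k)ᵒᵖ ⥤ Type u)
        (σ : R ⟶ (Functor.const _).obj (p k)),
        (k = k₀ → Nonempty (IsColimit (Cocone.mk (p k) σ)) ∧ ∀ j, ∃ x, R.obj j = yoneda.obj x) ∧
        (k ≠ k₀ → (∀ j, IsIso (σ.app j)) ∧ ∀ j, R.obj j = p k) := by
      intro k
      by_cases hk : k = k₀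
      · subst hk
        exact ⟨_, (Presheaf.tautologicalCocone (p k)).ι, fun _ =>
          ⟨⟨Presheaf.isColimitTautologicalCocone (p k)⟩, fun j => ⟨j.left, rfl⟩⟩,
          fun h => absurd rfl h⟩
      · exact ⟨(Functor.const _).obj (p k), 𝟙 _, fun h => absurd h hk, fun _ =>
          ⟨fun j => inferInstance, fun j => rfl⟩⟩
    choose R σ h₁ h₂ using h
    refine colim k₀ (Functor.pi' R) { pt := p, ι := { app j k := (σ k).app j, naturality := ?_ } }
      (h₁ k₀ rfl).1 (fun k hk j => (h₂ k hk).1 j) (fun j => ih _ (fun k hk => ?_))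
    · intro j j' a
      funext k
      exact (σ k).naturality a
    · by_cases hkk : k = k₀
      · subst hkk
        exact (h₁ k rfl).2 j
      · obtain ⟨x, hx⟩ := hp k (by simp [hkk, hk])
        exact ⟨x, ((h₂ k hkk).2 j).trans hx⟩

universe v' w'

variable {Z : Type w'} [Category.{v'} Z]

theorem IsSepCocont.isIso {F F' : (∀ k, (X k)ᵒᵖ ⥤ Type u) ⥤ Z} (hF : IsSepCocont.{u} F)
    (hF' : IsSepCocont.{u} F') (α : F ⟶ F')
    (h : ∀ x : ∀ k, X k, IsIso (α.app (fun k => yoneda.obj (x k)))) : IsIso α := by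
  have : ∀ p, IsIso (α.app p) := pi_presheaf_induction (fun p => IsIso (α.app p)) h
    (fun k₀ _ _ D c hc hi hD =>
      isIso_app_of_isColimit α (hF k₀ D c hc hi).some (hF' k₀ D c hc hi).some hD)
  exact NatIso.isIso_of_isIso_app α

end Density

section ExtProd

variable {ι : Type} {X : ι → Type u} [∀ k, Category.{u} (X k)]

/-- The external product `p ↦ (x ↦ ∏ₖ pₖ(xₖ))` of presheaves. -/
def extProd (X : ι → Type u) [∀ k, Category.{u} (X k)] :
    (∀ k, (X k)ᵒᵖ ⥤ Type u) ⥤ ((∀ k, X k)ᵒᵖ ⥤ Type u) where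
  obj p :=
    { obj x := ∀ k, (p k).obj (.op (x.unop k))
      map a := ↾ (fun t k => (p k).map (a.unop k).op (t k)) }
  map φ := { app x := ↾ (fun t k => (φ k).app _ (t k)) }

/-- This holds since in `Type` the product with a fixed set preserves colimits. -/
theorem isSepCocont_extProd : IsSepCocont.{u} (extProd X) := by
  intro k₀ K _ D c ⟨hc⟩ hi
  refine ⟨evaluationJointlyReflectsColimits _ (fun x => ?_)⟩
  have hc' : IsColimit (((evaluation _ (Type u)).obj (.op (x.unop k₀))).mapCocone
    ((Pi.eval _ k₀).mapCocone c)) := isColimitOfPreserves _ hc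
  have hbij : ∀ k ≠ k₀, ∀ j, Function.Bijective ((c.ι.app j k).app (.op (x.unop k))) :=
    fun k hk j => by
      have := hi k hk j
      rw [← isIso_iff_bijective]
      infer_instance
  -- A family in `∏ₖ (D j)ₖ(xₖ)` amounts to its coordinate at `k₀` together with the images in
  -- `∏ₖ (c.pt)ₖ(xₖ)` of its other coordinates.
  have huniq : ∀ (j : K) (v v' : ∀ k, (D.obj j k).obj (.op (x.unop k))), v k₀ = v' k₀ →
      (∀ k ≠ k₀, (c.ι.app j k).app (.op (x.unop k)) (v k) =
        (c.ι.app j k).app (.op (x.unop k)) (v' k)) → v = v' := fun j v v' h h' => by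
    funext k
    by_cases hk : k = k₀
    · subst hk
      exact h
    · exact (hbij k hk j).1 (h' k hk)
  have hex : ∀ (j : K) (t : ∀ k, (c.pt k).obj (.op (x.unop k)))
      (d : (D.obj j k₀).obj (.op (x.unop k₀))), ∃ v : ∀ k, (D.obj j k).obj (.op (x.unop k)),
        v k₀ = d ∧ ∀ k ≠ k₀, (c.ι.app j k).app (.op (x.unop k)) (v k) = t k := fun j t d => by
    have h : ∀ k, ∃ v : (D.obj j k).obj (.op (x.unop k)), (∀ h : k = k₀, v = h ▸ d) ∧
        (k ≠ k₀ → (c.ι.app j k).app (.op (x.unop k)) v = t k) := fun k => by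
      by_cases hk : k = k₀
      · subst hk
        exact ⟨d, fun _ => rfl, fun h => absurd rfl h⟩
      · obtain ⟨v, hv⟩ := (hbij k hk j).2 (t k)
        exact ⟨v, fun h => absurd h hk, fun _ => hv⟩
    choose v hv using h
    exact ⟨v, (hv k₀).1 rfl, fun k hk => (hv k).2 hk⟩
  choose v hv₀ hv using hex
  let F := (D ⋙ extProd X) ⋙ (evaluation _ (Type u)).obj x
  have hleg : ∀ (j : K) (w : F.obj j), v j (((extProd X).map (c.ι.app j)).app x w) (w k₀) = w :=
    fun j w => huniq j _ _ (hv₀ _ _ _) (fun k hk => hv _ _ _ k hk)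
  have hmap : ∀ {j j' : K} (f : j ⟶ j') t d, F.map f (v j t d) =
      v j' t ((D.map f k₀).app (.op (x.unop k₀)) d) := fun {j j'} f t d => by
    refine huniq j' _ _ ?_ (fun k hk => ?_)
    · exact (congrArg ((D.map f k₀).app (.op (x.unop k₀))) (hv₀ j t d)).trans (hv₀ _ _ _).symm
    · have h := ConcreteCategory.congr_hom (NatTrans.congr_app (congrFun (c.w f) k)
        (.op (x.unop k))) (v j t d k)
      exact h.trans ((hv j t d k hk).trans (hv j' t _ k hk).symm)
  -- With the coordinates of `t` other than `k₀` fixed, a cocone on the products restricts to a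
  -- cocone in the coordinate `k₀`.
  let r (s : Cocone F) (t : ∀ k, (c.pt k).obj (.op (x.unop k))) :
      Cocone ((D ⋙ Pi.eval _ k₀) ⋙ (evaluation _ (Type u)).obj (.op (x.unop k₀))) :=
    { pt := s.pt
      ι := { app j := ↾ (fun d => s.ι.app j (v j t d))
             naturality j j' f := by
               ext d
               exact (congrArg (s.ι.app j') (hmap f t d)).symm.trans
                 (ConcreteCategory.congr_hom (s.w f) (v j t d)) } }
  have hr : ∀ s t j d, hc'.desc (r s t) ((c.ι.app j k₀).app (.op (x.unop k₀)) d) =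
      s.ι.app j (v j t d) := fun s t j d => ConcreteCategory.congr_hom (hc'.fac (r s t) j) d
  refine IsColimit.mk (fun s => ↾ (fun t => hc'.desc (r s t) (t k₀))) (fun s j => ?_)
    (fun s m hm => ?_)
  · ext w
    exact (hr s _ j (w k₀)).trans (congrArg (s.ι.app j) (hleg j w))
  · ext t
    obtain ⟨j, d, hd⟩ := Types.jointly_surjective_of_isColimit hc' (t k₀)
    have ht : ((extProd X).map (c.ι.app j)).app x (v j t d) = t := by
      funext k
      by_cases hk : k = k₀
      · subst hk
        exact (congrArg _ (hv₀ j t d)).trans hd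
      · exact hv j t d k hk
    refine (congrArg m ht).symm.trans ?_
    refine (ConcreteCategory.congr_hom (hm j) (v j t d)).trans ?_
    refine (hr s t j d).symm.trans ?_
    exact congrArg (hc'.desc (r s t)) hd

end ExtProd

/-! ### The external product and left Kan extensions along `y, …, y` -/

section PiLan

variable {ι : Type} {X : ι → Type u} [∀ k, Category.{u} (X k)]

/-- The external product of representables is representable. -/
def extProdYoneda (X : ι → Type u) [∀ k, Category.{u} (X k)] :
    Functor.pi (fun k => yoneda (C := X k)) ⋙ extProd X ≅ yoneda :=
  NatIso.ofComponents (fun x => NatIso.ofComponents (fun y =>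
    (Iso.refl (∀ k, y.unop k ⟶ x k) : ((extProd X).obj (fun k => yoneda.obj (x k))).obj y ≅
      (yoneda.obj x).obj y)) (fun _ => rfl)) (fun _ => rfl)

/-- A family of maps `y(xₖ) → pₖ` amounts to a map from `y(x)` to the external product of `p`. -/
def extProdHomEquiv (x : ∀ k, X k) (p : ∀ k, (X k)ᵒᵖ ⥤ Type u) :
    ((fun k => yoneda.obj (x k)) ⟶ p) ≃ (yoneda.obj x ⟶ (extProd X).obj p) where
  toFun b := (extProdYoneda X).inv.app x ≫ (extProd X).map b
  invFun a k := yonedaEquiv.symm (yonedaEquiv a k)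
  left_inv b := by
    funext k
    refine yonedaEquiv.injective ((Equiv.apply_symm_apply _ _).trans ?_)
    rfl
  right_inv a := by
    refine yonedaEquiv.injective ?_
    funext k
    exact ConcreteCategory.congr_hom ((p k).map_id _) _

universe w v
variable {Z : Type w} [Category.{v} Z]

/-- The external product followed by a cocontinuous functor is the left Kan extension of its
restriction to families of representables: by `extProdHomEquiv`, the elements of the external
product of `p` are the arrows from families of representables to `p`. -/
theorem isLeftKanExtension_extProd_comp {X : ι → Cat.{u, u}}
    (L : ((∀ k, X k)ᵒᵖ ⥤ Type u) ⥤ Z) [PreservesColimitsOfSize.{u, u} L]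
    {f : (∀ k, J (X k)) ⥤ Z}
    (φ : f ≅ Functor.pi (fun k => yon (X k)) ⋙ extProd (fun k => X k) ⋙ L) :
    Functor.IsLeftKanExtension (L := Functor.pi (fun k => yon (X k)))
      (extProd (fun k => X k) ⋙ L) φ.hom := by
  refine Functor.LeftExtension.IsPointwiseLeftKanExtension.isLeftKanExtension
      (E := Functor.LeftExtension.mk _ φ.hom) ?_
  intro P
  let p : ∀ k, (X k)ᵒᵖ ⥤ Type u := P
  let q := (extProd (fun k => X k)).obj p
  have hc : IsColimit (L.mapCocone (Presheaf.tautologicalCocone q)) :=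
    isColimitOfPreserves _ (Presheaf.isColimitTautologicalCocone q)
  let up (x : ∀ k, X k) : ∀ k, J (X k) := fun k => J.up (x k)
  let ψ (x : ∀ k, X k) : L.obj (yoneda.obj x) ≅ f.obj (up x) :=
    L.mapIso ((extProdYoneda (fun k => X k)).symm.app x) ≪≫ φ.symm.app (up x)
  have hψ {x x' : ∀ k, X k} (l : x ⟶ x') :
      L.map (yoneda.map l) ≫ (ψ x').hom = (ψ x).hom ≫ f.map (X := up x) (Y := up x') l := by
    have h1 := congrArg L.map ((extProdYoneda (fun k => X k)).inv.naturality l)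
    have h2 := φ.inv.naturality (X := up x) (Y := up x') l
    refine (reassoc_of% ((L.map_comp _ _).symm.trans (h1.trans (L.map_comp _ _)))) _ |>.trans ?_
    exact (_ ≫= h2).trans (Category.assoc _ _ _).symm
  have hφ (x : ∀ k, X k) (b : (fun k => yoneda.obj (x k)) ⟶ p) :
      φ.hom.app (up x) ≫ L.map ((extProd (fun k => X k)).map b) =
        (ψ x).inv ≫ L.map (extProdHomEquiv x p b) := by
    refine Eq.trans ?_ (Category.assoc _ _ _).symm
    refine _ ≫= Eq.trans ?_ (L.map_comp _ _)
    exact congrArg L.map ((extProdYoneda (fun k => X k)).hom_inv_id_app_assoc x _).symm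
  let arr (j : CostructuredArrow yoneda q) :
      CostructuredArrow (Functor.pi (fun k => yon (X k))) P :=
    CostructuredArrow.mk (Y := up j.left) ((extProdHomEquiv j.left p).symm j.hom)
  let arrMap {j j' : CostructuredArrow yoneda q} (l : j ⟶ j') : arr j ⟶ arr j' :=
    CostructuredArrow.homMk (f := arr j) (f' := arr j') l.left
      ((extProdHomEquiv j.left p).injective
        ((congrArg (yoneda.map l.left ≫ ·)
          ((extProdHomEquiv j'.left p).apply_symm_apply j'.hom)).trans
          ((CostructuredArrow.w l).trans ((extProdHomEquiv j.left p).apply_symm_apply j.hom).symm)))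
  let t (s : Cocone (CostructuredArrow.proj (Functor.pi (fun k => yon (X k))) P ⋙ f)) :
      Cocone ((CostructuredArrow.proj yoneda q ⋙ yoneda) ⋙ L) :=
    { pt := s.pt
      ι := { app j := (ψ j.left).hom ≫ s.ι.app (arr j)
             naturality j j' l := by
               refine ((reassoc_of% (hψ l.left)) _).trans ?_
               exact (_ ≫= s.w (arrMap l)).trans (Category.comp_id _).symm } }
  have hs (s : Cocone (CostructuredArrow.proj (Functor.pi (fun k => yon (X k))) P ⋙ f))
      (x : ∀ k, X k) (b : (fun k => yoneda.obj (x k)) ⟶ p) {m : L.obj q ⟶ s.pt} :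
      φ.hom.app (up x) ≫ L.map ((extProd (fun k => X k)).map b) ≫ m =
        s.ι.app (CostructuredArrow.mk (Y := up x) b) ↔
      L.map (extProdHomEquiv x p b) ≫ m =
        (ψ x).hom ≫ s.ι.app (CostructuredArrow.mk (Y := up x) b) := by
    exact (Eq.congr_left ((reassoc_of% (hφ x b)) m)).trans (ψ x).inv_comp_eq
  refine IsColimit.mk (fun s => hc.desc (t s)) (fun s j => ?_) (fun s m hm => ?_)
  · let x : ∀ k, X k := fun k => (j.left k).down
    refine (Category.assoc _ _ _).trans ((hs s x j.hom).2 ?_)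
    refine (hc.fac (t s) (CostructuredArrow.mk (Y := x) (extProdHomEquiv x p j.hom))).trans ?_
    let σ (b : (fun k => yoneda.obj (x k)) ⟶ p) : f.obj (up x) ⟶ s.pt :=
      s.ι.app (CostructuredArrow.mk (Y := up x) b)
    exact _ ≫= congrArg σ ((extProdHomEquiv x p).symm_apply_apply j.hom)
  · refine hc.hom_ext (fun j => Eq.trans ?_ (hc.fac (t s) j).symm)
    have h := (hs s j.left ((extProdHomEquiv j.left p).symm j.hom)).1
      ((Category.assoc _ _ _).symm.trans (hm (arr j)))
    rw [Equiv.apply_symm_apply] at h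
    exact h

end PiLan

/-! ### Extension of multimorphisms to presheaves -/

section MultiLan

variable {ι : Type} {X : ι → Cat.{u, u}} {Y : Cat.{u, u}}

/-- The separately cocontinuous extension of `f` is the external product followed by the
cocontinuous extension of `f`, regarded as a functor on the small category `∏ₖ Xₖ`. -/
theorem exists_isSepCocont_lan (f : (∀ k, J (X k)) ⥤ Psh Y) :
    ∃ (F : (∀ k, Psh (X k)) ⥤ Psh Y) (φ : f ≅ Functor.pi (fun k => yon (X k)) ⋙ F),
      IsSepCocont.{u} F ∧ F.IsLeftKanExtension φ.hom := by
  have : HasColimitsOfSize.{u, u} (Psh Y) :=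
    inferInstanceAs (HasColimitsOfSize.{u, u} (Yᵒᵖ ⥤ Type u))
  let f' : (∀ k, X k) ⥤ Psh Y := Functor.pi (fun k => J.upFunctor (X k)) ⋙ f
  let L := (uliftYoneda.{u} (C := ∀ k, X k)).lan.obj f'
  have : PreservesColimitsOfSize.{u, u} L := preservesColimits_leftKanExtension_uliftYoneda f'
  have := isIso_lanUnit_uliftYoneda f'
  let φ : f' ≅ Functor.pi (fun k => yoneda (C := X k)) ⋙ extProd (fun k => X k) ⋙ L :=
    asIso (uliftYoneda.{u}.lanUnit.app f') ≪≫
      Functor.isoWhiskerRight (uliftYonedaIsoYoneda.{u, u, u} ≪≫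
        (extProdYoneda (fun k => X k)).symm) L
  let φ' : f ≅ Functor.pi (fun k => yon (X k)) ⋙ extProd (fun k => X k) ⋙ L :=
    Functor.isoWhiskerLeft (Functor.pi (fun k => J.downFunctor (X k))) φ
  exact ⟨extProd (fun k => X k) ⋙ L, φ', isSepCocont_extProd.comp L,
    isLeftKanExtension_extProd_comp L φ'⟩

variable [Finite ι]

/-- A separately cocontinuous functor is a left Kan extension of its restriction to families of
representables. -/
theorem IsSepCocont.isLeftKanExtension {F : (∀ k, Psh (X k)) ⥤ Psh Y} (hF : IsSepCocont.{u} F)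
    {f : (∀ k, J (X k)) ⥤ Psh Y} (φ : f ≅ Functor.pi (fun k => yon (X k)) ⋙ F) :
    F.IsLeftKanExtension φ.hom := by
  obtain ⟨F', φ', hF', h⟩ := exists_isSepCocont_lan f
  let d := Functor.descOfIsLeftKanExtension F' φ'.hom F φ.hom
  have hd : φ'.hom ≫ Functor.whiskerLeft _ d = φ.hom :=
    Functor.descOfIsLeftKanExtension_fac F' φ'.hom F φ.hom
  have hd' : Functor.whiskerLeft _ d = φ'.inv ≫ φ.hom := (Iso.eq_inv_comp φ').2 hd
  have : IsIso (Functor.whiskerLeft (Functor.pi (fun k => yon (X k))) d) := by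
    rw [hd']
    infer_instance
  have : IsIso d := IsSepCocont.isIso (X := fun k => X k) hF' hF d (fun x =>
    inferInstanceAs (IsIso ((Functor.whiskerLeft (Functor.pi (fun k => yon (X k))) d).app
      (fun k => J.up (x k)))))
  exact Functor.isLeftKanExtension_of_iso (asIso d) φ'.hom φ.hom hd

variable {F H : (∀ k, Psh (X k)) ⥤ Psh Y} {f : (∀ k, J (X k)) ⥤ Psh Y}

namespace IsSepCocont

/-- The 2-cell `F → H` with prescribed restriction to families of representables. -/
noncomputable def desc (hF : IsSepCocont.{u} F) (φ : f ≅ Functor.pi (fun k => yon (X k)) ⋙ F)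
    (ψ : f ⟶ Functor.pi (fun k => yon (X k)) ⋙ H) : F ⟶ H :=
  have := hF.isLeftKanExtension φ
  Functor.descOfIsLeftKanExtension F φ.hom H ψ

theorem unit_desc (hF : IsSepCocont.{u} F) (φ : f ≅ Functor.pi (fun k => yon (X k)) ⋙ F)
    (ψ : f ⟶ Functor.pi (fun k => yon (X k)) ⋙ H) :
    φ.hom ≫ Functor.whiskerLeft (Functor.pi (fun k => yon (X k))) (hF.desc φ ψ) = ψ :=
  have := hF.isLeftKanExtension φ
  Functor.descOfIsLeftKanExtension_fac F φ.hom H ψ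

theorem unit_desc_app (hF : IsSepCocont.{u} F) (φ : f ≅ Functor.pi (fun k => yon (X k)) ⋙ F)
    (ψ : f ⟶ Functor.pi (fun k => yon (X k)) ⋙ H) (x : ∀ k, J (X k)) :
    φ.hom.app x ≫ (hF.desc φ ψ).app (fun k => (yon (X k)).obj (x k)) = ψ.app x :=
  NatTrans.congr_app (hF.unit_desc φ ψ) x

theorem hom_ext_unit (hF : IsSepCocont.{u} F) (φ : f ≅ Functor.pi (fun k => yon (X k)) ⋙ F)
    {α β : F ⟶ H} (h : ∀ x, φ.hom.app x ≫ α.app (fun k => (yon (X k)).obj (x k)) =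
      φ.hom.app x ≫ β.app (fun k => (yon (X k)).obj (x k))) : α = β :=
  have := hF.isLeftKanExtension φ
  Functor.hom_ext_of_isLeftKanExtension F φ.hom α β (NatTrans.ext (funext h))

/-- The isomorphism `F ≅ H` with prescribed restriction to families of representables. -/
noncomputable def descIso (hF : IsSepCocont.{u} F) (φ : f ≅ Functor.pi (fun k => yon (X k)) ⋙ F)
    (hH : IsSepCocont.{u} H) (ψ : f ≅ Functor.pi (fun k => yon (X k)) ⋙ H) : F ≅ H where
  hom := hF.desc φ ψ.hom
  inv := hH.desc ψ φ.hom
  hom_inv_id := hF.hom_ext_unit φ fun x =>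
    ((reassoc_of% (hF.unit_desc_app φ ψ.hom x)) _).trans
      ((hH.unit_desc_app ψ φ.hom x).trans (Category.comp_id _).symm)
  inv_hom_id := hH.hom_ext_unit ψ fun x =>
    ((reassoc_of% (hH.unit_desc_app ψ φ.hom x)) _).trans
      ((hF.unit_desc_app φ ψ.hom x).trans (Category.comp_id _).symm)

end IsSepCocont

end MultiLan

section PshMap

variable {ι : Type} {X : ι → Cat.{u, u}} {Y : Cat.{u, u}}

/-- The separately cocontinuous extension `Psh X₁, …, Psh Xₙ → Psh Y` of a multimorphism
`f : X₁, …, Xₙ → Y`. -/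
noncomputable def pshMap (f : (∀ k, J (X k)) ⥤ J Y) : (∀ k, Psh (X k)) ⥤ Psh Y :=
  (exists_isSepCocont_lan (f ⋙ yon Y)).choose

/-- The cell `y ∘ f ≅ pshMap f ∘ (y, …, y)`. -/
noncomputable def pshUnit (f : (∀ k, J (X k)) ⥤ J Y) :
    f ⋙ yon Y ≅ Functor.pi (fun k => yon (X k)) ⋙ pshMap f :=
  (exists_isSepCocont_lan (f ⋙ yon Y)).choose_spec.choose

theorem isSepCocont_pshMap (f : (∀ k, J (X k)) ⥤ J Y) : IsSepCocont.{u} (pshMap f) :=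
  (exists_isSepCocont_lan (f ⋙ yon Y)).choose_spec.choose_spec.1

variable [Finite ι]

/-- The action of `pshMap` on 2-cells. -/
noncomputable def pshMap₂ {f f' : (∀ k, J (X k)) ⥤ J Y} (α : f ⟶ f') : pshMap f ⟶ pshMap f' :=
  (isSepCocont_pshMap f).desc (pshUnit f) (Functor.whiskerRight α (yon Y) ≫ (pshUnit f').hom)

theorem pshUnit_map₂ {f f' : (∀ k, J (X k)) ⥤ J Y} (α : f ⟶ f') (x : ∀ k, J (X k)) :
    (pshUnit f).hom.app x ≫ (pshMap₂ α).app (fun k => (yon (X k)).obj (x k)) =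
      (yon Y).map (α.app x) ≫ (pshUnit f').hom.app x :=
  (isSepCocont_pshMap f).unit_desc_app _ _ x

theorem pshMap_hom_ext {f : (∀ k, J (X k)) ⥤ J Y} {H : (∀ k, Psh (X k)) ⥤ Psh Y}
    {α β : pshMap f ⟶ H}
    (h : ∀ x, (pshUnit f).hom.app x ≫ α.app (fun k => (yon (X k)).obj (x k)) =
      (pshUnit f).hom.app x ≫ β.app (fun k => (yon (X k)).obj (x k))) : α = β :=
  (isSepCocont_pshMap f).hom_ext_unit (pshUnit f) h

/-- The cell `pshMap 1 ≅ 1`. -/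
noncomputable def pshMapId (X : Cat.{u, u}) :
    pshMap (X := fun _ : Unit => X) (idMap (J X)) ≅ idMap (Psh X) :=
  (isSepCocont_pshMap _).descIso (pshUnit _) (isSepCocont_idMap (Psh X))
    (Iso.refl (idMap (J X) ⋙ yon X))

theorem pshUnit_mapId {X : Cat.{u, u}} (x : Unit → J X) :
    (pshUnit (X := fun _ : Unit => X) (idMap (J X))).hom.app x ≫
      (pshMapId X).hom.app (fun k => (yon X).obj (x k)) = 𝟙 ((yon X).obj (x ())) :=
  (isSepCocont_pshMap _).unit_desc_app _ _ x

end PshMap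

section PshMapComp

variable {ι κ : Type} [Finite κ] {fib : ι → Type} {X : ι → Cat.{u, u}} {Y : Cat.{u, u}}
  (e : ∀ k, fib k → κ)
  (he : IsConcat e) {W : κ → Cat.{u, u}} (f : (∀ k, J (X k)) ⥤ J Y)
  (g : ∀ k, (∀ m : fib k, J (W (e k m))) ⥤ J (X k))

/-- The cell `pshMap (f ∘ (g₁, …, gₙ)) ≅ pshMap f ∘ (pshMap g₁, …, pshMap gₙ)`. -/
noncomputable def pshMapComp :
    pshMap (fcomp e (W := fun m => J (W m)) (X := fun k => J (X k)) f g) ≅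
      fcomp e (W := fun m => Psh (W m)) (X := fun k => Psh (X k)) (pshMap f)
        (fun k => pshMap (g k)) :=
  (isSepCocont_pshMap _).descIso (pshUnit _)
    ((isSepCocont_pshMap f).fcomp he (fun k => isSepCocont_pshMap (g k)))
    (Functor.isoWhiskerLeft (tuple e (W := fun m => J (W m)) (X := fun k => J (X k)) g)
        (pshUnit f) ≪≫
      Functor.isoWhiskerRight (NatIso.pi' (fun k =>
        Functor.isoWhiskerLeft (Pi.comap (fun m => ↑(J (W m))) (e k)) (pshUnit (g k))) :
        tuple e (W := fun m => J (W m)) (X := fun k => J (X k)) g ⋙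
          Functor.pi (fun k => yon (X k)) ≅
        Functor.pi (fun k => yon (W k)) ⋙ tuple e (W := fun m => Psh (W m))
          (X := fun k => Psh (X k)) (fun k => pshMap (g k))) (pshMap f))

theorem pshUnit_mapComp (w : ∀ m, J (W m)) :
    (pshUnit (fcomp e (W := fun m => J (W m)) (X := fun k => J (X k)) f g)).hom.app w ≫
        (pshMapComp e he f g).hom.app (fun m => (yon (W m)).obj (w m)) =
      (pshUnit f).hom.app (fun k => (g k).obj (fun m => w (e k m))) ≫
        (pshMap f).map (fun k => (pshUnit (g k)).hom.app (fun m => w (e k m))) :=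
  (isSepCocont_pshMap _).unit_desc_app _ _ w

end PshMapComp

/-! ### The pseudo-multifunctor -/

/-- Extension of multimorphisms to presheaves, as a pseudo-multifunctor. -/
noncomputable def pshMultifunctor : PseudoMultifunctor Psh.{u} where
  map X Y :=
    { obj f := pshMap f
      map α := pshMap₂ α
      map_id f := pshMap_hom_ext fun x => by
        refine (pshUnit_map₂ (𝟙 f) x).trans ?_
        exact (((yon Y).map_id _) =≫ _).trans
          ((Category.id_comp _).trans (Category.comp_id _).symm)
      map_comp {f f' f''} α β := pshMap_hom_ext fun x => by
        refine (pshUnit_map₂ (α ≫ β) x).trans ?_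
        refine Eq.trans ?_ (whisker_square (pshUnit_map₂ α x) _).symm
        refine Eq.trans ?_ (_ ≫= (pshUnit_map₂ β x).symm)
        exact (((yon Y).map_comp _ _) =≫ _).trans (Category.assoc _ _ _) }
  mapId := pshMapId
  mapComp e he _ _ _ f g := pshMapComp e he f g
  mapComp_naturality_left {ι κ _ _ fib _} e he {W X Y f f'} α g := pshMap_hom_ext fun w => by
    refine (whisker_square (pshUnit_map₂ (fcompL e (W := fun m => J (W m)) (X := fun k => J (X k))
      α g) w) _).trans ?_
    refine (_ ≫= pshUnit_mapComp e he f' g w).trans ?_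
    refine Eq.trans ?_ (whisker_square (pshUnit_mapComp e he f g w) _).symm
    refine Eq.trans ?_ (_ ≫= ((pshMap₂ α).naturality _).symm)
    exact (whisker_square (pshUnit_map₂ α (fun k => (g k).obj (fun m => w (e k m)))) _).symm
  mapComp_naturality_right {ι κ _ _ fib _} e he {W X Y} f {g g'} β := pshMap_hom_ext fun w => by
    refine (whisker_square (pshUnit_map₂ (fcompR e (W := fun m => J (W m)) (X := fun k => J (X k))
      f β) w) _).trans ?_
    refine (_ ≫= pshUnit_mapComp e he f g' w).trans ?_
    refine Eq.trans ?_ (whisker_square (pshUnit_mapComp e he f g w) _).symm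
    refine (whisker_square ((pshUnit f).hom.naturality
      (X := fun k => (g k).obj (fun m => w (e k m))) (Y := fun k => (g' k).obj (fun m => w (e k m)))
      (fun k => (β k).app (fun m => w (e k m)))) _).trans ?_
    refine _ ≫= (((pshMap f).map_comp _ _).symm.trans
      (Eq.trans ?_ ((pshMap f).map_comp _ _)))
    exact congrArg (pshMap f).map (funext fun k =>
      (pshUnit_map₂ (β k) (fun m => w (e k m))).symm)
  id_comp {κ _ X Y} f := pshMap_hom_ext fun x => by
    refine (whisker_square (pshUnit_mapComp (fun (_ : Unit) (m : κ) => m) (isConcat_id κ)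
      (X := fun _ => Y) (W := X) (idMap (J Y)) (fun _ => f) x) _).trans ?_
    refine (_ ≫= (pshMapId Y).hom.naturality _).trans ?_
    exact (whisker_triangle (pshUnit_mapId (fun _ => f.obj x)) _).trans (Category.comp_id _).symm
  comp_id {ι _ X Y} f := pshMap_hom_ext fun x => by
    refine (whisker_square (pshUnit_mapComp (fun (k : ι) (_ : Unit) => k) (isConcat_id' ι)
      (W := X) f (fun k => idMap (J (X k))) x) _).trans ?_
    refine _ ≫= (((pshMap f).map_comp _ _).symm.trans ?_)
    refine (congrArg (pshMap f).map (funext fun k => ?_)).trans ((pshMap f).map_id _)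
    exact pshUnit_mapId (fun _ => x k)
  assoc {ι κ ν _ _ _ fib _} e he {fib' _} e' he' {V W X Y} f g h := pshMap_hom_ext fun v => by
    refine (whisker_square (pshUnit_mapComp e' he'
      (fcomp e (W := fun m => J (W m)) (X := fun k => J (X k)) f g) h v) _).trans ?_
    refine (_ ≫= (pshMapComp e he f g).hom.naturality _).trans ?_
    refine (whisker_square (pshUnit_mapComp e he f g
      (fun l => (h l).obj (fun n => v (e' l n)))) _).trans ?_
    refine Eq.trans ?_ (whisker_square (pshUnit_mapComp
      (fun k (p : Σ m : fib k, fib' (e k m)) => e' (e k p.1) p.2) (isConcat_comp he he') f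
        (fun k => fcomp (fun (m : fib k) (n : fib' (e k m)) => Sigma.mk m n)
          (W := fun p => J (V (e' (e k p.1) p.2))) (X := fun m => J (W (e k m))) (g k)
          (fun m => h (e k m))) v) _).symm
    refine _ ≫= (((pshMap f).map_comp _ _).symm.trans
      (Eq.trans ?_ ((pshMap f).map_comp _ _)))
    refine congrArg (pshMap f).map (funext fun k => ?_)
    exact (pshUnit_mapComp (fun (m : fib k) (n : fib' (e k m)) => Sigma.mk m n)
      (isConcat_sigma _) (g k) (fun m => h (e k m)) (fun p => v (e' (e k p.1) p.2))).symm

/-! ### The multicategorical structure -/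

namespace LanChoice

variable (K : LanChoice.{u})

section Unary

variable {W X Y : Cat.{u, u}}

theorem preservesColimits_ext (h : J X ⥤ Psh Y) :
    PreservesColimitsOfSize.{u, u} ((K.strong.toRelPseudomonad.ext X Y).obj h) :=
  K.isCocontFst (Γ := .nil) (unary h) ⟨⟨⟨⟩⟩⟩

theorem eta_map_mu (f : J X ⥤ Psh Y) (g : J W ⥤ Psh X) (w : J W) :
    (K.strong.toRelPseudomonad.eta
        (g ⋙ (K.strong.toRelPseudomonad.ext X Y).obj f)).hom.app w ≫
        (K.strong.toRelPseudomonad.mu f g).hom.app ((yon W).obj w) =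
      ((K.strong.toRelPseudomonad.ext X Y).obj f).map
        ((K.strong.toRelPseudomonad.eta g).hom.app w) :=
  (whisker_triangle (K.unit_pn (Γ := .app .nil .nil) (Δ := .nil)
    (Functor.prod' (𝟭 _) (Ctx.bang .nil)) (mcomp (K.lan (unary f)) (unary g)) w ⟨⟨⟨⟩⟩⟩) _).trans
    (K.unit_hat (Γ := .nil) (Δ := .nil) (unary f) (unary g) w ⟨⟨⟨⟩⟩⟩ ⟨⟨⟨⟩⟩⟩)

theorem eta_theta (x : J X) :
    (K.strong.toRelPseudomonad.eta (yon X)).hom.app x ≫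
      (K.strong.toRelPseudomonad.theta X).hom.app ((yon X).obj x) = 𝟙 ((yon X).obj x) :=
  K.unit_theta x ⟨⟨⟨⟩⟩⟩

end Unary

variable {ι : Type} {X X' : ι → Cat.{u, u}} {Y Y' : Cat.{u, u}}
  {f : (∀ k, J (X k)) ⥤ J Y} {f' : (∀ k, J (X' k)) ⥤ J Y'} {g : ∀ k, J (X k) ⥤ Psh (X' k)}
  {h : J Y ⥤ Psh Y'}

/-- The cell `h ∘ f ≅ h^* ∘ pshMap f ∘ (y, …, y)`. -/
noncomputable def extUnit (f : (∀ k, J (X k)) ⥤ J Y) (h : J Y ⥤ Psh Y') :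
    f ⋙ h ≅ Functor.pi (fun k => yon (X k)) ⋙ pshMap f ⋙
      (K.strong.toRelPseudomonad.ext Y Y').obj h :=
  Functor.isoWhiskerLeft f (K.strong.toRelPseudomonad.eta h) ≪≫
    Functor.isoWhiskerRight (pshUnit f) ((K.strong.toRelPseudomonad.ext Y Y').obj h)

theorem isSepCocont_pshMap_comp_ext (f : (∀ k, J (X k)) ⥤ J Y) (h : J Y ⥤ Psh Y') :
    IsSepCocont.{u} (pshMap f ⋙ (K.strong.toRelPseudomonad.ext Y Y').obj h) :=
  have := K.preservesColimits_ext h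
  (isSepCocont_pshMap f).comp _

variable [Finite ι]

/-- The cell `α^*`, determined by `extUnit_extCell`. -/
noncomputable def extCell (α : f ⋙ h ⟶ Functor.pi g ⋙ pshMap f') :
    pshMap f ⋙ (K.strong.toRelPseudomonad.ext Y Y').obj h ⟶
      Functor.pi (fun k => (K.strong.toRelPseudomonad.ext (X k) (X' k)).obj (g k)) ⋙ pshMap f' :=
  (K.isSepCocont_pshMap_comp_ext f h).desc (K.extUnit f h)
    (α ≫ Functor.whiskerRight
      (NatTrans.pi (fun k => (K.strong.toRelPseudomonad.eta (g k)).hom)) (pshMap f'))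

theorem extUnit_extCell (α : f ⋙ h ⟶ Functor.pi g ⋙ pshMap f') (x : ∀ k, J (X k)) :
    (K.strong.toRelPseudomonad.eta h).hom.app (f.obj x) ≫
        ((K.strong.toRelPseudomonad.ext Y Y').obj h).map ((pshUnit f).hom.app x) ≫
        (K.extCell α).app (fun k => (yon (X k)).obj (x k)) =
      α.app x ≫ (pshMap f').map (fun k => (K.strong.toRelPseudomonad.eta (g k)).hom.app (x k)) :=
  (Category.assoc _ _ _).symm.trans
    ((K.isSepCocont_pshMap_comp_ext f h).unit_desc_app (K.extUnit f h) _ x)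

theorem extCell_hom_ext {H : (∀ k, Psh (X k)) ⥤ Psh Y'}
    {α β : pshMap f ⋙ (K.strong.toRelPseudomonad.ext Y Y').obj h ⟶ H}
    (w : ∀ x, (K.strong.toRelPseudomonad.eta h).hom.app (f.obj x) ≫
        ((K.strong.toRelPseudomonad.ext Y Y').obj h).map ((pshUnit f).hom.app x) ≫
        α.app (fun k => (yon (X k)).obj (x k)) =
      (K.strong.toRelPseudomonad.eta h).hom.app (f.obj x) ≫
        ((K.strong.toRelPseudomonad.ext Y Y').obj h).map ((pshUnit f).hom.app x) ≫
        β.app (fun k => (yon (X k)).obj (x k))) : α = β :=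
  (K.isSepCocont_pshMap_comp_ext f h).hom_ext_unit (K.extUnit f h) fun x =>
    (Category.assoc _ _ _).trans ((w x).trans (Category.assoc _ _ _).symm)

/-- The relative pseudomonad of presheaves is multicategorical. -/
noncomputable def multicategorical : K.strong.toRelPseudomonad.Multicategorical where
  F := pshMultifunctor
  unitCell := pshUnit
  unitCell_naturality α := NatTrans.ext (funext fun x => (pshUnit_map₂ α x).symm)
  extCell := K.extCell
  eta_compat α := NatTrans.ext (funext fun x => K.extUnit_extCell α x)
  mu_compat {ι _ X X' X'' Y Y' Y'' f f' f'' g g' h h'} α β := K.extCell_hom_ext fun x => by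
    refine (_ ≫= whisker_square ((K.strong.toRelPseudomonad.mu h' h).hom.naturality
      ((pshUnit f).hom.app x)) _).trans ?_
    refine (whisker_triangle (K.eta_map_mu h' h (f.obj x)) _).trans ?_
    refine (map_whisker_pentagon ((K.strong.toRelPseudomonad.ext Y' Y'').obj h')
      (K.extUnit_extCell α x) _).trans ?_
    refine (_ ≫= (K.extCell β).naturality _).trans ?_
    refine Eq.trans ?_ (whisker_pentagon (K.extUnit_extCell (f := f) (f' := f'')
      (g := fun k => g k ⋙ (K.strong.toRelPseudomonad.ext (X' k) (X'' k)).obj (g' k))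
      (h := h ⋙ (K.strong.toRelPseudomonad.ext Y' Y'').obj h')
      (Functor.whiskerRight α ((K.strong.toRelPseudomonad.ext Y' Y'').obj h') ≫
        Functor.whiskerLeft (Functor.pi g) (K.extCell β)) x) _).symm
    refine Eq.trans ?_ (Category.assoc _ _ _).symm
    refine _ ≫= (_ ≫= (Eq.trans ?_ ((pshMap f'').map_comp _ _)))
    exact congrArg (pshMap f'').map (funext fun k => (K.eta_map_mu (g' k) (g k) (x k)).symm)
  theta_compat {ι _ X Y} f := K.extCell_hom_ext fun x => by
    refine (whisker_pentagon (K.extUnit_extCell (pshUnit f).hom x) _).trans ?_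
    have h1 := (K.strong.toRelPseudomonad.theta Y).hom.naturality ((pshUnit f).hom.app x)
    refine Eq.trans ?_ (_ ≫= h1).symm
    refine Eq.trans ?_ (whisker_triangle (K.eta_theta (f.obj x)) _).symm
    refine Eq.trans (_ ≫= ?_) ((Category.comp_id _).trans (Category.id_comp _).symm)
    refine ((pshMap f).map_comp _ _).symm.trans (Eq.trans ?_ ((pshMap f).map_id _))
    exact congrArg (pshMap f).map (funext fun k => K.eta_theta (x k))

end LanChoice

end RelPsh

theorem mainTheorem4 :
    Nonempty RelPsh.LanChoice.{u} ∧
    ∀ K : RelPsh.LanChoice.{u}, ∃ S : RelPsh.StrongRelPseudomonad.{u} RelPsh.Psh RelPsh.yon,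
      S.StrengthIsLan K ∧
      S.IsLaxIdempotent ∧
      Nonempty S.Pseudocommutativity ∧
      Nonempty S.toRelPseudomonad.Multicategorical := by
  exact ⟨RelPsh.LanChoice.nonempty, fun K => ⟨K.strong, K.strengthIsLan, K.isLaxIdempotent,
    K.nonempty_pseudocommutativity, ⟨K.multicategorical⟩⟩⟩
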